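/- **Setting.** Let $\nu,\mu>0$. The Beurling type Gelfand–Shilov space $\Sigma_\nu^\mu(\mathbf R^d)$ is the space of all $f\in C^\infty(\mathbf R^d)$ such that $$\sup_{x\in\mathbf R^d,\ \alpha,\beta\in\mathbf N^d}\frac{|x^\alpha D^\beta f(x)|}{h^{|\alpha+\beta|}\,\alpha!^\nu\,\beta!^\mu}<\infty\qquad\text{for all } h>0,$$ where $D_j=-i\partial_j$, with the topology of these norms for $h>0$. Its dual $(\Sigma_\nu^\mu)'(\mathbf R^d)$, the space of continuous conjugate linear functionals $\phi\mapsto(u,\phi)$, carries the weak$^*$ topology, and a function $f\in\Sigma_\nu^\mu(\mathbf R^d)$ (or $f\in\mathscr S(\mathbf R^d)$) is identified with $\phi\mapsto\int f\,\overline\phi\,dx$. Write $T_xf(y)=f(y-x)$, $M_\xi f(y)=e^{i\langle y,\xi\rangle}f(y)$ and $\mathscr Ff(\xi)=\widehat f(\xi)=(2\pi)^{-d/2}\int f(x)e^{-i\langle x,\xi\rangle}\,dx$. For $u\in(\Sigma_\nu^\mu)'(\mathbf R^d)$ and a window $\varphi\in\Sigma_\nu^\mu(\mathbf R^d)\setminus\{0\}$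 put $V_\varphi u(x,\xi)=(2\pi)^{-d/2}(u,M_\xi T_x\varphi)$. The wave front set $\mathrm{WF}^{\nu,\mu}(u)\subseteq\mathbf R^{2d}\setminus\{0\}$ is defined by: a point $z_0\in\mathbf R^{2d}\setminus\{0\}$ satisfies $z_0\notin\mathrm{WF}^{\nu,\mu}(u)$ if and only if there is an open set $U\subseteq\mathbf R^{2d}\setminus\{0\}$ containing $z_0$ such that $$\sup_{\lambda>0,\ (x,\xi)\in U}e^{r\lambda}\,|V_\varphi u(\lambda^\nu x,\lambda^\mu\xi)|<\infty\qquad\text{for all } r>0.$$ Let $p(\xi)=\sum_{j=1}^dp_j(\xi_j)$, where $p_1,\dots,p_d$ are real polynomials in one variable with $m=\max_j\deg p_j\ge2$, and let $P_m(\xi)=\sum_{j:\,\deg p_j=m}c_{j,m}\xi_j^m$, where $c_{j,m}$ is the leading coefficient of $p_j$, be the principal part of $p$, with Hamilton flow $\chi_t(x,\xi)=(x+t\nabla P_m(\xi),\xi)$. Let $v\in\mathbf R^d$ with $v_j\ne0$ for all $j$, let $q_j$ be polynomials with $q_j'=p_j$, and let $$\varphi_t(\xi)=\sum_{j=1}^dv_j^{-1}\bigl(q_j(\xi_j-tv_j)-q_j(\xi_j)\bigr),\qquad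 \mathscr K_tf=M_{-tv}\,\mathscr F^{-1}\bigl(e^{i\varphi_t}\widehat f\,\bigr),\quad f\in\mathscr S(\mathbf R^d),\ t\in\mathbf R,$$ be the solution operator $\mathscr K_t:\mathscr S(\mathbf R^d)\to\mathscr S(\mathbf R^d)$ of the evolution equation $\partial_tu+i\bigl(p(D_x)+\langle v,x\rangle\bigr)u=0$, $u(0,\cdot)=f$. **Theorem.** Suppose $\nu\ge\mu(m-1)>1$ and $t\in\mathbf R$. Then $\mathscr K_t$ restricts to a continuous linear operator on $\Sigma_\nu^\mu(\mathbf R^d)$, and $\mathscr K_t$ extends to a continuous linear operator on $(\Sigma_\nu^\mu)'(\mathbf R^d)$, again denoted $\mathscr K_t$, which is uniquely determined by its values on $\Sigma_\nu^\mu(\mathbf R^d)$. For all $u\in(\Sigma_\nu^\mu)'(\mathbf R^d)$, and for any choice of the windows that define the wave front sets on the two sides, $$\mathrm{WF}^{\nu,\mu}(\mathscr K_tu)=\chi_t\bigl(\mathrm{WF}^{\nu,\mu}(u)\bigr)\quad\text{if }\nu=\mu(m-1),\qquad \mathrm{WF}^{\nu,\mu}(\mathscr K_tu)=\mathrm{WF}^{\nu,\mu}(u)\quad\text{if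 }\nu>\mu(m-1).$$ -/

import Mathlib

open MeasureTheory Complex
open scoped ContDiff SchwartzMap ComplexConjugate

noncomputable section

/-- The configuration space `ℝᵈ` with its Euclidean structure. -/
abbrev Rd (d : ℕ) : Type := EuclideanSpace ℝ (Fin d)

namespace GS

variable {d : ℕ}

/-- The operator `D_j = -i ∂_j`. -/
def D (j : Fin d) (f : Rd d → ℂ) : Rd d → ℂ :=
  fun x => -I * fderiv ℝ f x (EuclideanSpace.single j 1)

/-- The iterated operators `D_j ^ β_j`, for `j` in a list of indices. -/
def listD (l : List (Fin d)) (β : Fin d → ℕ) (f : Rd d → ℂ) : Rd d → ℂ :=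
  l.foldr (fun j g => (D j)^[β j] g) f

/-- `D^β = D_1^{β_1} ⋯ D_d^{β_d}` for a multi-index `β`. -/
def multiD (β : Fin d → ℕ) (f : Rd d → ℂ) : Rd d → ℂ :=
  listD (List.finRange d) β f

/-- The monomial `x^α`. -/
def monomial (α : Fin d → ℕ) (x : Rd d) : ℝ := ∏ j, x j ^ α j

/-- The length `|α|` of a multi-index. -/
def len (α : Fin d → ℕ) : ℕ := ∑ j, α j

/-- The factorial `α!` of a multi-index. -/
def fact (α : Fin d → ℕ) : ℕ := ∏ j, (α j).factorial

/-- The denominator `h^{|α+β|} α!^ν β!^μ`. -/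
def weight (ν μ h : ℝ) (α β : Fin d → ℕ) : ℝ :=
  h ^ len (α + β) * (fact α : ℝ) ^ ν * (fact β : ℝ) ^ μ

/-- The quotient `|x^α D^β f(x)| / (h^{|α+β|} α!^ν β!^μ)`. -/
def quot (ν μ h : ℝ) (f : Rd d → ℂ) (p : Rd d × (Fin d → ℕ) × (Fin d → ℕ)) : ℝ :=
  ‖(monomial p.2.1 p.1 : ℂ) * multiD p.2.2 f p.1‖ / weight ν μ h p.2.1 p.2.2

/-- `f` is smooth and `sup_{x,α,β} |x^α D^β f(x)| / (h^{|α+β|} α!^ν β!^μ) < ∞` for all `h > 0`. -/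
def Mem (ν μ : ℝ) (f : Rd d → ℂ) : Prop :=
  ContDiff ℝ ∞ f ∧ ∀ h : ℝ, 0 < h → BddAbove (Set.range (quot ν μ h f))

theorem weight_pos (ν μ : ℝ) {h : ℝ} (hh : 0 < h) (α β : Fin d → ℕ) : 0 < weight ν μ h α β := by
  have h1 : ∀ γ : Fin d → ℕ, (0 : ℝ) < fact γ := fun γ => by
    unfold fact
    exact_mod_cast Finset.prod_pos fun j _ => Nat.factorial_pos _
  unfold weight
  have := h1 α
  have := h1 β
  positivity

theorem quot_nonneg (ν μ : ℝ) {h : ℝ} (hh : 0 < h) (f : Rd d → ℂ)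
    (p : Rd d × (Fin d → ℕ) × (Fin d → ℕ)) : 0 ≤ quot ν μ h f p :=
  div_nonneg (norm_nonneg _) (weight_pos ν μ hh _ _).le

theorem bdd_iff (ν μ : ℝ) {h : ℝ} (hh : 0 < h) (f : Rd d → ℂ) :
    BddAbove (Set.range (quot ν μ h f)) ↔ ∃ C, 0 ≤ C ∧ ∀ x α β,
      |monomial α x| * ‖multiD β f x‖ ≤ C * weight ν μ h α β := by
  constructor
  · rintro ⟨C, hC⟩
    refine ⟨C, (quot_nonneg ν μ hh f (0, 0, 0)).trans (hC ⟨_, rfl⟩), fun x α β => ?_⟩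
    have := hC ⟨(x, α, β), rfl⟩
    simp only [quot] at this
    rw [div_le_iff₀ (weight_pos ν μ hh _ _)] at this
    simpa using this
  · rintro ⟨C, -, hC⟩
    refine ⟨C, ?_⟩
    rintro _ ⟨⟨x, α, β⟩, rfl⟩
    simp only [quot]
    rw [div_le_iff₀ (weight_pos ν μ hh _ _)]
    simpa using hC x α β

theorem multiD_zero (f : Rd d → ℂ) : multiD 0 f = f := by
  have : ∀ l : List (Fin d), listD l 0 f = f := fun l => by
    induction l with
    | nil => rfl
    | cons j l ih => exact ih
  exact this _

theorem D_smooth (j : Fin d) {f : Rd d → ℂ} (hf : ContDiff ℝ ∞ f) : ContDiff ℝ ∞ (D j f) := by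
  unfold D
  have : ContDiff ℝ ∞ (fderiv ℝ f) := hf.fderiv_right (by simp)
  fun_prop

theorem D_iter_smooth (j : Fin d) (n : ℕ) {f : Rd d → ℂ} (hf : ContDiff ℝ ∞ f) :
    ContDiff ℝ ∞ ((D j)^[n] f) := by
  induction n with
  | zero => exact hf
  | succ n ih => rw [Function.iterate_succ_apply']; exact D_smooth j ih

theorem listD_smooth (l : List (Fin d)) (β : Fin d → ℕ) {f : Rd d → ℂ} (hf : ContDiff ℝ ∞ f) :
    ContDiff ℝ ∞ (listD l β f) := by
  induction l with
  | nil => exact hf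
  | cons j l ih => exact D_iter_smooth j _ ih

theorem D_add (j : Fin d) {f g : Rd d → ℂ} (hf : ContDiff ℝ ∞ f) (hg : ContDiff ℝ ∞ g) :
    D j (f + g) = D j f + D j g := by
  funext x
  have h1 : DifferentiableAt ℝ f x := (hf.differentiable (by simp)) x
  have h2 : DifferentiableAt ℝ g x := (hg.differentiable (by simp)) x
  simp [D, fderiv_add h1 h2, mul_add]

theorem D_smul (j : Fin d) (c : ℂ) {f : Rd d → ℂ} (hf : ContDiff ℝ ∞ f) :
    D j (c • f) = c • D j f := by
  funext x
  have h1 : DifferentiableAt ℝ f x := (hf.differentiable (by simp)) x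
  simp only [D, fderiv_const_smul h1, Pi.smul_apply, smul_eq_mul, smul_apply]
  ring

theorem D_iter_add (j : Fin d) (n : ℕ) {f g : Rd d → ℂ} (hf : ContDiff ℝ ∞ f)
    (hg : ContDiff ℝ ∞ g) : (D j)^[n] (f + g) = (D j)^[n] f + (D j)^[n] g := by
  induction n with
  | zero => rfl
  | succ n ih =>
    simp only [Function.iterate_succ_apply', ih]
    exact D_add j (D_iter_smooth j n hf) (D_iter_smooth j n hg)

theorem D_iter_smul (j : Fin d) (n : ℕ) (c : ℂ) {f : Rd d → ℂ} (hf : ContDiff ℝ ∞ f) :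
    (D j)^[n] (c • f) = c • (D j)^[n] f := by
  induction n with
  | zero => rfl
  | succ n ih =>
    simp only [Function.iterate_succ_apply', ih]
    exact D_smul j c (D_iter_smooth j n hf)

theorem listD_add (l : List (Fin d)) (β : Fin d → ℕ) {f g : Rd d → ℂ} (hf : ContDiff ℝ ∞ f)
    (hg : ContDiff ℝ ∞ g) : listD l β (f + g) = listD l β f + listD l β g := by
  induction l with
  | nil => rfl
  | cons j l ih =>
    change (D j)^[β j] (listD l β (f + g)) = _
    rw [ih]
    exact D_iter_add j _ (listD_smooth l β hf) (listD_smooth l β hg)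

theorem listD_smul (l : List (Fin d)) (β : Fin d → ℕ) (c : ℂ) {f : Rd d → ℂ}
    (hf : ContDiff ℝ ∞ f) : listD l β (c • f) = c • listD l β f := by
  induction l with
  | nil => rfl
  | cons j l ih =>
    change (D j)^[β j] (listD l β (c • f)) = _
    rw [ih]
    exact D_iter_smul j _ c (listD_smooth l β hf)

theorem quot_add_le (ν μ : ℝ) {h : ℝ} (hh : 0 < h) {f g : Rd d → ℂ} (hf : ContDiff ℝ ∞ f)
    (hg : ContDiff ℝ ∞ g) (p : Rd d × (Fin d → ℕ) × (Fin d → ℕ)) :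
    quot ν μ h (f + g) p ≤ quot ν μ h f p + quot ν μ h g p := by
  unfold quot multiD
  rw [listD_add _ _ hf hg, ← add_div, Pi.add_apply, mul_add]
  exact div_le_div_of_nonneg_right (norm_add_le _ _) (weight_pos ν μ hh _ _).le

theorem quot_smul (ν μ h : ℝ) (c : ℂ) {f : Rd d → ℂ} (hf : ContDiff ℝ ∞ f)
    (p : Rd d × (Fin d → ℕ) × (Fin d → ℕ)) : quot ν μ h (c • f) p = ‖c‖ * quot ν μ h f p := by
  unfold quot multiD
  rw [listD_smul _ _ _ hf]
  simp only [Pi.smul_apply, smul_eq_mul, norm_mul]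
  ring

variable (d) in
/-- The linear space underlying the Beurling type Gelfand–Shilov space `Σ_ν^μ(ℝᵈ)`. -/
def submodule (ν μ : ℝ) : Submodule ℂ (Rd d → ℂ) where
  carrier := {f | Mem ν μ f}
  add_mem' := by
    rintro f g ⟨hf, hf'⟩ ⟨hg, hg'⟩
    refine ⟨hf.add hg, fun h hh => ?_⟩
    obtain ⟨A, hA⟩ := hf' h hh
    obtain ⟨B, hB⟩ := hg' h hh
    refine ⟨A + B, ?_⟩
    rintro _ ⟨p, rfl⟩
    exact (quot_add_le ν μ hh hf hg p).trans (add_le_add (hA ⟨p, rfl⟩) (hB ⟨p, rfl⟩))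
  zero_mem' := by
    have h0 : (0 : Rd d → ℂ) = (0 : ℂ) • (0 : Rd d → ℂ) := by simp
    have hs : ContDiff ℝ ∞ (0 : Rd d → ℂ) := contDiff_const
    refine ⟨hs, fun h _ => ⟨0, ?_⟩⟩
    rintro _ ⟨p, rfl⟩
    rw [h0, quot_smul ν μ h 0 hs]
    simp
  smul_mem' := by
    rintro c f ⟨hf, hf'⟩
    refine ⟨contDiff_const.smul hf, fun h hh => ?_⟩
    obtain ⟨A, hA⟩ := hf' h hh
    refine ⟨‖c‖ * A, ?_⟩
    rintro _ ⟨p, rfl⟩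
    rw [quot_smul ν μ h c hf]
    exact mul_le_mul_of_nonneg_left (hA ⟨p, rfl⟩) (norm_nonneg _)

theorem weight_eq (ν μ h : ℝ) (α β : Fin d → ℕ) : weight ν μ h α β =
    (∏ j, h ^ α j * ((α j).factorial : ℝ) ^ ν) * ∏ j, h ^ β j * ((β j).factorial : ℝ) ^ μ := by
  simp only [weight, len, fact, Finset.prod_mul_distrib, Pi.add_apply, Finset.sum_add_distrib,
    pow_add, Finset.prod_pow_eq_pow_sum]
  push_cast
  rw [← Real.finsetProd_rpow _ _ (fun _ _ => by positivity),
    ← Real.finsetProd_rpow _ _ (fun _ _ => by positivity)]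
  ring

theorem exists_pow_le {s h : ℝ} (hs : 0 < s) (hh : 0 < h) {c : ℝ} (hc : 0 ≤ c) :
    ∃ C : ℝ, 1 ≤ C ∧ ∀ n : ℕ, c ^ n ≤ C * (h ^ n * (n.factorial : ℝ) ^ s) := by
  set b : ℝ := (c / h) ^ s⁻¹ with hb
  have hb0 : 0 ≤ b := by positivity
  refine ⟨Real.exp b ^ s, Real.one_le_rpow (Real.one_le_exp hb0) hs.le, fun n => ?_⟩
  have h1 : (b ^ n / n.factorial) ^ s ≤ Real.exp b ^ s :=
    Real.rpow_le_rpow (by positivity) (Real.pow_div_factorial_le_exp b hb0 n) hs.le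
  have h2 : (b ^ n) ^ s = (c / h) ^ n := by
    rw [← Real.rpow_natCast, ← Real.rpow_mul hb0, mul_comm, Real.rpow_mul hb0, hb,
      Real.rpow_inv_rpow (by positivity) hs.ne', Real.rpow_natCast]
  rw [Real.div_rpow (by positivity) (by positivity), h2, div_le_iff₀ (by positivity), div_pow,
    div_le_iff₀ (by positivity)] at h1
  linarith

/-- Translation `T_a f(y) = f(y - a)`. -/
def translate (a : Rd d) (f : Rd d → ℂ) : Rd d → ℂ := fun y => f (y - a)

/-- Modulation `M_ξ f(y) = e^{i⟨y,ξ⟩} f(y)`. -/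
def modulate (ξ : Rd d) (f : Rd d → ℂ) : Rd d → ℂ :=
  fun y => exp (I * ((inner ℝ y ξ : ℝ) : ℂ)) * f y

theorem listD_translate (l : List (Fin d)) (β : Fin d → ℕ) (a : Rd d) (f : Rd d → ℂ) :
    listD l β (translate a f) = translate a (listD l β f) := by
  have h1 : ∀ (j : Fin d) (g : Rd d → ℂ), D j (translate a g) = translate a (D j g) := fun j g => by
    funext y
    unfold D translate
    rw [fderiv_comp_sub]
  have h2 : ∀ (j : Fin d) (n : ℕ) (g : Rd d → ℂ),
      (D j)^[n] (translate a g) = translate a ((D j)^[n] g) := fun j n g => by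
    induction n with
    | zero => rfl
    | succ n ih => simp only [Function.iterate_succ_apply', ih, h1]
  induction l with
  | nil => rfl
  | cons j l ih =>
    change (D j)^[β j] (listD l β (translate a f)) = _
    rw [ih, h2]
    rfl

theorem Mem.translate {ν μ : ℝ} (hν : 0 < ν) {f : Rd d → ℂ} (hf : Mem ν μ f) (a : Rd d) :
    Mem ν μ (translate a f) := by
  refine ⟨hf.1.comp (contDiff_id.sub contDiff_const), fun h hh => ?_⟩
  have hh2 : 0 < h / 2 := by positivity
  obtain ⟨A, hA0, hA⟩ := (bdd_iff ν μ hh2 f).1 (hf.2 _ hh2)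
  obtain ⟨C, hC1, hC⟩ := exists_pow_le hν hh2 (norm_nonneg a)
  refine (bdd_iff ν μ hh _).2 ⟨C ^ d * A, by positivity, fun y α β => ?_⟩
  set z := y - a with hz
  let γ : Fin d → ℕ := fun j => if |a j| ≤ |z j| then α j else 0
  have hD : multiD β (GS.translate a f) y = multiD β f z := by
    unfold multiD
    rw [listD_translate]
    rfl
  have hfac : ∀ j, |y j ^ α j| * ((h / 2) ^ γ j * ((γ j).factorial : ℝ) ^ ν) ≤
      |z j ^ γ j| * (C * (h ^ α j * ((α j).factorial : ℝ) ^ ν)) := fun j => by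
    have hy : |y j| ≤ |z j| + |a j| := by
      have : y j = z j + a j := by simp [hz]
      rw [this]
      exact abs_add_le _ _
    have haj : |a j| ≤ ‖a‖ := by simpa using PiLp.norm_apply_le a j
    rw [abs_pow, abs_pow]
    by_cases hc : |a j| ≤ |z j|
    · have hg : γ j = α j := if_pos hc
      rw [hg]
      have h1 : |y j| ^ α j ≤ 2 ^ α j * |z j| ^ α j := by
        rw [← mul_pow]
        exact pow_le_pow_left₀ (abs_nonneg _) (by linarith) _
      calc |y j| ^ α j * ((h / 2) ^ α j * ((α j).factorial : ℝ) ^ ν)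
          ≤ (2 ^ α j * |z j| ^ α j) * ((h / 2) ^ α j * ((α j).factorial : ℝ) ^ ν) := by gcongr
        _ = |z j| ^ α j * (1 * (h ^ α j * ((α j).factorial : ℝ) ^ ν)) := by
            rw [div_pow]; field_simp
        _ ≤ _ := by gcongr
    · have hg : γ j = 0 := if_neg hc
      rw [hg]
      push Not at hc
      have h1 : |y j| ^ α j ≤ 2 ^ α j * ‖a‖ ^ α j := by
        rw [← mul_pow]
        exact pow_le_pow_left₀ (abs_nonneg _) (by linarith) _
      have h2 := hC (α j)
      calc |y j| ^ α j * ((h / 2) ^ 0 * ((Nat.factorial 0 : ℕ) : ℝ) ^ ν) = |y j| ^ α j := by simp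
        _ ≤ 2 ^ α j * ‖a‖ ^ α j := h1
        _ ≤ 2 ^ α j * (C * ((h / 2) ^ α j * ((α j).factorial : ℝ) ^ ν)) := by gcongr
        _ = _ := by rw [div_pow]; field_simp
  have hprod := Finset.prod_le_prod (s := Finset.univ) (fun j _ => by positivity)
    (fun j _ => hfac j)
  have hCd : (∏ j : Fin d, (C * (h ^ α j * ((α j).factorial : ℝ) ^ ν))) =
      C ^ d * ∏ j, h ^ α j * ((α j).factorial : ℝ) ^ ν := by
    rw [Finset.prod_mul_distrib, Finset.prod_const, Finset.card_univ, Fintype.card_fin]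
  rw [Finset.prod_mul_distrib, ← Finset.abs_prod, Finset.prod_mul_distrib (f := fun j => |z j ^ γ j|),
    ← Finset.abs_prod, hCd] at hprod
  have hAz := hA z γ β
  rw [hD]
  rw [weight_eq] at hAz ⊢
  set W := ∏ j, (h / 2) ^ γ j * ((γ j).factorial : ℝ) ^ ν with hW
  set V := ∏ j, h ^ α j * ((α j).factorial : ℝ) ^ ν with hV
  have hWpos : 0 < W := Finset.prod_pos fun j _ => by positivity
  have hVpos : 0 < V := Finset.prod_pos fun j _ => by positivity
  have hβ : (∏ j, (h / 2) ^ β j * ((β j).factorial : ℝ) ^ μ) ≤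
      ∏ j, h ^ β j * ((β j).factorial : ℝ) ^ μ :=
    Finset.prod_le_prod (fun j _ => by positivity) fun j _ => by gcongr; linarith
  set Y := ∏ j, (h / 2) ^ β j * ((β j).factorial : ℝ) ^ μ
  set Z := ∏ j, h ^ β j * ((β j).factorial : ℝ) ^ μ
  refine le_of_mul_le_mul_right ?_ hWpos
  calc |monomial α y| * ‖multiD β f z‖ * W = (|monomial α y| * W) * ‖multiD β f z‖ := by ring
    _ ≤ (|monomial γ z| * (C ^ d * V)) * ‖multiD β f z‖ := by
        exact mul_le_mul_of_nonneg_right hprod (norm_nonneg _)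
    _ = (|monomial γ z| * ‖multiD β f z‖) * (C ^ d * V) := by ring
    _ ≤ (A * (W * Y)) * (C ^ d * V) := by gcongr
    _ ≤ (A * (W * Z)) * (C ^ d * V) := by gcongr
    _ = _ := by ring

variable (d) in
/-- The smooth functions. -/
def smooth : Submodule ℂ (Rd d → ℂ) where
  carrier := {f | ContDiff ℝ ∞ f}
  add_mem' := by
    intro f g (hf : ContDiff ℝ ∞ f) (hg : ContDiff ℝ ∞ g)
    exact hf.add hg
  zero_mem' := (contDiff_const : ContDiff ℝ ∞ fun _ : Rd d => (0 : ℂ))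
  smul_mem' := by
    intro c f (hf : ContDiff ℝ ∞ f)
    exact contDiff_const.smul hf

/-- `D_j` as an endomorphism of the smooth functions. -/
def endD (j : Fin d) : Module.End ℂ (smooth d) where
  toFun f := ⟨D j f, D_smooth j f.2⟩
  map_add' f g := Subtype.ext (D_add j f.2 g.2)
  map_smul' c f := Subtype.ext (D_smul j c f.2)

/-- Modulation in a single coordinate, as an endomorphism of the smooth functions. -/
def endM (j : Fin d) (c : ℝ) : Module.End ℂ (smooth d) where
  toFun f := ⟨fun y => exp (I * ((y j * c : ℝ) : ℂ)) * f.1 y, by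
    have : ContDiff ℝ ∞ f.1 := f.2
    have h1 : ContDiff ℝ ∞ (fun y : Rd d => y j * c) := by fun_prop
    have h2 : ContDiff ℝ ∞ (fun y : Rd d => ((y j * c : ℝ) : ℂ)) := ofRealCLM.contDiff.comp h1
    exact ((contDiff_const.mul h2).cexp).mul this⟩
  map_add' f g := Subtype.ext (by funext y; simp [mul_add])
  map_smul' a f := Subtype.ext (by funext y; simp; ring)

/-- The operators of `listD` as endomorphisms of the smooth functions. -/
def endListD (l : List (Fin d)) (β : Fin d → ℕ) : Module.End ℂ (smooth d) :=
  (l.map fun j => endD j ^ β j).prod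

theorem endD_pow_apply (j : Fin d) (n : ℕ) (f : smooth d) :
    ((endD j ^ n) f).1 = (D j)^[n] f.1 := by
  induction n with
  | zero => rfl
  | succ n ih =>
    rw [pow_succ', Function.iterate_succ_apply', ← ih]
    rfl

theorem endListD_apply (l : List (Fin d)) (β : Fin d → ℕ) (f : smooth d) :
    (endListD l β f).1 = listD l β f.1 := by
  induction l with
  | nil => rfl
  | cons j l ih =>
    change ((endD j ^ β j) (endListD l β f)).1 = (D j)^[β j] (listD l β f.1)
    rw [endD_pow_apply, ih]

theorem endD_mul_endM (i j : Fin d) (c : ℝ) : endD i * endM j c =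
    endM j c * (endD i + algebraMap ℂ _ (if i = j then (c : ℂ) else 0)) := by
  refine LinearMap.ext fun f => Subtype.ext (funext fun y => ?_)
  have hf : DifferentiableAt ℝ f.1 y :=
    ((show ContDiff ℝ ∞ f.1 from f.2).differentiable (by simp)) y
  have h1 : HasFDerivAt (fun y : Rd d => y j * c) (c • EuclideanSpace.proj (𝕜 := ℝ) j) y :=
    (EuclideanSpace.proj (𝕜 := ℝ) j : Rd d →L[ℝ] ℝ).hasFDerivAt.mul_const c
  have h2 : HasFDerivAt (fun y : Rd d => ((y j * c : ℝ) : ℂ)) _ y :=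
    ofRealCLM.hasFDerivAt.comp y h1
  have h3 := ((h2.const_mul I).cexp).mul hf.hasFDerivAt
  change -I * fderiv ℝ (fun y => exp (I * ((y j * c : ℝ) : ℂ)) * f.1 y) y _ =
    exp (I * ((y j * c : ℝ) : ℂ)) * (-I * fderiv ℝ f.1 y _ + _)
  rw [show (fun y => exp (I * ((y j * c : ℝ) : ℂ)) * f.1 y) =
    (fun y : Rd d => exp (I * ((y j * c : ℝ) : ℂ))) * f.1 from rfl, h3.fderiv]
  by_cases hij : i = j
  · subst hij
    simp
    linear_combination (-exp (I * (y i * c)) * c * f.1 y) * I_mul_I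
  · have hji : j ≠ i := fun h => hij h.symm
    simp [hij, hji]
    ring

theorem endListD_mul_endM_of_notMem (l : List (Fin d)) (β : Fin d → ℕ) (j : Fin d) (c : ℝ)
    (hj : j ∉ l) : endListD l β * endM j c = endM j c * endListD l β := by
  induction l with
  | nil => simp [endListD]
  | cons i l ih =>
    simp only [List.mem_cons, not_or] at hj
    have h1 : SemiconjBy (endM j c) (endD i) (endD i) := by
      have := endD_mul_endM i j c
      rw [if_neg (Ne.symm hj.1), map_zero, add_zero] at this
      exact this.symm
    have h2 := (h1.pow_right (β i)).eq
    change (endD i ^ β i * endListD l β) * _ = _ * (endD i ^ β i * endListD l β)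
    rw [mul_assoc, ih hj.2, ← mul_assoc, ← h2, mul_assoc]

theorem endListD_congr (l : List (Fin d)) {β γ : Fin d → ℕ} (h : ∀ j ∈ l, β j = γ j) :
    endListD l β = endListD l γ := by
  unfold endListD
  congr 1
  exact List.map_congr_left fun j hj => by rw [h j hj]

theorem endListD_mul_endM (l : List (Fin d)) (hl : l.Nodup) (β : Fin d → ℕ) (j : Fin d) (c : ℝ)
    (hj : j ∈ l) : endListD l β * endM j c = endM j c * ∑ k ∈ Finset.range (β j + 1),
      ((c : ℂ) ^ (β j - k) * ((β j).choose k : ℂ)) • endListD l (Function.update β j k) := by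
  induction l with
  | nil => simp at hj
  | cons i l ih =>
    have hl' := List.nodup_cons.1 hl
    by_cases hij : i = j
    · subst hij
      have h1 : SemiconjBy (endM i c) (endD i + algebraMap ℂ _ (c : ℂ)) (endD i) := by
        have := endD_mul_endM i i c
        rw [if_pos rfl] at this
        exact this.symm
      have h2 := (h1.pow_right (β i)).eq
      change (endD i ^ β i * endListD l β) * _ = _
      rw [mul_assoc, endListD_mul_endM_of_notMem l β i c hl'.1, ← mul_assoc, ← h2, mul_assoc]
      congr 1
      rw [Commute.add_pow (Algebra.commutes (c : ℂ) (endD i)).symm, Finset.sum_mul]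
      refine Finset.sum_congr rfl fun k _ => ?_
      have h3 : endListD (i :: l) (Function.update β i k) = endD i ^ k * endListD l β := by
        change endD i ^ (Function.update β i k i) * endListD l (Function.update β i k) = _
        rw [Function.update_self, endListD_congr l (β := Function.update β i k) (γ := β)]
        intro i' hi'
        refine Function.update_of_ne ?_ _ _
        rintro rfl
        exact hl'.1 hi'
      rw [h3, ← map_pow, ← map_natCast (algebraMap ℂ (Module.End ℂ (smooth d))),
        mul_assoc (endD i ^ k), ← map_mul, ← Algebra.commutes, ← Algebra.smul_def, smul_mul_assoc]
    · have hjl : j ∈ l := by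
        rcases List.mem_cons.1 hj with h | h
        · exact absurd h.symm hij
        · exact h
      have h1 : SemiconjBy (endM j c) (endD i) (endD i) := by
        have := endD_mul_endM i j c
        rw [if_neg hij, map_zero, add_zero] at this
        exact this.symm
      have h2 := (h1.pow_right (β i)).eq
      change (endD i ^ β i * endListD l β) * _ = _
      rw [mul_assoc, ih hl'.2 hjl, ← mul_assoc, ← h2, mul_assoc, Finset.mul_sum]
      congr 1
      refine Finset.sum_congr rfl fun k _ => ?_
      rw [mul_smul_comm]
      congr 1
      change _ = endD i ^ (Function.update β j k i) * endListD l (Function.update β j k)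
      rw [Function.update_of_ne hij]

theorem Mem.modulate_coord {ν μ : ℝ} (hμ : 0 < μ) {f : Rd d → ℂ} (hf : Mem ν μ f) (j : Fin d)
    (c : ℝ) : Mem ν μ (fun y => exp (I * ((y j * c : ℝ) : ℂ)) * f y) := by
  let F : smooth d := ⟨f, hf.1⟩
  refine ⟨(endM j c F).2, fun h hh => ?_⟩
  have hh2 : 0 < h / 2 := by positivity
  obtain ⟨A, hA0, hA⟩ := (bdd_iff ν μ hh2 f).1 (hf.2 _ hh2)
  obtain ⟨C, hC1, hC⟩ := exists_pow_le hμ hh2 (abs_nonneg c)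
  refine (bdd_iff ν μ hh _).2 ⟨C * A, by positivity, fun y α β => ?_⟩
  have hid : multiD β (fun y => exp (I * ((y j * c : ℝ) : ℂ)) * f y) y =
      exp (I * ((y j * c : ℝ) : ℂ)) * ∑ k ∈ Finset.range (β j + 1),
        ((c : ℂ) ^ (β j - k) * ((β j).choose k : ℂ)) * multiD (Function.update β j k) f y := by
    have h1 := endListD_apply (List.finRange d) β (endM j c F)
    have h2 := congrArg (fun T => (T F).1 y) (endListD_mul_endM (List.finRange d)
      (List.nodup_finRange d) β j c (List.mem_finRange j))
    have h3 : multiD β (fun y => exp (I * ((y j * c : ℝ) : ℂ)) * f y) y =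
      (endListD (List.finRange d) β (endM j c F)).1 y := by rw [h1]; rfl
    rw [h3]
    refine h2.trans ?_
    change exp (I * ((y j * c : ℝ) : ℂ)) * _ = _
    congr 1
    simp only [LinearMap.sum_apply, LinearMap.smul_apply, Submodule.coe_sum, Finset.sum_apply,
      Submodule.coe_smul, Pi.smul_apply, smul_eq_mul, endListD_apply]
    rfl
  set Q := ∏ i ∈ Finset.univ.erase j, (h / 2) ^ β i * ((β i).factorial : ℝ) ^ μ with hQ
  set P := ∏ i, (h / 2) ^ α i * ((α i).factorial : ℝ) ^ ν with hP
  have hQ0 : 0 ≤ Q := Finset.prod_nonneg fun i _ => by positivity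
  have hP0 : 0 ≤ P := Finset.prod_nonneg fun i _ => by positivity
  have hw : ∀ k, weight ν μ (h / 2) α (Function.update β j k) =
      P * (((h / 2) ^ k * (k.factorial : ℝ) ^ μ) * Q) := fun k => by
    rw [weight_eq, ← Finset.mul_prod_erase Finset.univ
      (fun i => (h / 2) ^ Function.update β j k i * ((Function.update β j k i).factorial : ℝ) ^ μ)
      (Finset.mem_univ j), Function.update_self]
    congr 2
    refine Finset.prod_congr rfl fun i hi => ?_
    rw [Function.update_of_ne (Finset.ne_of_mem_erase hi)]
  set n := β j with hn
  have hterm : ∀ k ∈ Finset.range (n + 1),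
      |monomial α y| * ‖((c : ℂ) ^ (n - k) * (n.choose k : ℂ)) * multiD (Function.update β j k) f y‖
      ≤ (n.choose k : ℝ) * (C * A * (P * (((h / 2) ^ n * (n.factorial : ℝ) ^ μ) * Q))) := by
    intro k hk
    have hkn : k ≤ n := Nat.lt_succ_iff.1 (Finset.mem_range.1 hk)
    have h1 := hA y α (Function.update β j k)
    rw [hw] at h1
    have h2 := hC (n - k)
    have h3 : ((n - k).factorial : ℝ) ^ μ * (k.factorial : ℝ) ^ μ ≤ (n.factorial : ℝ) ^ μ := by
      rw [← Real.mul_rpow (by positivity) (by positivity)]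
      refine Real.rpow_le_rpow (by positivity) ?_ hμ.le
      have := Nat.le_of_dvd (Nat.factorial_pos n) (Nat.factorial_mul_factorial_dvd_factorial hkn)
      rw [mul_comm]
      exact_mod_cast this
    have h4 : (h / 2) ^ (n - k) * (h / 2) ^ k = (h / 2) ^ n := by
      rw [← pow_add, Nat.sub_add_cancel hkn]
    simp only [norm_mul, norm_pow, norm_natCast, norm_real, Real.norm_eq_abs]
    calc |monomial α y| * (|c| ^ (n - k) * (n.choose k : ℝ) * ‖multiD (Function.update β j k) f y‖)
        = (n.choose k : ℝ) * (|c| ^ (n - k) *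
            (|monomial α y| * ‖multiD (Function.update β j k) f y‖)) := by ring
      _ ≤ (n.choose k : ℝ) * ((C * ((h / 2) ^ (n - k) * ((n - k).factorial : ℝ) ^ μ)) *
            (A * (P * (((h / 2) ^ k * (k.factorial : ℝ) ^ μ) * Q)))) := by gcongr
      _ = (n.choose k : ℝ) * (C * A * (P * ((((h / 2) ^ (n - k) * (h / 2) ^ k) *
            (((n - k).factorial : ℝ) ^ μ * (k.factorial : ℝ) ^ μ)) * Q))) := by ring
      _ ≤ _ := by rw [h4]; gcongr
  have hexp : ‖exp (I * ((y j * c : ℝ) : ℂ))‖ = 1 := by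
    rw [mul_comm]; exact norm_exp_ofReal_mul_I _
  have hfin : (2 : ℝ) ^ n * (P * (((h / 2) ^ n * (n.factorial : ℝ) ^ μ) * Q)) ≤
      weight ν μ h α β := by
    have e1 : P ≤ ∏ i, h ^ α i * ((α i).factorial : ℝ) ^ ν :=
      Finset.prod_le_prod (fun i _ => by positivity) fun i _ => by gcongr; linarith
    have e2 : Q ≤ ∏ i ∈ Finset.univ.erase j, h ^ β i * ((β i).factorial : ℝ) ^ μ :=
      Finset.prod_le_prod (fun i _ => by positivity) fun i _ => by gcongr; linarith
    rw [weight_eq, ← Finset.mul_prod_erase Finset.univ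
      (fun i => h ^ β i * ((β i).factorial : ℝ) ^ μ) (Finset.mem_univ j), ← hn]
    calc (2 : ℝ) ^ n * (P * (((h / 2) ^ n * (n.factorial : ℝ) ^ μ) * Q))
        = P * ((h ^ n * (n.factorial : ℝ) ^ μ) * Q) := by rw [div_pow]; field_simp
      _ ≤ _ := by gcongr
  rw [hid, norm_mul, hexp, one_mul]
  calc |monomial α y| * ‖∑ k ∈ Finset.range (n + 1),
        ((c : ℂ) ^ (n - k) * (n.choose k : ℂ)) * multiD (Function.update β j k) f y‖
      ≤ ∑ k ∈ Finset.range (n + 1), |monomial α y| *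
        ‖((c : ℂ) ^ (n - k) * (n.choose k : ℂ)) * multiD (Function.update β j k) f y‖ := by
        rw [← Finset.mul_sum]
        gcongr
        exact norm_sum_le _ _
    _ ≤ ∑ k ∈ Finset.range (n + 1),
        (n.choose k : ℝ) * (C * A * (P * (((h / 2) ^ n * (n.factorial : ℝ) ^ μ) * Q))) :=
        Finset.sum_le_sum hterm
    _ = C * A * ((2 : ℝ) ^ n * (P * (((h / 2) ^ n * (n.factorial : ℝ) ^ μ) * Q))) := by
        rw [← Finset.sum_mul]
        have : (∑ k ∈ Finset.range (n + 1), (n.choose k : ℝ)) = 2 ^ n := by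
          exact_mod_cast Nat.sum_range_choose n
        rw [this]; ring
    _ ≤ _ := by gcongr

theorem Mem.modulate {ν μ : ℝ} (hμ : 0 < μ) {f : Rd d → ℂ} (hf : Mem ν μ f) (ξ : Rd d) :
    Mem ν μ (modulate ξ f) := by
  have key : ∀ s : Finset (Fin d),
      Mem ν μ (fun y => exp (I * ((∑ j ∈ s, y j * ξ j : ℝ) : ℂ)) * f y) := fun s => by
    induction s using Finset.induction_on with
    | empty => simpa using hf
    | insert j s hj ih =>
      have := ih.modulate_coord hμ j (ξ j)
      convert this using 2 with y
      rw [Finset.sum_insert hj, ← mul_assoc, ← exp_add]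
      push_cast
      ring_nf
  convert key Finset.univ using 2 with y
  unfold GS.modulate
  congr 4
  simp [PiLp.inner_apply, mul_comm]

end GS

/-- The Beurling type Gelfand–Shilov space `Σ_ν^μ(ℝᵈ)`. -/
def GelfandShilov (d : ℕ) (ν μ : ℝ) : Type := GS.submodule d ν μ

namespace GelfandShilov

variable {d : ℕ} {ν μ : ℝ}

instance : AddCommGroup (GelfandShilov d ν μ) :=
  inferInstanceAs (AddCommGroup (GS.submodule d ν μ))

instance : Module ℂ (GelfandShilov d ν μ) :=
  inferInstanceAs (Module ℂ (GS.submodule d ν μ))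

instance : CoeFun (GelfandShilov d ν μ) fun _ => Rd d → ℂ := ⟨Subtype.val⟩

variable (d ν μ) in
/-- The norm `sup_{x,α,β} |x^α D^β f(x)| / (h^{|α+β|} α!^ν β!^μ)`, a seminorm on `Σ_ν^μ(ℝᵈ)`. -/
def seminorm (h : {h : ℝ // 0 < h}) : Seminorm ℂ (GelfandShilov d ν μ) :=
  Seminorm.of (fun f => ⨆ p, GS.quot ν μ h f p)
    (fun f g => ciSup_le fun p =>
      (GS.quot_add_le ν μ h.2 f.2.1 g.2.1 p).trans
        (add_le_add (le_ciSup (f.2.2 h h.2) p) (le_ciSup (g.2.2 h h.2) p)))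
    (fun c f => by
      have : ∀ p, GS.quot ν μ h (c • f : GelfandShilov d ν μ) p = ‖c‖ * GS.quot ν μ h f p :=
        GS.quot_smul ν μ h c f.2.1
      simp only [this]
      exact (Real.mul_iSup_of_nonneg (norm_nonneg c) _).symm)

variable (d ν μ) in
/-- The family of all these seminorms, for `h > 0`. -/
def seminormFamily : SeminormFamily ℂ (GelfandShilov d ν μ) {h : ℝ // 0 < h} := seminorm d ν μ

instance : Nonempty {h : ℝ // 0 < h} := ⟨⟨1, one_pos⟩⟩

/-- The Fréchet topology given by the seminorms for `h > 0`. -/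
instance : TopologicalSpace (GelfandShilov d ν μ) :=
  (seminormFamily d ν μ).moduleFilterBasis.topology

theorem withSeminorms : WithSeminorms (seminormFamily d ν μ) := ⟨rfl⟩

variable (d ν μ) in
/-- The space `(Σ_ν^μ)'(ℝᵈ)` of ultradistributions: continuous conjugate linear functionals on
`Σ_ν^μ(ℝᵈ)`, with the weak* topology, that is, pointwise convergence on `Σ_ν^μ(ℝᵈ)`. -/
abbrev Dual : Type := GelfandShilov d ν μ →SLₚₜ[starRingEnd ℂ] ℂ


theorem norm_mul_le (f : GelfandShilov d ν μ) (n : ℕ) :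
    ∃ C, ∀ x, ‖x‖ ^ (n + 1) * ‖f x‖ ≤ C := by
  obtain ⟨C, hC0, hC⟩ := (GS.bdd_iff ν μ one_pos f).1 (f.2.2 1 one_pos)
  let e : Fin d → Fin d → ℕ := fun j => Pi.single j (n + 1)
  refine ⟨(d : ℝ) ^ n * ∑ j, C * GS.weight ν μ 1 (e j) 0, fun x => ?_⟩
  have h0 : GS.multiD 0 (f : Rd d → ℂ) = f := GS.multiD_zero _
  have h1 : ∀ j, |x j| ^ (n + 1) * ‖f x‖ ≤ C * GS.weight ν μ 1 (e j) 0 := fun j => by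
    have := hC x (e j) 0
    rw [h0] at this
    have hm : GS.monomial (e j) x = x j ^ (n + 1) := by
      unfold GS.monomial
      rw [Finset.prod_eq_single j]
      · simp [e]
      · intro b _ hb
        simp [e, Pi.single_eq_of_ne hb]
      · simp
    rwa [hm, abs_pow] at this
  have h2 : ‖x‖ ≤ ∑ j, |x j| := by
    rw [EuclideanSpace.norm_eq]
    apply Real.sqrt_le_iff.2
    refine ⟨Finset.sum_nonneg fun _ _ => abs_nonneg _, ?_⟩
    simp only [Real.norm_eq_abs]
    exact Finset.sum_sq_le_sq_sum_of_nonneg fun _ _ => abs_nonneg _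
  have h3 : (∑ j, |x j|) ^ (n + 1) ≤ (d : ℝ) ^ n * ∑ j, |x j| ^ (n + 1) := by
    have h := pow_sum_div_card_le_sum_pow (s := Finset.univ) (f := fun j => |x j|)
      (fun j _ => abs_nonneg _) n
    rcases Nat.eq_zero_or_pos d with rfl | hd
    · simp
    · have hd' : (0 : ℝ) < (d : ℝ) ^ n := by positivity
      rw [Finset.card_univ, Fintype.card_fin, div_le_iff₀ hd'] at h
      linarith
  calc ‖x‖ ^ (n + 1) * ‖f x‖ ≤ ((d : ℝ) ^ n * ∑ j, |x j| ^ (n + 1)) * ‖f x‖ := by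
        gcongr
        exact (pow_le_pow_left₀ (norm_nonneg _) h2 _).trans h3
    _ = (d : ℝ) ^ n * ∑ j, |x j| ^ (n + 1) * ‖f x‖ := by rw [mul_assoc, Finset.sum_mul]
    _ ≤ _ := mul_le_mul_of_nonneg_left (Finset.sum_le_sum fun j _ => h1 j) (by positivity)

theorem norm_le (f : GelfandShilov d ν μ) (x : Rd d) : ‖f x‖ ≤ seminorm d ν μ ⟨1, one_pos⟩ f := by
  have h0 : GS.multiD 0 (f : Rd d → ℂ) = f := GS.multiD_zero _
  have := le_ciSup (f.2.2 1 one_pos) (x, 0, 0)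
  simp only [GS.quot, h0, GS.weight, GS.monomial, GS.fact] at this
  change ‖f x‖ ≤ iSup (GS.quot ν μ 1 f)
  simpa using this

theorem integrable (f : GelfandShilov d ν μ) : Integrable (f : Rd d → ℂ) volume := by
  obtain ⟨C, hC⟩ := f.norm_mul_le d
  have hI := (integrable_one_add_norm (E := Rd d) (μ := volume) (r := d + 1) (by simp)).const_mul
    (2 ^ (d + 1) * (seminorm d ν μ ⟨1, one_pos⟩ f + C))
  refine hI.mono' (f.2.1.continuous.aestronglyMeasurable) (Filter.Eventually.of_forall fun x => ?_)
  have hx : (0 : ℝ) < 1 + ‖x‖ := by positivity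
  have he : (1 + ‖x‖) ^ (-((d : ℝ) + 1)) = ((1 + ‖x‖) ^ (d + 1))⁻¹ := by
    rw [Real.rpow_neg hx.le]
    norm_cast
  rw [he, ← div_eq_mul_inv, le_div_iff₀ (by positivity)]
  have h1 := f.norm_le x
  have h2 := hC x
  have h3 : (1 + ‖x‖) ^ (d + 1) ≤ 2 ^ (d + 1) * (1 + ‖x‖ ^ (d + 1)) := by
    refine (add_pow_le (zero_le_one) (norm_nonneg x) (d + 1)).trans ?_
    rw [one_pow]
    gcongr
    · norm_num
    · simp
  calc ‖f x‖ * (1 + ‖x‖) ^ (d + 1) ≤ ‖f x‖ * (2 ^ (d + 1) * (1 + ‖x‖ ^ (d + 1))) := by gcongr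
    _ = 2 ^ (d + 1) * (‖f x‖ + ‖x‖ ^ (d + 1) * ‖f x‖) := by ring
    _ ≤ _ := by gcongr

/-- An integrable function `f` acts as the ultradistribution `φ ↦ (f, φ) = ∫ f(x) conj(φ(x)) dx`. -/
def ofIntegrable (f : Rd d → ℂ) (hf : Integrable f volume) : Dual d ν μ :=
  have hint : ∀ φ : GelfandShilov d ν μ, Integrable (fun x => f x * conj (φ x)) volume := fun φ =>
    hf.mul_bdd (c := seminorm d ν μ ⟨1, one_pos⟩ φ)
      (continuous_conj.comp φ.2.1.continuous).aestronglyMeasurable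
      (Filter.Eventually.of_forall fun x => by simpa using φ.norm_le x)
  have hadd : ∀ φ ψ : GelfandShilov d ν μ, ∫ x, f x * conj ((φ + ψ) x) =
      (∫ x, f x * conj (φ x)) + ∫ x, f x * conj (ψ x) := fun φ ψ => by
    rw [← integral_add (hint φ) (hint ψ)]
    refine integral_congr_ae (Filter.Eventually.of_forall fun x => ?_)
    change f x * conj (φ x + ψ x) = _
    simp [mul_add]
  have hsmul : ∀ (c : ℂ) (φ : GelfandShilov d ν μ), ∫ x, f x * conj ((c • φ) x) =
      conj c * ∫ x, f x * conj (φ x) := fun c φ => by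
    rw [← integral_const_mul]
    refine integral_congr_ae (Filter.Eventually.of_forall fun x => ?_)
    change f x * conj (c * φ x) = _
    simp only [map_mul]
    ring
  let L : GelfandShilov d ν μ →ₛₗ[starRingEnd ℂ] ℂ :=
    { toFun := fun φ => ∫ x, f x * conj (φ x)
      map_add' := hadd
      map_smul' := hsmul }
  have hL : Continuous L := by
    refine withSeminorms.continuous_normedSpace_rng ℂ L
      ⟨{⟨1, one_pos⟩}, ⟨∫ x, ‖f x‖, by positivity⟩, fun φ => ?_⟩
    simp only [Finset.sup_singleton]
    change ‖∫ x, f x * conj (φ x)‖ ≤ (∫ x, ‖f x‖) * seminorm d ν μ ⟨1, one_pos⟩ φ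
    rw [← integral_mul_const]
    refine norm_integral_le_of_norm_le (hf.norm.mul_const _) (Filter.Eventually.of_forall fun x => ?_)
    simp only [norm_mul, RCLike.norm_conj]
    exact mul_le_mul_of_nonneg_left (φ.norm_le x) (norm_nonneg _)
  (⟨L, hL⟩ : GelfandShilov d ν μ →SL[starRingEnd ℂ] ℂ)

theorem ofIntegrable_apply (f : Rd d → ℂ) (hf : Integrable f volume) (φ : GelfandShilov d ν μ) :
    (ofIntegrable f hf : Dual d ν μ) φ = ∫ x, f x * conj (φ x) := rfl

/-- The embedding of `Σ_ν^μ(ℝᵈ)` into `(Σ_ν^μ)'(ℝᵈ)`. -/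
def toDual (f : GelfandShilov d ν μ) : Dual d ν μ := ofIntegrable f f.integrable

/-- The time-frequency shift `M_ξ T_x φ` of `φ ∈ Σ_ν^μ(ℝᵈ)`. -/
def timeFreqShift (hν : 0 < ν) (hμ : 0 < μ) (x ξ : Rd d) (φ : GelfandShilov d ν μ) :
    GelfandShilov d ν μ :=
  ⟨GS.modulate ξ (GS.translate x φ), (GS.Mem.translate hν φ.2 x).modulate hμ ξ⟩

/-- The short-time Fourier transform `V_φ u(x,ξ) = (2π)^{-d/2} (u, M_ξ T_x φ)`. -/
def stft (hν : 0 < ν) (hμ : 0 < μ) (φ : GelfandShilov d ν μ) (u : Dual d ν μ) (x ξ : Rd d) : ℂ :=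
  (((2 * Real.pi) ^ (-(d : ℝ) / 2) : ℝ) : ℂ) * u (timeFreqShift hν hμ x ξ φ)

/-- The Gelfand–Shilov wave front set `WF^{ν,μ}(u) ⊆ T*ℝᵈ ∖ 0`, computed with the window `φ`. -/
def waveFrontSet (hν : 0 < ν) (hμ : 0 < μ) (φ : GelfandShilov d ν μ) (u : Dual d ν μ) :
    Set (Rd d × Rd d) :=
  {z | z ≠ 0 ∧ ¬ ∃ U : Set (Rd d × Rd d), IsOpen U ∧ z ∈ U ∧ 0 ∉ U ∧
    ∀ r : ℝ, 0 < r → ∃ C : ℝ, ∀ s : ℝ, 0 < s → ∀ w ∈ U,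
      Real.exp (r * s) * ‖stft hν hμ φ u (s ^ ν • w.1) (s ^ μ • w.2)‖ ≤ C}

end GelfandShilov

namespace Airy

variable {d : ℕ}

/-- The Fourier transform `(2π)^{-d/2} ∫ f(x) e^{-i⟨x,ξ⟩} dx`. -/
def fourier (f : Rd d → ℂ) (ξ : Rd d) : ℂ :=
  (((2 * Real.pi) ^ (-(d : ℝ) / 2) : ℝ) : ℂ) * ∫ x, f x * exp (-I * ((inner ℝ x ξ : ℝ) : ℂ))

/-- The inverse Fourier transform `(2π)^{-d/2} ∫ f(ξ) e^{i⟨x,ξ⟩} dξ`. -/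
def fourierInv (f : Rd d → ℂ) (x : Rd d) : ℂ :=
  (((2 * Real.pi) ^ (-(d : ℝ) / 2) : ℝ) : ℂ) * ∫ ξ, f ξ * exp (I * ((inner ℝ x ξ : ℝ) : ℂ))

/-- The phase `φ_t(ξ) = ∑_j v_j⁻¹ (q_j(ξ_j - t v_j) - q_j(ξ_j))`. -/
def phase (q : Fin d → Polynomial ℝ) (v : Rd d) (t : ℝ) (ξ : Rd d) : ℝ :=
  ∑ j, (v j)⁻¹ * ((q j).eval (ξ j - t * v j) - (q j).eval (ξ j))

/-- The solution operator `𝒦_t f = M_{-tv} 𝓕⁻¹(e^{iφ_t} 𝓕 f)` of the evolution equation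
`∂_t u + i (p(D) + ⟨v, x⟩) u = 0`, where `p(ξ) = ∑_j q_j'(ξ_j)`. -/
def propagator (q : Fin d → Polynomial ℝ) (v : Rd d) (t : ℝ) (f : Rd d → ℂ) : Rd d → ℂ :=
  GS.modulate (-t • v) (fourierInv fun ξ => exp (I * (phase q v t ξ : ℂ)) * fourier f ξ)

/-- The principal part `P_m(ξ) = ∑_{deg p_j = m} c_{j,m} ξ_j^m` of `p(ξ) = ∑_j p_j(ξ_j)`. -/
def principalPart (p : Fin d → Polynomial ℝ) (m : ℕ) (ξ : Rd d) : ℝ :=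
  ∑ j with (p j).natDegree = m, (p j).coeff m * ξ j ^ m

/-- The Hamilton flow `χ_t(x,ξ) = (x + t ∇P_m(ξ), ξ)` of `P_m`. -/
def hamiltonFlow (p : Fin d → Polynomial ℝ) (m : ℕ) (t : ℝ) (z : Rd d × Rd d) : Rd d × Rd d :=
  (z.1 + t • gradient (principalPart p m) z.2, z.2)

end Airy

end

open MeasureTheory Complex
open scoped ContDiff SchwartzMap ComplexConjugate FourierTransform LineDeriv

open scoped ContDiff SchwartzMap ComplexConjugate

/-! ### Factorial powers against exponentials of powers, and the anisotropic gauge -/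

noncomputable section

namespace GS

/-! The operator `𝒦_t` is the modulation `M_{-tv}` after the Fourier multiplier `e^{iφ_t}`. The
phase is a sum of one-variable polynomials of degree at most `m`, and its part of degree `m` is `-t
P_m`: the difference of the `q_j` lowers the degree by one, and `v_j⁻¹` cancels the step `t v_j`.
Since `𝒦_{-t}` is both the inverse and the `L²` adjoint of `𝒦_t`, the extension to
ultradistributions is the transpose of `𝒦_{-t}`, and the short-time Fourier transform of `𝒦_t u` is,
up to a constant, `u` tested on `𝒦_{-t} M_ξ T_x φ`.

Expand `a = φ_{-t}` at `ξ` to first order. The constant term contributes a unimodular factor, the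
linear term a translation by `-∇a(ξ)`, and the remainder acts as a multiplier on the window alone
(`phaseMultiplier_schwartzShift`). The remainder depends on `ξ` without a uniform bound. Cauchy
estimates and an interpolation that uses `μ(m-1) ≤ ν` (`exists_mul_rpow_le`) show that the
short-time Fourier transform of the modified window is at most a constant times `exp(‖ξ‖^{1/μ})`
times a decay of any prescribed rate `k`. The loss in `ξ` does not depend on `k`; on the dilates
`(s^ν x, s^μ ξ)` it is only `e^{Rs}`.

The inversion formula (`Dual.apply_eq_integral`) turns this into a bound of the transform of `𝒦_t u`
by an integral of the transform of `u` against a kernel centred at `(x - ∇a(ξ), ξ + tv)`. Near the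
centre the regularity of `u` beats `e^{Rs}`. At gauge distance of order `s` the free rate `k` beats
`e^{Rs}` and the growth of the transform of `u` (`exists_mem_nhds_convolution_decay`). After undoing
the dilation, the centre converges as `s → ∞`: to the inverse Hamilton flow of `(x, ξ)` if `ν =
μ(m-1)`, and to `(x, ξ)` itself if `ν > μ(m-1)`. So regularity propagates (`RegularAt.propagate`);
time `-t` gives the other inclusion. The windows on the two sides are arbitrary throughout.

Continuity on `Σ_ν^μ` rests on the same estimate, since the Gelfand–Shilov norms are controlled by
the decay of the short-time Fourier transform (`boundedBy_of_funSTFT`), and multiplication by a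
unimodular symbol leaves the decay on the Fourier side unchanged. Uniqueness on the dual follows
because weak* continuous functionals are evaluations (`exists_eval_eq`). -/

theorem pow_le_factorial_rpow_mul_exp {s h : ℝ} (hs : 0 < s) (hh : 0 < h) {t : ℝ} (ht : 0 ≤ t)
    (n : ℕ) : t ^ n ≤ h ^ n * (n.factorial : ℝ) ^ s * Real.exp (s * h⁻¹ ^ s⁻¹ * t ^ s⁻¹) := by
  -- The exponential series gives `b^n / n! ≤ e^b`; the power `s` of this inequality is the claim.
  set b : ℝ := (t / h) ^ s⁻¹ with hb
  have hb0 : 0 ≤ b := by positivity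
  have h1 : (b ^ n / n.factorial) ^ s ≤ Real.exp b ^ s :=
    Real.rpow_le_rpow (by positivity) (Real.pow_div_factorial_le_exp b hb0 n) hs.le
  have h2 : (b ^ n) ^ s = (t / h) ^ n := by
    rw [← Real.rpow_natCast, ← Real.rpow_mul hb0, mul_comm, Real.rpow_mul hb0, hb,
      Real.rpow_inv_rpow (by positivity) hs.ne', Real.rpow_natCast]
  rw [Real.div_rpow (by positivity) (by positivity), h2, div_le_iff₀ (by positivity), div_pow,
    div_le_iff₀ (by positivity), ← Real.exp_mul] at h1
  have h3 : b * s = s * h⁻¹ ^ s⁻¹ * t ^ s⁻¹ := by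
    rw [hb, div_eq_mul_inv, Real.mul_rpow ht (by positivity)]; ring
  rw [h3] at h1
  linarith

theorem exists_pow_le_mul_exp {s h : ℝ} (hs : 0 < s) (hh : 0 < h) :
    ∃ A : ℝ, 0 ≤ A ∧ ∀ t : ℝ, 0 ≤ t → ∀ n : ℕ,
      t ^ n ≤ h ^ n * (n.factorial : ℝ) ^ s * Real.exp (A * t ^ s⁻¹) :=
  ⟨s * h⁻¹ ^ s⁻¹, by positivity, fun _ ht n => pow_le_factorial_rpow_mul_exp hs hh ht n⟩

theorem exists_pow_le_exp {s r : ℝ} (hs : 0 < s) (hr : 0 < r) (n : ℕ) :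
    ∃ C : ℝ, 0 < C ∧ ∀ t : ℝ, 0 ≤ t → t ^ n ≤ C * Real.exp (r * t ^ s⁻¹) := by
  -- The parameter `h = (s/r)^s` makes the exponent `s h^{-1/s}` equal to `r`.
  refine ⟨((s / r) ^ s) ^ n * (n.factorial : ℝ) ^ s, by positivity, fun t ht => ?_⟩
  have := pow_le_factorial_rpow_mul_exp hs (h := (s / r) ^ s) (by positivity) ht n
  have h3 : s * ((s / r) ^ s)⁻¹ ^ s⁻¹ = r := by
    rw [← Real.inv_rpow (by positivity), Real.rpow_rpow_inv (by positivity) hs.ne']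
    field_simp
  rwa [h3] at this

/-- Converse of the previous bounds: the `1/s`-th powers of the hypotheses control each `b^n / n!`,
and summing them with weights `2^{-n}` controls `exp(b/2)`. Neither `h` nor `C` depends on `a` or
`M`, which keeps all later operator bounds uniform in the function. -/
theorem exists_exp_mul_le {s : ℝ} (hs : 0 < s) (r : ℝ) :
    ∃ h C : ℝ, 0 < h ∧ 0 < C ∧ ∀ t a M : ℝ, 0 ≤ t → 0 ≤ a →
      (∀ n : ℕ, t ^ n * a ≤ M * (h ^ n * (n.factorial : ℝ) ^ s)) →
      Real.exp (r * t ^ s⁻¹) * a ≤ C * M := by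
  set k : ℝ := |r| + 1 with hk
  have hk0 : 0 < k := by positivity
  -- `h` is chosen with `s * (h⁻¹)^(1/s) / 2 = k`
  refine ⟨((2 * k / s) ^ s)⁻¹, 2 ^ s, by positivity, by positivity, fun t a M ht ha H => ?_⟩
  set h : ℝ := ((2 * k / s) ^ s)⁻¹ with hh
  have hhpos : 0 < h := by positivity
  rcases ha.eq_or_lt with rfl | ha
  · have := H 0
    simp at this
    simp; positivity
  set b : ℝ := (t / h) ^ s⁻¹ with hb
  have hb0 : 0 ≤ b := by positivity
  have hbk : b * s = 2 * k * t ^ s⁻¹ := by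
    rw [hb, hh, div_inv_eq_mul, Real.mul_rpow ht (by positivity),
      Real.rpow_rpow_inv (by positivity) hs.ne']
    field_simp
  have hM : 0 < M := by
    have := H 0
    simp at this
    linarith
  have h1 : ∀ n : ℕ, b ^ n / n.factorial ≤ (M / a) ^ s⁻¹ := fun n => by
    have h2 : (b ^ n) ^ s = (t / h) ^ n := by
      rw [← Real.rpow_natCast, ← Real.rpow_mul hb0, mul_comm, Real.rpow_mul hb0, hb,
        Real.rpow_inv_rpow (by positivity) hs.ne', Real.rpow_natCast]
    rw [Real.le_rpow_inv_iff_of_pos (by positivity) (by positivity) hs,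
      Real.div_rpow (by positivity) (by positivity), h2, div_pow, div_div, div_le_div_iff₀
      (by positivity) (by positivity)]
    exact H n
  have h2 : Real.exp (b / 2) ≤ 2 * (M / a) ^ s⁻¹ := by
    have hsum := NormedSpace.expSeries_div_hasSum_exp (b / 2)
    rw [← Real.exp_eq_exp_ℝ] at hsum
    have hgeo := (hasSum_geometric_two).mul_right ((M / a) ^ s⁻¹)
    refine hasSum_le (fun n => ?_) hsum hgeo
    rw [div_pow, div_right_comm, one_div, inv_pow, mul_comm, ← div_eq_mul_inv]
    gcongr
    exact h1 n
  have h3 : Real.exp (b / 2) ^ s ≤ 2 ^ s * (M / a) := by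
    refine (Real.rpow_le_rpow (Real.exp_nonneg _) h2 hs.le).trans_eq ?_
    rw [Real.mul_rpow (by positivity) (by positivity), Real.rpow_inv_rpow (by positivity) hs.ne']
  rw [← Real.exp_mul, show b / 2 * s = k * t ^ s⁻¹ by linarith, ← mul_div_assoc,
    le_div_iff₀ ha] at h3
  refine le_trans ?_ h3
  gcongr
  exact (le_abs_self r).trans (by linarith)

theorem add_rpow_le_two_rpow_mul {p : ℝ} (hp : 0 < p) {a b : ℝ} (ha : 0 ≤ a) (hb : 0 ≤ b) :
    (a + b) ^ p ≤ 2 ^ p * (a ^ p + b ^ p) := by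
  have h1 : (a + b) ^ p ≤ (2 * max a b) ^ p := by
    refine Real.rpow_le_rpow (by positivity) ?_ hp.le
    linarith [le_max_left a b, le_max_right a b]
  rw [Real.mul_rpow (by norm_num) (le_max_of_le_left ha)] at h1
  refine h1.trans ?_
  gcongr
  rcases le_total a b with h | h
  · rw [max_eq_right h]; linarith [Real.rpow_nonneg ha p]
  · rw [max_eq_left h]; linarith [Real.rpow_nonneg hb p]

section RootNorm

variable {E : Type*} [NormedAddCommGroup E]

/-- The gauge `‖x‖^{1/s}`. -/
def rootNorm (s : ℝ) (x : E) : ℝ := ‖x‖ ^ s⁻¹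

theorem rootNorm_nonneg (s : ℝ) (x : E) : 0 ≤ rootNorm s x := by
  unfold rootNorm; positivity

theorem rootNorm_zero {s : ℝ} (hs : 0 < s) : rootNorm s (0 : E) = 0 := by
  simp [rootNorm, Real.zero_rpow, hs.ne']

theorem rootNorm_neg (s : ℝ) (x : E) : rootNorm s (-x) = rootNorm s x := by
  simp [rootNorm]

theorem rootNorm_sub_comm (s : ℝ) (x y : E) : rootNorm s (x - y) = rootNorm s (y - x) := by
  rw [← rootNorm_neg, neg_sub]

theorem rootNorm_add_le {s : ℝ} (hs : 0 < s) (x y : E) :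
    rootNorm s (x + y) ≤ 2 ^ s⁻¹ * (rootNorm s x + rootNorm s y) :=
  (Real.rpow_le_rpow (norm_nonneg _) (norm_add_le x y) (by positivity)).trans
    (add_rpow_le_two_rpow_mul (by positivity) (norm_nonneg _) (norm_nonneg _))

theorem rootNorm_le_sub_add {s : ℝ} (hs : 0 < s) (x y : E) :
    rootNorm s x ≤ 2 ^ s⁻¹ * (rootNorm s (x - y) + rootNorm s y) := by
  simpa using rootNorm_add_le hs (x - y) y

theorem continuous_rootNorm {s : ℝ} (hs : 0 < s) : Continuous (rootNorm s : E → ℝ) :=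
  continuous_norm.rpow_const fun _ => Or.inr (by positivity)

theorem rootNorm_smul {s : ℝ} [NormedSpace ℝ E] (c : ℝ) (x : E) :
    rootNorm s (c • x) = |c| ^ s⁻¹ * rootNorm s x := by
  unfold rootNorm
  rw [norm_smul, Real.norm_eq_abs, Real.mul_rpow (abs_nonneg _) (norm_nonneg _)]

theorem integrable_exp_neg_rootNorm [NormedSpace ℝ E] [FiniteDimensional ℝ E] [MeasurableSpace E]
    [BorelSpace E] (m : Measure E) [m.IsAddHaarMeasure] {s r : ℝ} (hs : 0 < s) (hr : 0 < r) :
    Integrable (fun x : E => Real.exp (-(r * rootNorm s x))) m := by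
  set n := Module.finrank ℝ E + 1 with hn
  obtain ⟨C, hC0, hC⟩ := exists_pow_le_exp hs hr n
  have hI := (integrable_one_add_norm (E := E) (μ := m) (r := n) (by simp [hn])).const_mul
    (2 ^ n * (1 + C))
  have hcont : Continuous fun x : E => Real.exp (-(r * rootNorm s x)) := by
    have := continuous_rootNorm (E := E) hs
    fun_prop
  refine hI.mono' hcont.aestronglyMeasurable (Filter.Eventually.of_forall fun x => ?_)
  have hx : (0 : ℝ) < 1 + ‖x‖ := by positivity
  rw [Real.rpow_neg hx.le, Real.rpow_natCast, ← div_eq_mul_inv, le_div_iff₀ (by positivity),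
    Real.norm_eq_abs, Real.abs_exp, Real.exp_neg, inv_mul_le_iff₀ (Real.exp_pos _)]
  have h3 : (1 + ‖x‖) ^ n ≤ 2 ^ n * (1 + ‖x‖ ^ n) := by
    refine (add_pow_le (zero_le_one) (norm_nonneg x) n).trans ?_
    rw [one_pow]
    gcongr
    · norm_num
    · simp
  refine h3.trans ?_
  have h4 := hC _ (norm_nonneg x)
  have h5 : (1 : ℝ) ≤ Real.exp (r * rootNorm s x) :=
    Real.one_le_exp (mul_nonneg hr.le (rootNorm_nonneg _ _))
  change ‖x‖ ^ n ≤ C * Real.exp (r * rootNorm s x) at h4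
  nlinarith [pow_pos (two_pos : (0:ℝ) < 2) n]

end RootNorm

section AnisoNorm

variable {d : ℕ}

/-- The anisotropic phase space gauge `‖y‖^{1/ν} + ‖η‖^{1/μ}`. -/
def anisoNorm (ν μ : ℝ) (z : Rd d × Rd d) : ℝ := rootNorm ν z.1 + rootNorm μ z.2

theorem anisoNorm_nonneg (ν μ : ℝ) (z : Rd d × Rd d) : 0 ≤ anisoNorm ν μ z :=
  add_nonneg (rootNorm_nonneg _ _) (rootNorm_nonneg _ _)

theorem continuous_anisoNorm {ν μ : ℝ} (hν : 0 < ν) (hμ : 0 < μ) :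
    Continuous (anisoNorm ν μ : Rd d × Rd d → ℝ) :=
  ((continuous_rootNorm hν).comp continuous_fst).add ((continuous_rootNorm hμ).comp continuous_snd)

/-- A constant in the quasi-triangle inequality for `anisoNorm`. -/
def quasiConst (ν μ : ℝ) : ℝ := 2 ^ ν⁻¹ + 2 ^ μ⁻¹

theorem one_le_quasiConst {ν μ : ℝ} (hν : 0 < ν) (hμ : 0 < μ) : 1 ≤ quasiConst ν μ := by
  have h1 : (1 : ℝ) ≤ 2 ^ ν⁻¹ := Real.one_le_rpow (by norm_num) (by positivity)
  have h2 : (1 : ℝ) ≤ 2 ^ μ⁻¹ := Real.one_le_rpow (by norm_num) (by positivity)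
  unfold quasiConst; linarith

theorem anisoNorm_le_sub_add {ν μ : ℝ} (hν : 0 < ν) (hμ : 0 < μ) (z w : Rd d × Rd d) :
    anisoNorm ν μ z ≤ quasiConst ν μ * (anisoNorm ν μ (z - w) + anisoNorm ν μ w) := by
  have h1 := rootNorm_le_sub_add hν z.1 w.1
  have h2 := rootNorm_le_sub_add hμ z.2 w.2
  have a1 := rootNorm_nonneg ν (z.1 - w.1)
  have a2 := rootNorm_nonneg ν w.1
  have a3 := rootNorm_nonneg μ (z.2 - w.2)
  have a4 := rootNorm_nonneg μ w.2
  have b1 : (0 : ℝ) < 2 ^ ν⁻¹ := by positivity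
  have b2 : (0 : ℝ) < 2 ^ μ⁻¹ := by positivity
  simp only [anisoNorm, quasiConst, Prod.fst_sub, Prod.snd_sub]
  nlinarith [mul_nonneg b1.le a3, mul_nonneg b1.le a4, mul_nonneg b2.le a1, mul_nonneg b2.le a2]

theorem integrable_exp_neg_anisoNorm {ν μ r : ℝ} (hν : 0 < ν) (hμ : 0 < μ) (hr : 0 < r) :
    Integrable (fun z : Rd d × Rd d => Real.exp (-(r * anisoNorm ν μ z))) := by
  have := (integrable_exp_neg_rootNorm (E := Rd d) volume hν hr).mul_prod
    (integrable_exp_neg_rootNorm (E := Rd d) volume hμ hr)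
  refine this.congr (Filter.Eventually.of_forall fun z => ?_)
  simp only [anisoNorm]
  rw [← Real.exp_add]
  ring_nf

end AnisoNorm

end GS

end

open scoped ContDiff SchwartzMap ComplexConjugate

/-! ### Gelfand–Shilov bounds as decay estimates, and the embedding in the Schwartz space -/

noncomputable section

namespace GS

variable {d : ℕ}

/-- `M` bounds the Gelfand–Shilov norm of `f` with parameter `h`. -/
def BoundedBy (ν μ h : ℝ) (f : Rd d → ℂ) (M : ℝ) : Prop :=
  ∀ x α β, |monomial α x| * ‖multiD β f x‖ ≤ M * weight ν μ h α β

theorem BoundedBy.nonneg {ν μ h : ℝ} {f : Rd d → ℂ} {M : ℝ} (hf : BoundedBy ν μ h f M) :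
    0 ≤ M := by
  have := (mul_nonneg (abs_nonneg _) (norm_nonneg _)).trans (hf 0 0 0)
  simpa [weight, fact, len] using this

theorem BoundedBy.mono {ν μ h h' : ℝ} (hh : 0 < h) (hle : h ≤ h') {f : Rd d → ℂ} {M : ℝ}
    (hf : BoundedBy ν μ h f M) : BoundedBy ν μ h' f M := fun x α β => by
  refine (hf x α β).trans (mul_le_mul_of_nonneg_left ?_ hf.nonneg)
  unfold weight
  gcongr

theorem monomial_single (i : Fin d) (k : ℕ) (x : Rd d) : monomial (Pi.single i k) x = x i ^ k := by
  unfold monomial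
  rw [Finset.prod_eq_single i]
  · simp
  · intro b _ hb
    simp [Pi.single_eq_of_ne hb]
  · simp

theorem fact_single (i : Fin d) (k : ℕ) : fact (Pi.single i k) = k.factorial := by
  unfold fact
  rw [Finset.prod_eq_single i]
  · simp
  · intro b _ hb
    simp [Pi.single_eq_of_ne hb]
  · simp

theorem len_single (i : Fin d) (k : ℕ) : len (Pi.single i k : Fin d → ℕ) = k := by
  simp [len]

theorem len_add (α β : Fin d → ℕ) : len (α + β) = len α + len β := by
  simp [len, Finset.sum_add_distrib]

theorem fact_pos (α : Fin d → ℕ) : (0 : ℝ) < fact α := by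
  unfold fact
  exact_mod_cast Finset.prod_pos fun j _ => Nat.factorial_pos _

theorem exists_norm_le_card_mul_abs (hd : 0 < d) (x : Rd d) : ∃ i, ‖x‖ ≤ d * |x i| := by
  have : Nonempty (Fin d) := ⟨⟨0, hd⟩⟩
  obtain ⟨i, hi⟩ := Finite.exists_max fun i => |x i|
  refine ⟨i, ?_⟩
  have h2 : ‖x‖ ≤ ∑ j, |x j| := by
    rw [EuclideanSpace.norm_eq]
    apply Real.sqrt_le_iff.2
    refine ⟨Finset.sum_nonneg fun _ _ => abs_nonneg _, ?_⟩
    simp only [Real.norm_eq_abs]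
    exact Finset.sum_sq_le_sq_sum_of_nonneg fun _ _ => abs_nonneg _
  refine h2.trans ((Finset.sum_le_sum fun j _ => hi j).trans ?_)
  simp

theorem abs_apply_le_norm (x : Rd d) (i : Fin d) : |x i| ≤ ‖x‖ := by
  simpa using PiLp.norm_apply_le x i

/-- A function whose products with all `|x_i|^n` grow at most like `h^n n!^s` decays like
`exp(-r‖x‖^{1/s})`. -/
theorem exists_le_exp_neg_rootNorm {s r : ℝ} (hs : 0 < s) (hr : 0 ≤ r) :
    ∃ h C : ℝ, 0 < h ∧ 0 < C ∧ ∀ (x : Rd d) (a M : ℝ), 0 ≤ a → a ≤ M →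
      (∀ i, ∀ n : ℕ, |x i| ^ n * a ≤ M * (h ^ n * (n.factorial : ℝ) ^ s)) →
      a ≤ C * M * Real.exp (-(r * rootNorm s x)) := by
  obtain ⟨h, C, hh, hC, H⟩ := exists_exp_mul_le hs (r * (d : ℝ) ^ s⁻¹)
  -- The summand `1` serves `d = 0`, where no coordinate is available and `a ≤ M` is all there is.
  refine ⟨h, C + 1, hh, by positivity, fun x a M ha haM hx => ?_⟩
  rcases Nat.eq_zero_or_pos d with rfl | hd
  · have : x = 0 := Subsingleton.elim _ _
    subst this
    rw [rootNorm_zero hs]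
    simp
    nlinarith
  obtain ⟨i, hi⟩ := exists_norm_le_card_mul_abs hd x
  have h1 := H |x i| a M (abs_nonneg _) ha (hx i)
  have h2 : rootNorm s x ≤ (d : ℝ) ^ s⁻¹ * |x i| ^ s⁻¹ := by
    unfold rootNorm
    rw [← Real.mul_rpow (by positivity) (by positivity)]
    exact Real.rpow_le_rpow (norm_nonneg _) hi (by positivity)
  rw [Real.exp_neg, ← div_eq_mul_inv, le_div_iff₀ (Real.exp_pos _), mul_comm]
  calc Real.exp (r * rootNorm s x) * a
      ≤ Real.exp (r * (d : ℝ) ^ s⁻¹ * |x i| ^ s⁻¹) * a := by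
        rw [mul_assoc]; gcongr
    _ ≤ C * M := h1
    _ ≤ (C + 1) * M := by nlinarith

/-- The supremum over the powers `x^α` is traded for exponential decay of any prescribed rate, while
the dependence on `β` keeps its factorial form. Only the powers of single coordinates are needed.
The smaller of two parameters serves both purposes at once. -/
theorem BoundedBy.exists_norm_multiD_le (μ : ℝ) {ν r h : ℝ} (hν : 0 < ν) (hr : 0 ≤ r)
    (hh : 0 < h) : ∃ h' C : ℝ, 0 < h' ∧ 0 < C ∧ ∀ (f : Rd d → ℂ) (M : ℝ), BoundedBy ν μ h' f M →
      ∀ x β, ‖multiD β f x‖ ≤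
        C * M * (h ^ len β * (fact β : ℝ) ^ μ) * Real.exp (-(r * rootNorm ν x)) := by
  obtain ⟨h0, C, hh0, hC, H⟩ := exists_le_exp_neg_rootNorm (d := d) hν hr
  refine ⟨min h h0, C, lt_min hh hh0, hC, fun f M hf x β => ?_⟩
  have hM := hf.nonneg
  have h1 : ∀ α : Fin d → ℕ, |monomial α x| * ‖multiD β f x‖ ≤
      (M * (h ^ len β * (fact β : ℝ) ^ μ)) * (h0 ^ len α * (fact α : ℝ) ^ ν) := fun α => by
    refine (hf x α β).trans ?_
    unfold weight
    rw [len_add, pow_add]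
    have e1 : min h h0 ^ len α ≤ h0 ^ len α := by gcongr; exact min_le_right _ _
    have e2 : min h h0 ^ len β ≤ h ^ len β := by gcongr; exact min_le_left _ _
    have e3 := Real.rpow_pos_of_pos (fact_pos α) ν
    have e4 := Real.rpow_pos_of_pos (fact_pos β) μ
    have e5 : 0 < min h h0 := lt_min hh hh0
    calc M * (min h h0 ^ len α * min h h0 ^ len β * (fact α : ℝ) ^ ν * (fact β : ℝ) ^ μ)
        ≤ M * (h0 ^ len α * h ^ len β * (fact α : ℝ) ^ ν * (fact β : ℝ) ^ μ) := by gcongr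
      _ = _ := by ring
  have h2 := H x ‖multiD β f x‖ (M * (h ^ len β * (fact β : ℝ) ^ μ)) (norm_nonneg _)
    (by simpa [monomial, len, fact] using h1 0) (fun i n => by
      simpa [monomial_single, len_single, fact_single] using h1 (Pi.single i n))
  rw [← mul_assoc] at h2
  exact h2

/-- Symmetry of the second derivative. The operator `multiD` applies the `D_j` in a fixed order, so
commutation is what allows a single `D_j` to be absorbed into or split off from `D^β`. -/
theorem endD_comm (i j : Fin d) : endD i * endD j = endD j * endD i := by
  refine LinearMap.ext fun f => Subtype.ext (funext fun x => ?_)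
  have hf : ContDiff ℝ ∞ f.1 := f.2
  have hd : DifferentiableAt ℝ (fderiv ℝ f.1) x :=
    ((hf.fderiv_right (m := ∞) (by simp)).differentiable (by simp)) x
  have key : ∀ i j : Fin d, D i (D j f.1) x = -I * (-I * fderiv ℝ (fderiv ℝ f.1) x
      (EuclideanSpace.single i 1) (EuclideanSpace.single j 1)) := fun i j => by
    unfold D
    have h1 : HasFDerivAt (fun y => fderiv ℝ f.1 y (EuclideanSpace.single j (1 : ℝ)))
        ((fderiv ℝ (fderiv ℝ f.1) x).flip (EuclideanSpace.single j 1)) x := by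
      have := hd.hasFDerivAt.clm_apply (hasFDerivAt_const (EuclideanSpace.single j (1 : ℝ)) x)
      simpa using this
    rw [(h1.const_mul (-I)).fderiv]
    simp
  have hs : IsSymmSndFDerivAt ℝ f.1 x := hf.contDiffAt.isSymmSndFDerivAt (by
    rw [minSmoothness_of_isRCLikeNormedField]; exact WithTop.coe_le_coe.2 (le_top : (2 : ℕ∞) ≤ ⊤))
  change D i (D j f.1) x = D j (D i f.1) x
  rw [key, key, hs.eq]

theorem endD_mul_endListD (l : List (Fin d)) (hl : l.Nodup) (β : Fin d → ℕ) (j : Fin d)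
    (hj : j ∈ l) : endD j * endListD l β = endListD l (β + Pi.single j 1) := by
  induction l with
  | nil => simp at hj
  | cons i l ih =>
    have hl' := List.nodup_cons.1 hl
    change endD j * (endD i ^ β i * endListD l β) =
      endD i ^ (β + Pi.single j 1 : Fin d → ℕ) i * endListD l (β + Pi.single j 1)
    by_cases hij : i = j
    · subst hij
      rw [endListD_congr l (β := β + Pi.single i 1) (γ := β)]
      · simp [pow_succ', mul_assoc]
      · intro k hk
        have : k ≠ i := by rintro rfl; exact hl'.1 hk
        simp [Pi.single_eq_of_ne this]
    · have hjl : j ∈ l := by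
        rcases List.mem_cons.1 hj with h | h
        · exact absurd h.symm hij
        · exact h
      have hc : endD j * endD i ^ β i = endD i ^ β i * endD j :=
        ((show Commute (endD j) (endD i) from endD_comm j i).pow_right _).eq
      rw [← mul_assoc, hc, mul_assoc, ih hl'.2 hjl]
      simp [Pi.single_eq_of_ne hij]

theorem D_multiD (j : Fin d) (β : Fin d → ℕ) {f : Rd d → ℂ} (hf : ContDiff ℝ ∞ f) :
    D j (multiD β f) = multiD (β + Pi.single j 1) f := by
  have := congrArg (fun T => (T (⟨f, hf⟩ : smooth d)).1) (endD_mul_endListD (List.finRange d)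
    (List.nodup_finRange d) β j (List.mem_finRange j))
  have h1 := endListD_apply (List.finRange d) (β + Pi.single j 1) (⟨f, hf⟩ : smooth d)
  have h2 := endListD_apply (List.finRange d) β (⟨f, hf⟩ : smooth d)
  change D j (endListD (List.finRange d) β ⟨f, hf⟩).1 = (endListD _ _ _).1 at this
  rw [h1, h2] at this
  exact this

theorem multiD_D (j : Fin d) (β : Fin d → ℕ) {f : Rd d → ℂ} (hf : ContDiff ℝ ∞ f) :
    multiD β (D j f) = multiD (β + Pi.single j 1) f := by
  rw [← D_multiD j β hf]
  have hc : endListD (List.finRange d) β * endD j = endD j * endListD (List.finRange d) β := by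
    generalize List.finRange d = l
    refine (Commute.list_prod_left _ _ fun T hT => ?_).eq
    obtain ⟨i, -, rfl⟩ := List.mem_map.1 hT
    exact (show Commute (endD i) (endD j) from endD_comm i j).pow_left _
  have := congrArg (fun T => (T (⟨f, hf⟩ : smooth d)).1) hc
  have h2 := endListD_apply (List.finRange d) β (⟨f, hf⟩ : smooth d)
  have h1 := endListD_apply (List.finRange d) β (endD j (⟨f, hf⟩ : smooth d))
  change (endListD (List.finRange d) β (endD j ⟨f, hf⟩)).1 =
    D j (endListD (List.finRange d) β ⟨f, hf⟩).1 at this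
  rw [h1, h2] at this
  exact this

theorem multiD_smooth (β : Fin d → ℕ) {f : Rd d → ℂ} (hf : ContDiff ℝ ∞ f) :
    ContDiff ℝ ∞ (multiD β f) := listD_smooth _ _ hf

theorem multiD_single (j : Fin d) (k : ℕ) {f : Rd d → ℂ} (hf : ContDiff ℝ ∞ f) :
    multiD (Pi.single j k) f = (D j)^[k] f := by
  induction k with
  | zero => simp [multiD_zero]
  | succ k ih =>
    rw [Function.iterate_succ_apply', ← ih, D_multiD j _ hf, ← Pi.single_add]

/-- Converts decay of the partial derivatives into decay of the iterated Fréchet derivatives, as the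
Schwartz space demands. The Fréchet derivative is a sum of fixed linear maps applied to the `D_j f`,
so the induction on the order runs over all functions simultaneously. -/
theorem norm_iteratedFDeriv_decay (n : ℕ) : ∀ {f : Rd d → ℂ}, ContDiff ℝ ∞ f →
    (∀ β, ∀ k : ℕ, ∃ C, ∀ x, ‖x‖ ^ k * ‖multiD β f x‖ ≤ C) →
    ∀ k : ℕ, ∃ C, ∀ x, ‖x‖ ^ k * ‖iteratedFDeriv ℝ n f x‖ ≤ C := by
  induction n with
  | zero =>
    intro f _ H k
    obtain ⟨C, hC⟩ := H 0 k
    rw [multiD_zero] at hC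
    exact ⟨C, by simpa using hC⟩
  | succ n ih =>
    intro f hf H k
    have hj : ∀ j : Fin d, ∃ C, ∀ x, ‖x‖ ^ k * ‖iteratedFDeriv ℝ n (D j f) x‖ ≤ C := fun j => by
      refine ih (D_smooth j hf) (fun β k => ?_) k
      rw [multiD_D j β hf]
      exact H _ k
    choose C hC using hj
    -- Multiplication by `i` undoes the factor `-i` in `D_j`.
    let Λ : Fin d → ℂ →L[ℝ] Rd d →L[ℝ] ℂ := fun j =>
      (ContinuousLinearMap.smulRightL ℝ (Rd d) ℂ (EuclideanSpace.proj j)).comp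
        (ContinuousLinearMap.mul ℝ ℂ I)
    have hfd : fderiv ℝ f = fun x => ∑ j, (Λ j ∘ D j f) x := by
      funext x
      refine ContinuousLinearMap.ext fun y => ?_
      have hy : y = ∑ j, y j • EuclideanSpace.single j (1 : ℝ) := by
        ext i
        simp [Pi.single_apply]
      conv_lhs => rw [hy]
      simp only [map_sum, map_smul, Function.comp_apply, _root_.sum_apply]
      refine Finset.sum_congr rfl fun j _ => ?_
      simp only [Λ, D, ContinuousLinearMap.comp_apply, ContinuousLinearMap.smulRightL_apply_apply,
        ContinuousLinearMap.mul_apply']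
      congr 1
      rw [← mul_assoc]
      simp
    refine ⟨∑ j, ‖Λ j‖ * C j, fun x => ?_⟩
    rw [← norm_iteratedFDeriv_fderiv, hfd, iteratedFDeriv_sum]
    · rw [Finset.sum_apply]
      refine (mul_le_mul_of_nonneg_left (norm_sum_le _ _) (by positivity)).trans ?_
      rw [Finset.mul_sum]
      refine Finset.sum_le_sum fun j _ => ?_
      have h1 := (Λ j).norm_iteratedFDeriv_comp_left (x := x) (n := n)
        (D_smooth j hf).contDiffAt (by exact_mod_cast le_top)
      calc ‖x‖ ^ k * ‖iteratedFDeriv ℝ n (Λ j ∘ D j f) x‖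
          ≤ ‖x‖ ^ k * (‖Λ j‖ * ‖iteratedFDeriv ℝ n (D j f) x‖) := by gcongr
        _ = ‖Λ j‖ * (‖x‖ ^ k * ‖iteratedFDeriv ℝ n (D j f) x‖) := by ring
        _ ≤ _ := by gcongr; exact hC j x
    · intro j _
      exact ((Λ j).contDiff.comp (D_smooth j hf)).of_le (by exact_mod_cast le_top)

theorem Mem.exists_boundedBy {ν μ : ℝ} {f : Rd d → ℂ} (hf : Mem ν μ f) {h : ℝ} (hh : 0 < h) :
    ∃ M, BoundedBy ν μ h f M := by
  obtain ⟨C, -, hC⟩ := (bdd_iff ν μ hh f).1 (hf.2 h hh)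
  exact ⟨C, hC⟩

theorem mem_of_boundedBy {ν μ : ℝ} {f : Rd d → ℂ} (hf : ContDiff ℝ ∞ f)
    (H : ∀ h : ℝ, 0 < h → ∃ M, BoundedBy ν μ h f M) : Mem ν μ f :=
  ⟨hf, fun h hh => by
    obtain ⟨M, hM⟩ := H h hh
    exact (bdd_iff ν μ hh f).2 ⟨M, hM.nonneg, hM⟩⟩

theorem Mem.decay {ν μ : ℝ} (hν : 0 < ν) {f : Rd d → ℂ} (hf : Mem ν μ f) (β : Fin d → ℕ) (k : ℕ) :
    ∃ C, ∀ x, ‖x‖ ^ k * ‖multiD β f x‖ ≤ C := by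
  obtain ⟨h', C, hh', hC, H⟩ :=
    BoundedBy.exists_norm_multiD_le (d := d) μ (r := 1) (h := 1) hν zero_le_one one_pos
  obtain ⟨M, hM⟩ := hf.exists_boundedBy hh'
  obtain ⟨A, hA, HA⟩ := exists_pow_le_exp hν one_pos k
  have hM0 := hM.nonneg
  have hb := fact_pos β
  refine ⟨A * (C * M * (1 ^ len β * (fact β : ℝ) ^ μ)), fun x => ?_⟩
  calc ‖x‖ ^ k * ‖multiD β f x‖ ≤ (A * Real.exp (1 * rootNorm ν x)) *
        (C * M * (1 ^ len β * (fact β : ℝ) ^ μ) * Real.exp (-(1 * rootNorm ν x))) := by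
        gcongr
        · exact HA _ (norm_nonneg x)
        · exact H f M hM x β
    _ = A * (C * M * (1 ^ len β * (fact β : ℝ) ^ μ)) *
        (Real.exp (1 * rootNorm ν x) * Real.exp (-(1 * rootNorm ν x))) := by ring
    _ = _ := by rw [← Real.exp_add]; simp

/-- A function in the Gelfand–Shilov space as a Schwartz function. -/
def Mem.toSchwartz {ν μ : ℝ} (hν : 0 < ν) {f : Rd d → ℂ} (hf : Mem ν μ f) : 𝓢(Rd d, ℂ) where
  toFun := f
  smooth' := hf.1
  decay' k n := norm_iteratedFDeriv_decay n hf.1 (hf.decay hν) k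

/-- The iterates of `D_j` as derivatives along a line. -/
theorem D_iterate_eq_iteratedDeriv (j : Fin d) (k : ℕ) {f : Rd d → ℂ} (hf : ContDiff ℝ ∞ f)
    (x : Rd d) (s : ℝ) : (D j)^[k] f (x + s • EuclideanSpace.single j 1) =
      (-I) ^ k * iteratedDeriv k (fun s : ℝ => f (x + s • EuclideanSpace.single j 1)) s := by
  induction k generalizing s with
  | zero => simp
  | succ k ih =>
    rw [Function.iterate_succ_apply', iteratedDeriv_succ]
    set g := (D j)^[k] f with hg
    have hg' : ContDiff ℝ ∞ g := D_iter_smooth j k hf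
    have h1 : HasDerivAt (fun s : ℝ => g (x + s • EuclideanSpace.single j 1))
        (fderiv ℝ g (x + s • EuclideanSpace.single j 1) (EuclideanSpace.single j 1)) s := by
      have h2 := ((hg'.differentiable (by simp)) (x + s • EuclideanSpace.single j 1)).hasFDerivAt
      have h3 : HasDerivAt (fun s : ℝ => x + s • EuclideanSpace.single j (1 : ℝ))
          (EuclideanSpace.single j (1 : ℝ)) s := by
        simpa using ((hasDerivAt_id s).smul_const (EuclideanSpace.single j (1 : ℝ))).const_add x
      exact h2.comp_hasDerivAt s h3
    have h4 : (fun s : ℝ => g (x + s • EuclideanSpace.single j 1)) = fun s =>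
      (-I) ^ k * iteratedDeriv k (fun s : ℝ => f (x + s • EuclideanSpace.single j 1)) s :=
      funext ih
    have h5 : iteratedDeriv k (fun s : ℝ => f (x + s • EuclideanSpace.single j 1)) =
        fun s => (-I)⁻¹ ^ k * g (x + s • EuclideanSpace.single j 1) := by
      funext s
      rw [congrFun h4 s, ← mul_assoc, ← mul_pow, inv_mul_cancel₀ (by simp), one_pow, one_mul]
    rw [h5, (h1.const_mul _).deriv, D, pow_succ', ← mul_assoc, mul_assoc (-I), ← mul_pow,
      mul_inv_cancel₀ (by simp), one_pow, mul_one]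

/-- The one-variable Leibniz rule along the line through `x` in direction `e_j`; the factors
`(-i)^k` and `(-i)^{n-k}` recombine. -/
theorem D_iterate_mul (j : Fin d) (n : ℕ) {f g : Rd d → ℂ} (hf : ContDiff ℝ ∞ f)
    (hg : ContDiff ℝ ∞ g) (x : Rd d) : (D j)^[n] (f * g) x =
      ∑ k ∈ Finset.range (n + 1), (n.choose k : ℂ) * (D j)^[k] f x * (D j)^[n - k] g x := by
  have hl : ContDiff ℝ ∞ fun s : ℝ => x + s • EuclideanSpace.single j (1 : ℝ) := by fun_prop
  have e := fun (k : ℕ) {f : Rd d → ℂ} (hf : ContDiff ℝ ∞ f) =>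
    D_iterate_eq_iteratedDeriv j k hf x 0
  simp only [zero_smul, add_zero] at e
  rw [e n (f := f * g) (hf.mul hg)]
  have := iteratedDeriv_mul (n := n) (x := (0 : ℝ))
    (f := fun s : ℝ => f (x + s • EuclideanSpace.single j (1 : ℝ)))
    (g := fun s : ℝ => g (x + s • EuclideanSpace.single j (1 : ℝ)))
    ((hf.comp hl).contDiffAt.of_le (by exact_mod_cast le_top))
    ((hg.comp hl).contDiffAt.of_le (by exact_mod_cast le_top))
  change _ * iteratedDeriv n ((fun s : ℝ => f (x + s • EuclideanSpace.single j (1 : ℝ))) *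
    fun s : ℝ => g (x + s • EuclideanSpace.single j (1 : ℝ))) 0 = _
  rw [this, Finset.mul_sum]
  refine Finset.sum_congr rfl fun k hk => ?_
  have hkn : k ≤ n := Nat.lt_succ_iff.1 (Finset.mem_range.1 hk)
  rw [e k hf, e (n - k) hg]
  have hp : (-I) ^ n = (-I) ^ k * (-I) ^ (n - k) := by rw [← pow_add, Nat.add_sub_cancel' hkn]
  rw [hp]
  ring

end GS

end

/-! ### The Fourier transform in Gelfand–Shilov norms -/

noncomputable section

namespace GS

variable {d : ℕ}

theorem D_mul_pow (i j : Fin d) (c : ℂ) (m : ℕ) : D i (fun x : Rd d => c * (x j : ℂ) ^ m) =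
    fun x => ((-I * if i = j then 1 else 0) * c * m) * (x j : ℂ) ^ (m - 1) := by
  funext x
  have h1 : HasFDerivAt (fun y : Rd d => (y j : ℂ)) (ofRealCLM.comp (EuclideanSpace.proj j)) x :=
    (ofRealCLM.comp (EuclideanSpace.proj (𝕜 := ℝ) j)).hasFDerivAt
  have h2 := (h1.pow m).const_mul c
  unfold D
  rw [h2.fderiv]
  by_cases hij : i = j
  · subst hij
    simp
    ring
  · have hji : j ≠ i := fun h => hij h.symm
    simp [hij, hji]

theorem D_iterate_coord_pow (i j : Fin d) (l k : ℕ) : (D i)^[k] (fun x : Rd d => (x j : ℂ) ^ l) =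
    fun x => ((-I * if i = j then 1 else 0) ^ k * l.descFactorial k) * (x j : ℂ) ^ (l - k) := by
  induction k with
  | zero => simp
  | succ k ih =>
    rw [Function.iterate_succ_apply', ih, D_mul_pow]
    funext x
    rw [Nat.descFactorial_succ, Nat.sub_sub]
    push_cast
    ring

theorem norm_D_iterate_coord_pow_le (i j : Fin d) (l k : ℕ) (x : Rd d) :
    ‖(D i)^[k] (fun x : Rd d => (x j : ℂ) ^ l) x‖ ≤ l.descFactorial k * |x j| ^ (l - k) := by
  rw [D_iterate_coord_pow]
  simp only [norm_mul, norm_pow, norm_natCast, norm_real, Real.norm_eq_abs]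
  refine mul_le_mul_of_nonneg_right ?_ (by positivity)
  refine mul_le_of_le_one_left (by positivity) (pow_le_one₀ (by positivity) ?_)
  split_ifs <;> simp

theorem contDiff_coord (j : Fin d) : ContDiff ℝ ∞ fun x : Rd d => (x j : ℂ) :=
  (ofRealCLM.comp (EuclideanSpace.proj (𝕜 := ℝ) j)).contDiff

/-- The use of `ν > 1`: the surplus `k!^{ν-1}` outgrows every geometric sequence, so plain
factorials, which arise from Leibniz terms and from Cauchy estimates, are admissible with
arbitrarily small `h`. -/
theorem exists_factorial_le {ν h : ℝ} (hν : 1 < ν) (hh : 0 < h) :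
    ∃ C : ℝ, 1 ≤ C ∧ ∀ k : ℕ, (k.factorial : ℝ) ≤ C * (h ^ k * (k.factorial : ℝ) ^ ν) := by
  obtain ⟨C, hC1, hC⟩ := exists_pow_le (s := ν - 1) (by linarith) hh zero_le_one
  refine ⟨C, hC1, fun k => ?_⟩
  have hk : (0 : ℝ) < k.factorial := by positivity
  have := hC k
  rw [one_pow, Real.rpow_sub_one hk.ne', ← mul_div_assoc, ← mul_div_assoc, le_div_iff₀ hk] at this
  linarith

/-- This is the integrand behind the mixed bounds for the Fourier transform. Each derivative that
falls on `x_j^l` costs a factorial, which `ν > 1` absorbs; the remaining power of `x_j` is paid for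
by the decay of `f`. Halving `h` pays for the binomial factors `2^n` and `2^l`. -/
theorem exists_norm_D_iterate_coord_mul_le {ν μ h : ℝ} (hν : 1 < ν) (hμ : 0 < μ) (hh : 0 < h) :
    ∃ h' C : ℝ, 0 < h' ∧ 0 < C ∧ ∀ (f : Rd d → ℂ) (M : ℝ), ContDiff ℝ ∞ f →
      BoundedBy ν μ h' f M → ∀ (i j : Fin d) (n l : ℕ) (x : Rd d),
      ‖(D i)^[n] ((fun x : Rd d => (x j : ℂ) ^ l) * f) x‖ ≤
        C * M * ((h ^ n * (n.factorial : ℝ) ^ μ) * (h ^ l * (l.factorial : ℝ) ^ ν)) *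
          Real.exp (-rootNorm ν x) := by
  have hν0 : 0 < ν := by linarith
  set k := h / 2 with hk
  have hk0 : 0 < k := by positivity
  obtain ⟨A, hA0, hA⟩ := exists_pow_le_mul_exp hν0 hk0
  obtain ⟨h', C, hh', hC, H⟩ :=
    BoundedBy.exists_norm_multiD_le (d := d) μ (r := A + 1) hν0 (by linarith) hk0
  -- The parameter is `k²` because a derivative on the monomial lowers both remaining exponents:
  -- `(k²)^a k^{l-a} k^{n-a} = k^n k^l`.
  obtain ⟨B, hB1, hB⟩ := exists_factorial_le hν (h := k ^ 2) (by positivity)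
  refine ⟨h', C * B, hh', by positivity, fun f M hf hM i j n l x => ?_⟩
  have hM0 := hM.nonneg
  have hfD : ∀ n, ‖(D i)^[n] f x‖ ≤ C * M * (k ^ n * (n.factorial : ℝ) ^ μ) *
      Real.exp (-((A + 1) * rootNorm ν x)) := fun n => by
    simpa [multiD_single i n hf, len_single, fact_single] using H f M hM x (Pi.single i n)
  rw [D_iterate_mul i n ((contDiff_coord j).pow l) hf]
  set W := (k ^ n * (n.factorial : ℝ) ^ μ) * (k ^ l * (l.factorial : ℝ) ^ ν) with hW
  have hterm : ∀ a ∈ Finset.range (n + 1), ‖(n.choose a : ℂ) *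
      (D i)^[a] (fun x : Rd d => (x j : ℂ) ^ l) x * (D i)^[n - a] f x‖ ≤
      (n.choose a : ℝ) * (2 ^ l * (C * B * M * W * Real.exp (-rootNorm ν x))) := by
    intro a ha
    have han : a ≤ n := Nat.lt_succ_iff.1 (Finset.mem_range.1 ha)
    rw [norm_mul, norm_mul, norm_natCast, mul_assoc]
    refine mul_le_mul_of_nonneg_left ?_ (by positivity)
    have h1 := norm_D_iterate_coord_pow_le i j l a x
    have h2 := hfD (n - a)
    by_cases hal : a ≤ l
    · have h3 : |x j| ^ (l - a) ≤ k ^ (l - a) * ((l - a).factorial : ℝ) ^ ν *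
          Real.exp (A * rootNorm ν x) := by
        refine (hA _ (abs_nonneg _) _).trans ?_
        gcongr
        exact Real.rpow_le_rpow (abs_nonneg _) (abs_apply_le_norm x j) (by positivity)
      have h4 : (l.descFactorial a : ℝ) ≤ 2 ^ l * a.factorial := by
        rw [Nat.descFactorial_eq_factorial_mul_choose]
        push_cast
        rw [mul_comm]
        gcongr
        exact_mod_cast Nat.choose_le_two_pow l a
      have h5 := hB a
      have h6 : (a.factorial : ℝ) ^ ν * ((l - a).factorial : ℝ) ^ ν ≤ (l.factorial : ℝ) ^ ν := by
        rw [← Real.mul_rpow (by positivity) (by positivity)]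
        refine Real.rpow_le_rpow (by positivity) ?_ hν0.le
        exact_mod_cast Nat.le_of_dvd (Nat.factorial_pos l)
          (Nat.factorial_mul_factorial_dvd_factorial hal)
      have h7 : ((n - a).factorial : ℝ) ^ μ ≤ (n.factorial : ℝ) ^ μ := by
        refine Real.rpow_le_rpow (by positivity) ?_ hμ.le
        exact_mod_cast Nat.factorial_le (Nat.sub_le n a)
      have h8 : Real.exp (A * rootNorm ν x) * Real.exp (-((A + 1) * rootNorm ν x)) =
          Real.exp (-rootNorm ν x) := by rw [← Real.exp_add]; ring_nf
      have h9 : (k ^ 2) ^ a * k ^ (l - a) * k ^ (n - a) = k ^ n * k ^ l := by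
        rw [← pow_mul, ← pow_add, ← pow_add, ← pow_add]
        congr 1
        omega
      calc ‖(D i)^[a] (fun x : Rd d => (x j : ℂ) ^ l) x‖ * ‖(D i)^[n - a] f x‖
          ≤ (2 ^ l * (B * ((k ^ 2) ^ a * (a.factorial : ℝ) ^ ν)) *
            (k ^ (l - a) * ((l - a).factorial : ℝ) ^ ν * Real.exp (A * rootNorm ν x))) *
            (C * M * (k ^ (n - a) * ((n - a).factorial : ℝ) ^ μ) *
              Real.exp (-((A + 1) * rootNorm ν x))) := by
            refine mul_le_mul (h1.trans ?_) h2 (norm_nonneg _) (by positivity)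
            refine mul_le_mul (h4.trans ?_) h3 (by positivity) (by positivity)
            gcongr
        _ = 2 ^ l * (C * B * M * ((((k ^ 2) ^ a * k ^ (l - a) * k ^ (n - a)) *
              (((n - a).factorial : ℝ) ^ μ *
              ((a.factorial : ℝ) ^ ν * ((l - a).factorial : ℝ) ^ ν))) *
              (Real.exp (A * rootNorm ν x) * Real.exp (-((A + 1) * rootNorm ν x))))) := by ring
        _ ≤ 2 ^ l * (C * B * M * (((k ^ n * k ^ l) * ((n.factorial : ℝ) ^ μ *
              (l.factorial : ℝ) ^ ν)) * Real.exp (-rootNorm ν x))) := by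
            rw [h8, h9]
            gcongr
        _ = _ := by rw [hW]; ring
    -- More than `l` derivatives annihilate `x_j^l`.
    · have h0 : l.descFactorial a = 0 := Nat.descFactorial_eq_zero_iff_lt.2 (not_le.1 hal)
      rw [h0, Nat.cast_zero, zero_mul] at h1
      have h0' := le_antisymm h1 (norm_nonneg _)
      rw [h0', zero_mul]
      positivity
  refine (norm_sum_le _ _).trans ((Finset.sum_le_sum hterm).trans (le_of_eq ?_))
  rw [← Finset.sum_mul]
  have : (∑ a ∈ Finset.range (n + 1), (n.choose a : ℝ)) = 2 ^ n := by
    exact_mod_cast Nat.sum_range_choose n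
  rw [this, hW, hk, div_pow, div_pow]
  field_simp

/-- The operator `D_j` on Schwartz functions. -/
def schwartzD (j : Fin d) (f : 𝓢(Rd d, ℂ)) : 𝓢(Rd d, ℂ) :=
  (-I) • ∂_{(EuclideanSpace.single j (1 : ℝ) : Rd d)} f

theorem coe_schwartzD (j : Fin d) (f : 𝓢(Rd d, ℂ)) : (schwartzD j f : Rd d → ℂ) = D j f := by
  funext x
  simp [schwartzD, D, SchwartzMap.lineDerivOp_apply_eq_fderiv]

theorem coe_schwartzD_iterate (j : Fin d) (n : ℕ) (f : 𝓢(Rd d, ℂ)) :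
    ((schwartzD j)^[n] f : Rd d → ℂ) = (D j)^[n] f := by
  induction n with
  | zero => rfl
  | succ n ih => rw [Function.iterate_succ_apply', Function.iterate_succ_apply', coe_schwartzD, ih]

/-- Multiplication by the coordinate `x_j` on Schwartz functions. -/
def schwartzX (j : Fin d) : 𝓢(Rd d, ℂ) →L[ℂ] 𝓢(Rd d, ℂ) :=
  SchwartzMap.smulLeftCLM ℂ fun x : Rd d => (x j : ℂ)

theorem schwartzX_apply (j : Fin d) (f : 𝓢(Rd d, ℂ)) (x : Rd d) :
    schwartzX j f x = (x j : ℂ) * f x := by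
  have : (fun x : Rd d => (x j : ℂ)).HasTemperateGrowth :=
    (ofRealCLM.comp (EuclideanSpace.proj (𝕜 := ℝ) j)).hasTemperateGrowth
  rw [schwartzX, SchwartzMap.smulLeftCLM_apply_apply this, smul_eq_mul]

theorem coe_schwartzX_iterate (j : Fin d) (n : ℕ) (f : 𝓢(Rd d, ℂ)) :
    ((schwartzX j)^[n] f : Rd d → ℂ) = (fun x : Rd d => (x j : ℂ) ^ n) * (f : Rd d → ℂ) := by
  induction n with
  | zero => funext x; simp
  | succ n ih =>
    funext x
    rw [Function.iterate_succ_apply', schwartzX_apply, ih, Pi.mul_apply, Pi.mul_apply, pow_succ']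
    ring

theorem inner_single_one (x : Rd d) (j : Fin d) :
    inner ℝ x (EuclideanSpace.single j (1 : ℝ)) = x j := by
  simp [EuclideanSpace.inner_single_right]

theorem fourier_schwartzD (j : Fin d) (f : 𝓢(Rd d, ℂ)) (ξ : Rd d) :
    𝓕 (schwartzD j f) ξ = (2 * Real.pi * ξ j : ℝ) * 𝓕 f ξ := by
  have : (inner ℝ · (EuclideanSpace.single j (1 : ℝ)) : Rd d → ℝ).HasTemperateGrowth := by fun_prop
  rw [schwartzD, FourierTransform.fourier_smul, SchwartzMap.fourier_lineDerivOp_eq]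
  simp only [_root_.smul_apply]
  rw [SchwartzMap.smulLeftCLM_apply_apply this, inner_single_one, real_smul, smul_eq_mul,
    smul_eq_mul]
  push_cast
  linear_combination (-2 * Real.pi * (ξ j : ℂ) * 𝓕 f ξ) * I_mul_I

theorem fourier_schwartzD_iterate (j : Fin d) (n : ℕ) (f : 𝓢(Rd d, ℂ)) (ξ : Rd d) :
    𝓕 ((schwartzD j)^[n] f) ξ = ((2 * Real.pi * ξ j : ℝ) : ℂ) ^ n * 𝓕 f ξ := by
  induction n with
  | zero => simp
  | succ n ih => rw [Function.iterate_succ_apply', fourier_schwartzD, ih]; ring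

theorem fourierInv_schwartzD (j : Fin d) (f : 𝓢(Rd d, ℂ)) (ξ : Rd d) :
    𝓕⁻ (schwartzD j f) ξ = (-(2 * Real.pi * ξ j) : ℝ) * 𝓕⁻ f ξ := by
  have : (inner ℝ · (EuclideanSpace.single j (1 : ℝ)) : Rd d → ℝ).HasTemperateGrowth := by fun_prop
  rw [schwartzD, FourierTransform.fourierInv_smul, SchwartzMap.fourierInv_lineDerivOp_eq]
  simp only [_root_.smul_apply]
  rw [SchwartzMap.smulLeftCLM_apply_apply this, inner_single_one, real_smul, smul_eq_mul,
    smul_eq_mul]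
  push_cast
  linear_combination (2 * Real.pi * (ξ j : ℂ) * 𝓕⁻ f ξ) * I_mul_I

theorem fourierInv_schwartzD_iterate (j : Fin d) (n : ℕ) (f : 𝓢(Rd d, ℂ)) (ξ : Rd d) :
    𝓕⁻ ((schwartzD j)^[n] f) ξ = ((-(2 * Real.pi * ξ j) : ℝ) : ℂ) ^ n * 𝓕⁻ f ξ := by
  induction n with
  | zero => simp
  | succ n ih => rw [Function.iterate_succ_apply', fourierInv_schwartzD, ih]; ring

theorem schwartzD_fourier (j : Fin d) (f : 𝓢(Rd d, ℂ)) :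
    schwartzD j (𝓕 f) = (-(2 * Real.pi) : ℂ) • 𝓕 (schwartzX j f) := by
  have : (inner ℝ · (EuclideanSpace.single j (1 : ℝ)) : Rd d → ℝ).HasTemperateGrowth := by fun_prop
  have h1 : schwartzX j f = SchwartzMap.smulLeftCLM ℂ
      (inner ℝ · (EuclideanSpace.single j (1 : ℝ)) : Rd d → ℝ) f := by
    ext x
    rw [schwartzX_apply, SchwartzMap.smulLeftCLM_apply_apply this, inner_single_one, real_smul]
  rw [schwartzD, SchwartzMap.lineDerivOp_fourier_eq, FourierTransform.fourier_smul, ← h1, smul_smul]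
  congr 1
  linear_combination (2 * Real.pi : ℂ) * I_mul_I

theorem schwartzD_iterate_fourier (j : Fin d) (n : ℕ) (f : 𝓢(Rd d, ℂ)) :
    (schwartzD j)^[n] (𝓕 f) = (-(2 * Real.pi) : ℂ) ^ n • 𝓕 ((schwartzX j)^[n] f) := by
  induction n with
  | zero => simp
  | succ n ih =>
    rw [Function.iterate_succ_apply', ih, Function.iterate_succ_apply', pow_succ, mul_smul,
      ← schwartzD_fourier, schwartzD, schwartzD, LineDeriv.lineDerivOp_smul, smul_comm]

theorem norm_fourier_le_integral (f : 𝓢(Rd d, ℂ)) (ξ : Rd d) : ‖𝓕 f ξ‖ ≤ ∫ x, ‖f x‖ := by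
  refine (SchwartzMap.norm_fourier_apply_le_toLp_one f ξ).trans_eq ?_
  exact SchwartzMap.norm_toLp_one

theorem norm_fourierInv_le_integral (f : 𝓢(Rd d, ℂ)) (ξ : Rd d) : ‖𝓕⁻ f ξ‖ ≤ ∫ x, ‖f x‖ := by
  have : 𝓕⁻ f ξ = 𝓕 f (-ξ) := by
    rw [SchwartzMap.fourierInv_coe, SchwartzMap.fourier_coe, Real.fourierInv_eq_fourier_neg]
  rw [this]
  exact norm_fourier_le_integral f _

/-- The Fourier transform exchanges `ν` and `μ`. Up to powers of `2π`, `ξ_i^n D_j^l 𝓕f` is the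
transform of `D_i^n (x_j^l f)`, hence bounded by an `L¹` norm; the powers of `ξ_i` are then
converted into decay. -/
theorem exists_norm_D_iterate_fourier_le {ν μ r h : ℝ} (hν : 1 < ν) (hμ : 0 < μ) (hr : 0 ≤ r)
    (hh : 0 < h) : ∃ h' C : ℝ, 0 < h' ∧ 0 < C ∧ ∀ (f : 𝓢(Rd d, ℂ)) (M : ℝ),
      BoundedBy ν μ h' f M → ∀ (j : Fin d) (l : ℕ) (ξ : Rd d),
      ‖(D j)^[l] (𝓕 f : 𝓢(Rd d, ℂ)) ξ‖ ≤
        C * M * (h ^ l * (l.factorial : ℝ) ^ ν) * Real.exp (-(r * rootNorm μ ξ)) := by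
  have hν0 : 0 < ν := by linarith
  have hpi : 0 < 2 * Real.pi := by positivity
  have hpi1 : 1 ≤ 2 * Real.pi := by linarith [Real.pi_gt_three]
  obtain ⟨h0, C0, hh0, hC0, H0⟩ := exists_le_exp_neg_rootNorm (d := d) hμ hr
  set k := min (h / (2 * Real.pi)) h0 with hk
  have hk0 : 0 < k := lt_min (by positivity) hh0
  obtain ⟨h', C, hh', hC, H⟩ := exists_norm_D_iterate_coord_mul_le (d := d) hν hμ hk0
  have hinteg := integrable_exp_neg_rootNorm (E := Rd d) volume hν0 one_pos
  simp only [one_mul] at hinteg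
  set J := ∫ x : Rd d, Real.exp (-rootNorm ν x) with hJ
  have hJ0 : 0 ≤ J := integral_nonneg fun _ => (Real.exp_pos _).le
  refine ⟨h', C0 * (C * (J + 1)), hh', by positivity, fun f M hM j l ξ => ?_⟩
  have hM0 := hM.nonneg
  set W := C * M * (h ^ l * (l.factorial : ℝ) ^ ν) * J with hW
  have hW0 : 0 ≤ W := by positivity
  have key : ∀ i n, |ξ i| ^ n * ‖(D j)^[l] (𝓕 f : 𝓢(Rd d, ℂ)) ξ‖ ≤
      W * (h0 ^ n * (n.factorial : ℝ) ^ μ) := fun i n => by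
    rw [← coe_schwartzD_iterate, schwartzD_iterate_fourier, _root_.smul_apply, norm_smul,
      norm_pow, norm_neg, norm_mul, norm_ofNat, norm_real, Real.norm_of_nonneg Real.pi_pos.le]
    have h1 : |ξ i| ^ n * ‖𝓕 ((schwartzX j)^[l] f) ξ‖ ≤
        ∫ x, ‖(schwartzD i)^[n] ((schwartzX j)^[l] f) x‖ := by
      refine le_trans ?_ (norm_fourier_le_integral _ ξ)
      rw [fourier_schwartzD_iterate, norm_mul, norm_pow, norm_real, Real.norm_eq_abs, abs_mul,
        abs_of_pos hpi]
      gcongr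
      exact le_mul_of_one_le_left (abs_nonneg _) hpi1
    have h2 : ∫ x, ‖(schwartzD i)^[n] ((schwartzX j)^[l] f) x‖ ≤
        C * M * ((k ^ n * (n.factorial : ℝ) ^ μ) * (k ^ l * (l.factorial : ℝ) ^ ν)) * J := by
      rw [hJ, ← integral_const_mul]
      refine integral_mono_of_nonneg (Filter.Eventually.of_forall fun x => norm_nonneg _)
        (hinteg.const_mul _) (Filter.Eventually.of_forall fun x => ?_)
      rw [coe_schwartzD_iterate, coe_schwartzX_iterate]
      exact H f M (f.smooth ⊤) hM i j n l x
    have e1 : k ^ n ≤ h0 ^ n := by gcongr; exact min_le_right _ _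
    have e2 : (2 * Real.pi) ^ l * k ^ l ≤ h ^ l := by
      rw [← mul_pow]
      gcongr
      have : k ≤ h / (2 * Real.pi) := min_le_left _ _
      rwa [le_div_iff₀ hpi, mul_comm] at this
    calc |ξ i| ^ n * ((2 * Real.pi) ^ l * ‖𝓕 ((schwartzX j)^[l] f) ξ‖)
        = (2 * Real.pi) ^ l * (|ξ i| ^ n * ‖𝓕 ((schwartzX j)^[l] f) ξ‖) := by ring
      _ ≤ (2 * Real.pi) ^ l *
          (C * M * ((k ^ n * (n.factorial : ℝ) ^ μ) * (k ^ l * (l.factorial : ℝ) ^ ν)) * J) := by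
          exact mul_le_mul_of_nonneg_left (h1.trans h2) (by positivity)
      _ = C * M * ((k ^ n * (n.factorial : ℝ) ^ μ) * (((2 * Real.pi) ^ l * k ^ l) *
          (l.factorial : ℝ) ^ ν)) * J := by ring
      _ ≤ C * M * ((h0 ^ n * (n.factorial : ℝ) ^ μ) * (h ^ l * (l.factorial : ℝ) ^ ν)) * J := by
          gcongr
      _ = _ := by rw [hW]; ring
  by_cases hd : Nonempty (Fin d)
  · have h3 := H0 ξ _ W (norm_nonneg _) (by simpa using key hd.some 0) key
    refine h3.trans (mul_le_mul_of_nonneg_right ?_ (Real.exp_pos _).le)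
    have : C * M * (h ^ l * (l.factorial : ℝ) ^ ν) * J ≤
      C * M * (h ^ l * (l.factorial : ℝ) ^ ν) * (J + 1) := by gcongr; linarith
    refine (mul_le_mul_of_nonneg_left this hC0.le).trans_eq ?_
    ring
  · exact absurd ⟨j⟩ hd

end GS

end

/-! ### Polynomial phase multipliers: Cauchy estimates and decay -/

noncomputable section

namespace GS

variable {d : ℕ}

/-- The unimodular symbol `exp(i ∑_j ρ_j(η_j))`. -/
def phaseSymbol (ρ : Fin d → Polynomial ℝ) (η : Rd d) : ℂ :=
  exp (I * ((∑ j, (ρ j).eval (η j) : ℝ) : ℂ))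

theorem norm_phaseSymbol (ρ : Fin d → Polynomial ℝ) (η : Rd d) : ‖phaseSymbol ρ η‖ = 1 := by
  rw [phaseSymbol, mul_comm]
  exact norm_exp_ofReal_mul_I _

theorem iteratedDeriv_exp_I_mul (n : ℕ) : iteratedDeriv n (fun t : ℝ => exp (I * (t : ℂ))) =
    fun t : ℝ => I ^ n * exp (I * (t : ℂ)) := by
  induction n with
  | zero => simp
  | succ n ih =>
    rw [iteratedDeriv_succ, ih]
    funext t
    have h1 : HasDerivAt (fun t : ℝ => I * (t : ℂ)) I t := by
      simpa using (ofRealCLM.hasDerivAt (x := t)).const_mul I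
    rw [(h1.cexp.const_mul _).deriv]
    ring

theorem hasTemperateGrowth_exp_I_mul :
    (fun t : ℝ => exp (I * (t : ℂ))).HasTemperateGrowth := by
  refine ⟨(contDiff_const.mul ofRealCLM.contDiff).cexp, fun n => ⟨0, 1, fun t => ?_⟩⟩
  rw [norm_iteratedFDeriv_eq_norm_iteratedDeriv, iteratedDeriv_exp_I_mul]
  simp [mul_comm I, norm_exp_ofReal_mul_I]

theorem hasTemperateGrowth_coord (j : Fin d) : (fun x : Rd d => x j).HasTemperateGrowth :=
  (EuclideanSpace.proj (𝕜 := ℝ) j : Rd d →L[ℝ] ℝ).hasTemperateGrowth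

theorem hasTemperateGrowth_phaseSymbol (ρ : Fin d → Polynomial ℝ) :
    (phaseSymbol ρ).HasTemperateGrowth := by
  have h1 : (fun η : Rd d => ∑ j, (ρ j).eval (η j)).HasTemperateGrowth := by
    have := Function.HasTemperateGrowth.sum (s := Finset.univ)
      (f := fun (j : Fin d) (η : Rd d) => (ρ j).eval (η j)) fun j _ => by
        have h2 : (fun η : Rd d => (ρ j).eval (η j)) = fun η =>
            ∑ i ∈ Finset.range ((ρ j).natDegree + 1), (ρ j).coeff i * η j ^ i := by
          funext η
          rw [Polynomial.eval_eq_sum_range]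
        rw [h2]
        exact Function.HasTemperateGrowth.sum fun i _ =>
          (Function.HasTemperateGrowth.const _).mul ((hasTemperateGrowth_coord j).pow i)
    exact this
  exact hasTemperateGrowth_exp_I_mul.comp h1

theorem contDiff_phaseSymbol (ρ : Fin d → Polynomial ℝ) : ContDiff ℝ ∞ (phaseSymbol ρ) :=
  (hasTemperateGrowth_phaseSymbol ρ).1

/-- The Fourier multiplier with symbol `phaseSymbol ρ`. -/
def phaseMultiplier (ρ : Fin d → Polynomial ℝ) : 𝓢(Rd d, ℂ) →L[ℂ] 𝓢(Rd d, ℂ) :=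
  SchwartzMap.fourierMultiplierCLM ℂ (phaseSymbol ρ)

/-- Multiplication by `phaseSymbol ρ`. -/
def phaseMul (ρ : Fin d → Polynomial ℝ) : 𝓢(Rd d, ℂ) →L[ℂ] 𝓢(Rd d, ℂ) :=
  SchwartzMap.smulLeftCLM ℂ (phaseSymbol ρ)

theorem phaseMul_apply (ρ : Fin d → Polynomial ℝ) (f : 𝓢(Rd d, ℂ)) (x : Rd d) :
    phaseMul ρ f x = phaseSymbol ρ x * f x := by
  rw [phaseMul, SchwartzMap.smulLeftCLM_apply_apply (hasTemperateGrowth_phaseSymbol ρ), smul_eq_mul]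

theorem phaseMultiplier_eq (ρ : Fin d → Polynomial ℝ) (f : 𝓢(Rd d, ℂ)) :
    phaseMultiplier ρ f = 𝓕⁻ (phaseMul ρ (𝓕 f)) := by
  rw [phaseMultiplier, SchwartzMap.fourierMultiplierCLM_apply, phaseMul]

theorem fourier_phaseMultiplier (ρ : Fin d → Polynomial ℝ) (f : 𝓢(Rd d, ℂ)) :
    𝓕 (phaseMultiplier ρ f) = phaseMul ρ (𝓕 f) := by
  rw [phaseMultiplier_eq, FourierTransform.fourier_fourierInv_eq]

theorem norm_fourier_phaseMultiplier (ρ : Fin d → Polynomial ℝ) (f : 𝓢(Rd d, ℂ)) (ξ : Rd d) :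
    ‖𝓕 (phaseMultiplier ρ f) ξ‖ = ‖𝓕 f ξ‖ := by
  rw [fourier_phaseMultiplier, phaseMul_apply, norm_mul, norm_phaseSymbol, one_mul]

theorem iteratedDeriv_comp_ofReal {F : ℂ → ℂ} (hF : ContDiff ℂ ∞ F) (n : ℕ) :
    iteratedDeriv n (fun t : ℝ => F t) = fun t : ℝ => iteratedDeriv n F t := by
  induction n with
  | zero => simp
  | succ n ih =>
    funext t
    rw [iteratedDeriv_succ, ih, iteratedDeriv_succ]
    have h1 : DifferentiableAt ℂ (iteratedDeriv n F) t :=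
      (hF.differentiable_iteratedDeriv n (by exact_mod_cast WithTop.coe_lt_top n)) t
    exact h1.hasDerivAt.comp_ofReal.deriv

/-- Cauchy estimates for the derivatives of `exp(i ρ)`. -/
theorem norm_iteratedDeriv_exp_polynomial_le (ρ : Polynomial ℝ) {B Y s : ℝ} (hB : 0 ≤ B)
    (hY : 0 < Y) (H : ∀ w : ℂ, ‖w‖ ≤ 1 →
      ‖Polynomial.aeval ((s : ℂ) + w) ρ - ((ρ.eval s : ℝ) : ℂ)‖ ≤ B * ‖w‖ * Y) (l : ℕ) :
    ‖iteratedDeriv l (fun t : ℝ => exp (I * ((ρ.eval t : ℝ) : ℂ))) s‖ ≤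
      Real.exp B ^ l * (Y ^ l + l.factorial) := by
  set F : ℂ → ℂ := fun z => exp (I * Polynomial.aeval z ρ) with hFdef
  have hF : ContDiff ℂ ∞ F := (contDiff_const.mul (Polynomial.contDiff_aeval ρ ∞)).cexp
  have h0 : (fun t : ℝ => exp (I * ((ρ.eval t : ℝ) : ℂ))) = fun t : ℝ => F t := by
    funext t
    rw [hFdef]
    congr 2
    exact (Polynomial.aeval_algebraMap_apply_eq_algebraMap_eval t ρ).symm
  -- For `l = 0` the radius chosen below would be `0`.
  rcases Nat.eq_zero_or_pos l with rfl | hl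
  · simp [mul_comm I, norm_exp_ofReal_mul_I]
  rw [h0, iteratedDeriv_comp_ofReal hF]
  have hl' : (0 : ℝ) < l := by exact_mod_cast hl
  -- The bound `R ≤ 1` keeps the circle where the hypothesis holds, and `R Y ≤ l` keeps the function
  -- below `e^{Bl}` on it. The loss `l! / R^l` is `l!` if `R = 1`, and otherwise at most `Y^l`, by
  -- `l! ≤ l^l`.
  set R := min 1 (l / Y) with hR
  have hR0 : 0 < R := lt_min one_pos (by positivity)
  have hsph : ∀ z ∈ Metric.sphere (s : ℂ) R, ‖F z‖ ≤ Real.exp (B * l) := by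
    intro z hz
    have hz' : ‖z - s‖ = R := by simpa using hz
    have h1 := H (z - s) (hz' ▸ min_le_left _ _)
    rw [add_sub_cancel, hz'] at h1
    rw [hFdef]
    simp only [norm_exp]
    refine Real.exp_le_exp.2 ?_
    -- The value `ρ(s)` is real, so only the increment of `ρ` influences the modulus of the
    -- exponential.
    have h2 : (I * Polynomial.aeval z ρ).re = -(Polynomial.aeval z ρ - ((ρ.eval s : ℝ) : ℂ)).im := by
      simp
    rw [h2]
    calc -(Polynomial.aeval z ρ - ((ρ.eval s : ℝ) : ℂ)).im
        ≤ |(Polynomial.aeval z ρ - ((ρ.eval s : ℝ) : ℂ)).im| := neg_le_abs _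
      _ ≤ _ := abs_im_le_norm _
      _ ≤ B * R * Y := h1
      _ = B * (R * Y) := by ring
      _ ≤ B * l := by
          gcongr
          have : R ≤ l / Y := min_le_right _ _
          rwa [le_div_iff₀ hY] at this
  have h3 := norm_iteratedDeriv_le_of_forall_mem_sphere_norm_le l hR0
    (hF.differentiable (by simp)).diffContOnCl hsph
  refine h3.trans ?_
  have h4 : (R ^ l)⁻¹ * l.factorial ≤ Y ^ l + l.factorial := by
    rcases le_total 1 ((l : ℝ) / Y) with h | h
    · rw [hR, min_eq_left h]
      simp; positivity
    · rw [hR, min_eq_right h, div_pow, inv_div, div_mul_eq_mul_div, div_le_iff₀ (by positivity)]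
      have : (l.factorial : ℝ) ≤ (l : ℝ) ^ l := by exact_mod_cast Nat.factorial_le_pow l
      have h5 : (0 : ℝ) ≤ l.factorial * (l : ℝ) ^ l := by positivity
      nlinarith [pow_pos hY l]
  rw [mul_comm B, Real.exp_nat_mul, div_eq_inv_mul]
  calc (R ^ l)⁻¹ * (l.factorial * Real.exp B ^ l)
      = Real.exp B ^ l * ((R ^ l)⁻¹ * l.factorial) := by ring
    _ ≤ _ := by gcongr

/-- The use of `μ(m-1) ≤ ν`. The base is at least `1`, so `1/ν` may be replaced by `1/(μ(m-1))`, for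
which the product of `m-1` factors is homogeneous of degree `1/μ`. One factor is free of `X`, so a
Young-type splitting makes the coefficient of `X^{1/μ}` as small as desired. It is normalized to `1`
whatever `K` is; the cost falls on the `s` term and the constant. -/
theorem exists_mul_rpow_le {μ ν K : ℝ} (hμ : 0 < μ) (hK : 0 < K) {m : ℕ} (hm : 2 ≤ m)
    (hνμ : μ * ((m : ℝ) - 1) ≤ ν) : ∃ A C : ℝ, 0 ≤ A ∧ ∀ X s : ℝ, 0 ≤ X → 0 ≤ s →
      K * ((1 + X + s) ^ (m - 2) * (1 + s)) ^ ν⁻¹ ≤ X ^ μ⁻¹ + A * s ^ μ⁻¹ + C := by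
  obtain ⟨n, rfl⟩ : ∃ n, m = n + 2 := ⟨m - 2, by omega⟩
  set p : ℝ := μ * ((n + 2 : ℕ) - 1) with hp
  have hn1 : (0 : ℝ) < ((n + 2 : ℕ) : ℝ) - 1 := by push_cast; linarith [(Nat.cast_nonneg n : (0:ℝ) ≤ n)]
  have hp0 : 0 < p := by positivity
  have hpn : p = μ * ((n + 1 : ℕ) : ℝ) := by rw [hp]; push_cast; ring
  set T : ℝ := 2 ^ μ⁻¹ with hT
  have hT0 : 0 < T := by positivity
  -- Here `T` is the loss in splitting `a = X + b`, so `K ε T = 1` is the final coefficient of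
  -- `X^{1/μ}`.
  set ε : ℝ := 1 / (K * T) with hε
  have hε0 : 0 < ε := by positivity
  set δ : ℝ := ε ^ p with hδ
  have hδ0 : 0 < δ := by positivity
  set Dδ : ℝ := ((δ⁻¹) ^ n) ^ p⁻¹ with hD
  have hD0 : 0 ≤ Dδ := by positivity
  refine ⟨(1 + K * Dδ) * T, (1 + K * Dδ) * T, by positivity, fun X s hX hs => ?_⟩
  set a := 1 + X + s with ha
  set b := 1 + s with hb
  have hb1 : 1 ≤ b := by linarith
  have hba : b ≤ a := by linarith
  have ha1 : 1 ≤ a := hb1.trans hba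
  have hY1 : 1 ≤ a ^ n * b := one_le_mul_of_one_le_of_one_le (one_le_pow₀ ha1) hb1
  have h1 : (a ^ (n + 2 - 2) * b) ^ ν⁻¹ ≤ (a ^ n * b) ^ p⁻¹ := by
    rw [Nat.add_sub_cancel]
    exact Real.rpow_le_rpow_of_exponent_le hY1 (inv_anti₀ hp0 hνμ)
  have hpow : ∀ c : ℝ, 0 ≤ c → (c ^ (n + 1)) ^ p⁻¹ = c ^ μ⁻¹ := fun c hc => by
    rw [← Real.rpow_natCast, ← Real.rpow_mul hc, hpn]
    congr 1
    field_simp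
  have h2 : (a ^ n * b) ^ p⁻¹ ≤ ε * a ^ μ⁻¹ + Dδ * b ^ μ⁻¹ := by
    have hnn1 : 0 ≤ ε * a ^ μ⁻¹ := by positivity
    have hnn2 : 0 ≤ Dδ * b ^ μ⁻¹ := by positivity
    -- If `b` is small relative to `a`, it supplies the small factor `δ = ε^p`; otherwise `a` is
    -- comparable to `b` and everything is charged to `b`.
    rcases le_total b (δ * a) with h | h
    · have : (a ^ n * b) ^ p⁻¹ ≤ (δ * a ^ (n + 1)) ^ p⁻¹ := by
        refine Real.rpow_le_rpow (by positivity) ?_ (by positivity)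
        calc a ^ n * b ≤ a ^ n * (δ * a) := by gcongr
          _ = _ := by ring
      rw [Real.mul_rpow hδ0.le (by positivity), hpow a (by linarith), hδ,
        Real.rpow_rpow_inv hε0.le hp0.ne'] at this
      linarith
    · have h' : a ≤ δ⁻¹ * b := by
        rw [inv_mul_eq_div, le_div_iff₀ hδ0]; linarith
      have : (a ^ n * b) ^ p⁻¹ ≤ ((δ⁻¹) ^ n * b ^ (n + 1)) ^ p⁻¹ := by
        refine Real.rpow_le_rpow (by positivity) ?_ (by positivity)
        calc a ^ n * b ≤ (δ⁻¹ * b) ^ n * b := by gcongr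
          _ = _ := by rw [mul_pow, pow_succ, mul_assoc]
      rw [Real.mul_rpow (x := δ⁻¹ ^ n) (by positivity) (by positivity), hpow b (by linarith)] at this
      linarith
  have h3 : a ^ μ⁻¹ ≤ T * (X ^ μ⁻¹ + b ^ μ⁻¹) := by
    rw [show a = X + b by rw [ha, hb]; ring]
    exact add_rpow_le_two_rpow_mul (by positivity) hX (by linarith)
  have h4 : b ^ μ⁻¹ ≤ T * (1 + s ^ μ⁻¹) := by
    simpa using add_rpow_le_two_rpow_mul (p := μ⁻¹) (by positivity) zero_le_one hs
  calc K * (a ^ (n + 2 - 2) * b) ^ ν⁻¹ ≤ K * (ε * a ^ μ⁻¹ + Dδ * b ^ μ⁻¹) := by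
        gcongr; exact h1.trans h2
    _ ≤ K * (ε * (T * (X ^ μ⁻¹ + b ^ μ⁻¹)) + Dδ * b ^ μ⁻¹) := by gcongr
    _ = X ^ μ⁻¹ + (1 + K * Dδ) * b ^ μ⁻¹ := by rw [hε]; field_simp; ring_nf
    _ ≤ X ^ μ⁻¹ + (1 + K * Dδ) * (T * (1 + s ^ μ⁻¹)) := by gcongr
    _ = _ := by ring

/-- Puts the Cauchy bound into Gelfand–Shilov form. Dividing `h` by `e^B` absorbs `e^{Bl}`. The
smallness of `h` enters only through `K` in the previous lemma, so it does not affect the factor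
`exp(X^{1/μ})`. -/
theorem exists_exp_pow_mul_le {μ ν B h : ℝ} (hμ : 0 < μ) (hν : 1 < ν) (hh : 0 < h) {m : ℕ}
    (hm : 2 ≤ m) (hνμ : μ * ((m : ℝ) - 1) ≤ ν) : ∃ A C : ℝ, 0 ≤ A ∧ 0 < C ∧
      ∀ X s : ℝ, 0 ≤ X → 0 ≤ s → ∀ l : ℕ,
      Real.exp B ^ l * (((1 + X + s) ^ (m - 2) * (1 + s)) ^ l + l.factorial) ≤
        C * (h ^ l * (l.factorial : ℝ) ^ ν) * Real.exp (X ^ μ⁻¹) * Real.exp (A * s ^ μ⁻¹) := by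
  have hν0 : 0 < ν := by linarith
  set k := h / Real.exp B with hk
  have hk0 : 0 < k := by positivity
  have hkh : Real.exp B * k = h := by rw [hk]; field_simp
  obtain ⟨A, C, hA, H⟩ := exists_mul_rpow_le hμ (K := ν * k⁻¹ ^ ν⁻¹) (by positivity) hm hνμ
  obtain ⟨C', hC', H'⟩ := exists_factorial_le hν hk0
  refine ⟨A, Real.exp C + C', hA, by positivity, fun X s hX hs l => ?_⟩
  set Y := (1 + X + s) ^ (m - 2) * (1 + s) with hY
  have hY0 : 0 ≤ Y := by positivity
  have h1 := pow_le_factorial_rpow_mul_exp hν0 hk0 hY0 l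
  have h2 : Real.exp (ν * k⁻¹ ^ ν⁻¹ * Y ^ ν⁻¹) ≤
      Real.exp C * (Real.exp (X ^ μ⁻¹) * Real.exp (A * s ^ μ⁻¹)) := by
    rw [← Real.exp_add, ← Real.exp_add]
    exact Real.exp_le_exp.2 ((H X s hX hs).trans_eq (by ring))
  have h3 : 1 ≤ Real.exp (X ^ μ⁻¹) * Real.exp (A * s ^ μ⁻¹) := by
    rw [← Real.exp_add]
    exact Real.one_le_exp (by positivity)
  set E := Real.exp (X ^ μ⁻¹) * Real.exp (A * s ^ μ⁻¹) with hE
  have hE0 : 0 < E := by positivity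
  have h4 : Real.exp B ^ l * k ^ l = h ^ l := by rw [← mul_pow, hkh]
  calc Real.exp B ^ l * (Y ^ l + l.factorial)
      ≤ Real.exp B ^ l * (k ^ l * (l.factorial : ℝ) ^ ν * (Real.exp C * E) +
          C' * (k ^ l * (l.factorial : ℝ) ^ ν) * E) := by
        gcongr
        · exact h1.trans (by gcongr)
        · exact (H' l).trans (le_mul_of_one_le_right (by positivity) h3)
    _ = (Real.exp C + C') * ((Real.exp B ^ l * k ^ l) * (l.factorial : ℝ) ^ ν) * E := by ring
    _ = _ := by rw [h4, hE]; ring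

theorem norm_D_iterate_phaseSymbol (ρ : Fin d → Polynomial ℝ) (j : Fin d) (l : ℕ) (η : Rd d) :
    ‖(D j)^[l] (phaseSymbol ρ) η‖ =
      ‖iteratedDeriv l (fun t : ℝ => exp (I * (((ρ j).eval t : ℝ) : ℂ))) (η j)‖ := by
  have h1 := D_iterate_eq_iteratedDeriv j l (contDiff_phaseSymbol ρ) η 0
  rw [zero_smul, add_zero] at h1
  -- The phase is separable: along direction `e_j` the other coordinates contribute only a
  -- unimodular constant.
  set c : ℂ := exp (I * ((∑ i ∈ Finset.univ.erase j, (ρ i).eval (η i) : ℝ) : ℂ)) with hc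
  have hc1 : ‖c‖ = 1 := by rw [hc, mul_comm]; exact norm_exp_ofReal_mul_I _
  have h2 : (fun s : ℝ => phaseSymbol ρ (η + s • EuclideanSpace.single j 1)) =
      fun s => c * (fun t : ℝ => exp (I * (((ρ j).eval t : ℝ) : ℂ))) (η j + s) := by
    funext s
    rw [phaseSymbol, ← Finset.add_sum_erase _ _ (Finset.mem_univ j), hc]
    have e1 : ∑ i ∈ Finset.univ.erase j,
        (ρ i).eval ((η + s • EuclideanSpace.single j (1 : ℝ) : Rd d) i) =
        ∑ i ∈ Finset.univ.erase j, (ρ i).eval (η i) := by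
      refine Finset.sum_congr rfl fun i hi => ?_
      simp [Finset.ne_of_mem_erase hi]
    rw [e1, ofReal_add, mul_add, exp_add, mul_comm]
    simp
  rw [h1, h2, iteratedDeriv_const_mul_field, iteratedDeriv_comp_const_add l
    (fun t : ℝ => exp (I * (((ρ j).eval t : ℝ) : ℂ))) (η j)]
  simp [hc1]

/-- The central estimate, uniform in the phase. Powers of `x_i` become derivatives of `e^{iρ} 𝓕f`.
The derivatives of the symbol grow like `exp(A‖η‖^{1/μ})`, which the decay of `𝓕f` at rate `A + 1`
absorbs with an integrable rest. The phase enters only through `B` and `X`, and the factor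
`exp(X^{1/μ})` is the same for every rate `r`. -/
theorem exists_norm_phaseMultiplier_le (hd : 0 < d) {μ ν B r : ℝ} (hμ : 0 < μ) (hν : 1 < ν) (hB : 0 ≤ B)
    (hr : 0 ≤ r) {m : ℕ} (hm : 2 ≤ m) (hνμ : μ * ((m : ℝ) - 1) ≤ ν) :
    ∃ h' C : ℝ, 0 < h' ∧ 0 < C ∧ ∀ (f : 𝓢(Rd d, ℂ)) (M : ℝ), BoundedBy ν μ h' f M →
      ∀ (ρ : Fin d → Polynomial ℝ) (X : ℝ), 0 ≤ X →
      (∀ (j : Fin d) (s : ℝ) (w : ℂ), ‖w‖ ≤ 1 →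
        ‖Polynomial.aeval ((s : ℂ) + w) (ρ j) - (((ρ j).eval s : ℝ) : ℂ)‖ ≤
          B * ‖w‖ * ((1 + X + |s|) ^ (m - 2) * (1 + |s|))) →
      ∀ x, ‖phaseMultiplier ρ f x‖ ≤
        C * M * Real.exp (X ^ μ⁻¹) * Real.exp (-(r * rootNorm ν x)) := by
  have hν0 : 0 < ν := by linarith
  have hpi : 0 < 2 * Real.pi := by positivity
  have hpi1 : 1 ≤ 2 * Real.pi := by linarith [Real.pi_gt_three]
  obtain ⟨h0, C0, hh0, hC0, H0⟩ := exists_le_exp_neg_rootNorm (d := d) hν0 hr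
  set k := h0 / 2 with hk
  have hk0 : 0 < k := by positivity
  obtain ⟨A, C1, hA, hC1, H1⟩ := exists_exp_pow_mul_le (B := B) hμ hν hk0 hm hνμ
  obtain ⟨h', C2, hh', hC2, H2⟩ :=
    exists_norm_D_iterate_fourier_le (d := d) (r := A + 1) hν hμ (by linarith) hk0
  have hinteg := integrable_exp_neg_rootNorm (E := Rd d) volume hμ one_pos
  simp only [one_mul] at hinteg
  set J := ∫ x : Rd d, Real.exp (-rootNorm μ x) with hJ
  have hJ0 : 0 ≤ J := integral_nonneg fun _ => (Real.exp_pos _).le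
  refine ⟨h', C0 * (C1 * C2 * (J + 1)), hh', by positivity, fun f M hM ρ X hX Hρ x => ?_⟩
  have hM0 := hM.nonneg
  set W := C1 * C2 * M * Real.exp (X ^ μ⁻¹) * J with hW
  have hW0 : 0 ≤ W := by positivity
  have key : ∀ i n, |x i| ^ n * ‖phaseMultiplier ρ f x‖ ≤
      W * (h0 ^ n * (n.factorial : ℝ) ^ ν) := fun i n => by
    rw [phaseMultiplier_eq]
    set G := phaseMul ρ (𝓕 f) with hG
    have hGf : (G : Rd d → ℂ) = phaseSymbol ρ * (𝓕 f : 𝓢(Rd d, ℂ)) := funext fun η => by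
      rw [hG, phaseMul_apply]; rfl
    have h1 : |x i| ^ n * ‖𝓕⁻ G x‖ ≤ ∫ η, ‖(schwartzD i)^[n] G η‖ := by
      refine le_trans ?_ (norm_fourierInv_le_integral _ x)
      rw [fourierInv_schwartzD_iterate, norm_mul, norm_pow, norm_real, Real.norm_eq_abs, abs_neg,
        abs_mul, abs_of_pos hpi]
      gcongr
      exact le_mul_of_one_le_left (abs_nonneg _) hpi1
    refine h1.trans ?_
    have h2 : ∀ η, ‖(schwartzD i)^[n] G η‖ ≤ C1 * C2 * M * Real.exp (X ^ μ⁻¹) *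
        (h0 ^ n * (n.factorial : ℝ) ^ ν) * Real.exp (-rootNorm μ η) := fun η => by
      rw [coe_schwartzD_iterate, hGf, D_iterate_mul i n (contDiff_phaseSymbol ρ)
        ((𝓕 f : 𝓢(Rd d, ℂ)).smooth ⊤)]
      have hterm : ∀ a ∈ Finset.range (n + 1), ‖(n.choose a : ℂ) *
          (D i)^[a] (phaseSymbol ρ) η * (D i)^[n - a] (𝓕 f : 𝓢(Rd d, ℂ)) η‖ ≤
          (n.choose a : ℝ) * (C1 * C2 * M * Real.exp (X ^ μ⁻¹) *
          (k ^ n * (n.factorial : ℝ) ^ ν) * Real.exp (-rootNorm μ η)) := by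
        intro a ha
        have han : a ≤ n := Nat.lt_succ_iff.1 (Finset.mem_range.1 ha)
        rw [norm_mul, norm_mul, Complex.norm_natCast, mul_assoc]
        refine mul_le_mul_of_nonneg_left ?_ (by positivity)
        have e1 : ‖(D i)^[a] (phaseSymbol ρ) η‖ ≤ C1 * (k ^ a * (a.factorial : ℝ) ^ ν) *
            Real.exp (X ^ μ⁻¹) * Real.exp (A * rootNorm μ η) := by
          rw [norm_D_iterate_phaseSymbol]
          refine (norm_iteratedDeriv_exp_polynomial_le (ρ i) hB (by positivity)
            (Hρ i (η i)) a).trans ((H1 X |η i| hX (abs_nonneg _) a).trans ?_)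
          gcongr
          exact Real.rpow_le_rpow (abs_nonneg _) (abs_apply_le_norm η i) (by positivity)
        have e2 := H2 f M hM i (n - a) η
        have e3 : (a.factorial : ℝ) ^ ν * ((n - a).factorial : ℝ) ^ ν ≤ (n.factorial : ℝ) ^ ν := by
          rw [← Real.mul_rpow (by positivity) (by positivity)]
          refine Real.rpow_le_rpow (by positivity) ?_ hν0.le
          exact_mod_cast Nat.le_of_dvd (Nat.factorial_pos n)
            (Nat.factorial_mul_factorial_dvd_factorial han)
        have e4 : Real.exp (A * rootNorm μ η) * Real.exp (-((A + 1) * rootNorm μ η)) =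
            Real.exp (-rootNorm μ η) := by rw [← Real.exp_add]; ring_nf
        have e5 : k ^ a * k ^ (n - a) = k ^ n := by rw [← pow_add, Nat.add_sub_cancel' han]
        calc ‖(D i)^[a] (phaseSymbol ρ) η‖ * ‖(D i)^[n - a] (𝓕 f : 𝓢(Rd d, ℂ)) η‖
            ≤ (C1 * (k ^ a * (a.factorial : ℝ) ^ ν) * Real.exp (X ^ μ⁻¹) *
              Real.exp (A * rootNorm μ η)) * (C2 * M * (k ^ (n - a) *
              ((n - a).factorial : ℝ) ^ ν) * Real.exp (-((A + 1) * rootNorm μ η))) :=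
              mul_le_mul e1 e2 (norm_nonneg _) (by positivity)
          _ = C1 * C2 * M * Real.exp (X ^ μ⁻¹) * ((k ^ a * k ^ (n - a)) *
              ((a.factorial : ℝ) ^ ν * ((n - a).factorial : ℝ) ^ ν)) *
              (Real.exp (A * rootNorm μ η) * Real.exp (-((A + 1) * rootNorm μ η))) := by ring
          _ ≤ _ := by rw [e4, e5]; gcongr
      refine (norm_sum_le _ _).trans ((Finset.sum_le_sum hterm).trans (le_of_eq ?_))
      rw [← Finset.sum_mul]
      have : (∑ a ∈ Finset.range (n + 1), (n.choose a : ℝ)) = 2 ^ n := by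
        exact_mod_cast Nat.sum_range_choose n
      rw [this, hk, div_pow]
      field_simp
    have h3 : W * (h0 ^ n * (n.factorial : ℝ) ^ ν) = ∫ η : Rd d, C1 * C2 * M * Real.exp (X ^ μ⁻¹) *
        (h0 ^ n * (n.factorial : ℝ) ^ ν) * Real.exp (-rootNorm μ η) := by
      rw [integral_const_mul, ← hJ, hW]; ring
    rw [h3]
    exact integral_mono_of_nonneg (Filter.Eventually.of_forall fun η => norm_nonneg ((schwartzD i)^[n] G η))
      (hinteg.const_mul _) (Filter.Eventually.of_forall h2)
  refine (H0 x ‖phaseMultiplier ρ f x‖ W (norm_nonneg _) (by simpa using key ⟨0, hd⟩ 0) key).trans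
    (mul_le_mul_of_nonneg_right ?_ (Real.exp_pos _).le)
  have h4 : C1 * C2 * M * Real.exp (X ^ μ⁻¹) * J ≤
      C1 * C2 * M * Real.exp (X ^ μ⁻¹) * (J + 1) := by gcongr; linarith
  refine (mul_le_mul_of_nonneg_left h4 hC0.le).trans_eq ?_
  ring

end GS

end

/-! ### Gelfand–Shilov norms of time-frequency shifts -/

noncomputable section

namespace GS

variable {d : ℕ}

/-- The derivatives of `f` are bounded by `M h^{|β|} β!^μ W(x)`. -/
def DerivBound (μ h : ℝ) (f : Rd d → ℂ) (M : ℝ) (W : Rd d → ℝ) : Prop :=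
  ∀ x β, ‖multiD β f x‖ ≤ M * (∏ j, h ^ β j * ((β j).factorial : ℝ) ^ μ) * W x

theorem prod_eq_pow_len_mul (s h : ℝ) (α : Fin d → ℕ) :
    ∏ j, h ^ α j * ((α j).factorial : ℝ) ^ s = h ^ len α * (fact α : ℝ) ^ s := by
  simp only [len, fact, Finset.prod_mul_distrib, Finset.prod_pow_eq_pow_sum]
  push_cast
  rw [← Real.finsetProd_rpow _ _ (fun _ _ => by positivity)]

theorem multiD_modulate_coord {f : Rd d → ℂ} (hf : ContDiff ℝ ∞ f) (j : Fin d) (c : ℝ)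
    (β : Fin d → ℕ) (y : Rd d) : multiD β (fun y => exp (I * ((y j * c : ℝ) : ℂ)) * f y) y =
      exp (I * ((y j * c : ℝ) : ℂ)) * ∑ k ∈ Finset.range (β j + 1),
        ((c : ℂ) ^ (β j - k) * ((β j).choose k : ℂ)) * multiD (Function.update β j k) f y := by
  let F : smooth d := ⟨f, hf⟩
  have h1 := endListD_apply (List.finRange d) β (endM j c F)
  have h2 := congrArg (fun T => (T F).1 y) (endListD_mul_endM (List.finRange d)
    (List.nodup_finRange d) β j c (List.mem_finRange j))
  have h3 : multiD β (fun y => exp (I * ((y j * c : ℝ) : ℂ)) * f y) y =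
    (endListD (List.finRange d) β (endM j c F)).1 y := by rw [h1]; rfl
  rw [h3]
  refine h2.trans ?_
  change exp (I * ((y j * c : ℝ) : ℂ)) * _ = _
  congr 1
  simp only [LinearMap.sum_apply, LinearMap.smul_apply, Submodule.coe_sum, Finset.sum_apply,
    Submodule.coe_smul, Pi.smul_apply, smul_eq_mul, endListD_apply]
  rfl

/-- By the Leibniz rule the powers of `c` fill the missing derivatives of order `n - k`;
superadditivity of factorials recombines the weights, and the doubled `h` pays for the binomial sum
`2^n`. -/
theorem DerivBound.modulate_coord {μ h A c M : ℝ} {W : Rd d → ℝ} (hμ : 0 < μ) (hh : 0 < h)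
    (hM : 0 ≤ M) (hW : ∀ x, 0 ≤ W x)
    (hA : ∀ n : ℕ, |c| ^ n ≤ h ^ n * (n.factorial : ℝ) ^ μ * A) {f : Rd d → ℂ}
    (hf : ContDiff ℝ ∞ f) (H : DerivBound μ h f M W) (j : Fin d) :
    DerivBound μ (2 * h) (fun y => exp (I * ((y j * c : ℝ) : ℂ)) * f y) (M * A) W := by
  intro y β
  rw [multiD_modulate_coord hf, norm_mul]
  have hexp : ‖exp (I * ((y j * c : ℝ) : ℂ))‖ = 1 := by
    rw [mul_comm]; exact norm_exp_ofReal_mul_I _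
  rw [hexp, one_mul]
  have hA0 : 0 ≤ A := by simpa using zero_le_one.trans (hA 0)
  set Q := ∏ i ∈ Finset.univ.erase j, h ^ β i * ((β i).factorial : ℝ) ^ μ with hQ
  have hQ0 : 0 ≤ Q := Finset.prod_nonneg fun i _ => by positivity
  have hw : ∀ k, (∏ i, h ^ Function.update β j k i *
      ((Function.update β j k i).factorial : ℝ) ^ μ) = (h ^ k * (k.factorial : ℝ) ^ μ) * Q :=
    fun k => by
      rw [← Finset.mul_prod_erase Finset.univ _ (Finset.mem_univ j), Function.update_self]
      congr 1
      refine Finset.prod_congr rfl fun i hi => ?_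
      rw [Function.update_of_ne (Finset.ne_of_mem_erase hi)]
  set n := β j with hn
  have hterm : ∀ k ∈ Finset.range (n + 1),
      ‖((c : ℂ) ^ (n - k) * (n.choose k : ℂ)) * multiD (Function.update β j k) f y‖
      ≤ (n.choose k : ℝ) * (M * A * ((h ^ n * (n.factorial : ℝ) ^ μ) * Q) * W y) := by
    intro k hk
    have hkn : k ≤ n := Nat.lt_succ_iff.1 (Finset.mem_range.1 hk)
    have h1 := H y (Function.update β j k)
    rw [hw] at h1
    have h3 : ((n - k).factorial : ℝ) ^ μ * (k.factorial : ℝ) ^ μ ≤ (n.factorial : ℝ) ^ μ := by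
      rw [← Real.mul_rpow (by positivity) (by positivity)]
      refine Real.rpow_le_rpow (by positivity) ?_ hμ.le
      have := Nat.le_of_dvd (Nat.factorial_pos n) (Nat.factorial_mul_factorial_dvd_factorial hkn)
      rw [mul_comm]
      exact_mod_cast this
    have h4 : h ^ (n - k) * h ^ k = h ^ n := by rw [← pow_add, Nat.sub_add_cancel hkn]
    have hWy := hW y
    simp only [norm_mul, norm_pow, Complex.norm_natCast, norm_real, Real.norm_eq_abs]
    calc |c| ^ (n - k) * (n.choose k : ℝ) * ‖multiD (Function.update β j k) f y‖
        ≤ (h ^ (n - k) * ((n - k).factorial : ℝ) ^ μ * A) * (n.choose k : ℝ) *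
            (M * ((h ^ k * (k.factorial : ℝ) ^ μ) * Q) * W y) := by
          gcongr
          exact hA (n - k)
      _ = (n.choose k : ℝ) * (M * A * (((h ^ (n - k) * h ^ k) *
            (((n - k).factorial : ℝ) ^ μ * (k.factorial : ℝ) ^ μ)) * Q) * W y) := by ring
      _ ≤ _ := by rw [h4]; gcongr
  refine (norm_sum_le _ _).trans ((Finset.sum_le_sum hterm).trans ?_)
  rw [← Finset.sum_mul]
  have : (∑ k ∈ Finset.range (n + 1), (n.choose k : ℝ)) = 2 ^ n := by
    exact_mod_cast Nat.sum_range_choose n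
  rw [this]
  have e2 : Q ≤ ∏ i ∈ Finset.univ.erase j, (2 * h) ^ β i * ((β i).factorial : ℝ) ^ μ :=
    Finset.prod_le_prod (fun i _ => by positivity) fun i _ => by gcongr; linarith
  rw [← Finset.mul_prod_erase Finset.univ
    (fun i => (2 * h) ^ β i * ((β i).factorial : ℝ) ^ μ) (Finset.mem_univ j), ← hn]
  have hWy := hW y
  calc (2 : ℝ) ^ n * (M * A * ((h ^ n * (n.factorial : ℝ) ^ μ) * Q) * W y)
      = M * A * (((2 * h) ^ n * (n.factorial : ℝ) ^ μ) * Q) * W y := by rw [mul_pow]; ring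
    _ ≤ _ := by gcongr

theorem modulate_smooth (ξ : Rd d) {f : Rd d → ℂ} (hf : ContDiff ℝ ∞ f) :
    ContDiff ℝ ∞ (modulate ξ f) := by
  have h1 : ContDiff ℝ ∞ fun y : Rd d => (inner ℝ y ξ : ℝ) :=
    contDiff_id.inner ℝ contDiff_const
  exact (contDiff_const.mul (ofRealCLM.contDiff.comp h1)).cexp.mul hf

theorem exists_derivBound_modulate {μ h : ℝ} (hμ : 0 < μ) (hh : 0 < h) :
    ∃ h' A : ℝ, 0 < h' ∧ 0 ≤ A ∧ ∀ (f : Rd d → ℂ) (M : ℝ) (W : Rd d → ℝ), ContDiff ℝ ∞ f →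
      0 ≤ M → (∀ x, 0 ≤ W x) → DerivBound μ h' f M W → ∀ ξ : Rd d,
      DerivBound μ h (modulate ξ f) (M * Real.exp (A * rootNorm μ ξ)) W := by
  -- Each of the `d` coordinate modulations doubles the parameter.
  set k : ℝ := h / 2 ^ d with hk
  have hk0 : 0 < k := by positivity
  obtain ⟨A, hA, HA⟩ := exists_pow_le_mul_exp hμ hk0
  refine ⟨k, d * A, hk0, by positivity, fun f M W hf hM hW H ξ => ?_⟩
  have hA' : ∀ (j : Fin d) (n : ℕ), |ξ j| ^ n ≤ k ^ n * (n.factorial : ℝ) ^ μ *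
      Real.exp (A * rootNorm μ ξ) := fun j n => by
    refine (HA _ (abs_nonneg _) n).trans ?_
    gcongr
    exact Real.rpow_le_rpow (abs_nonneg _) (abs_apply_le_norm ξ j) (by positivity)
  have key : ∀ s : Finset (Fin d),
      ContDiff ℝ ∞ (fun y : Rd d => exp (I * ((∑ j ∈ s, y j * ξ j : ℝ) : ℂ)) * f y) ∧
      DerivBound μ (2 ^ s.card * k) (fun y => exp (I * ((∑ j ∈ s, y j * ξ j : ℝ) : ℂ)) * f y)
        (M * Real.exp (A * rootNorm μ ξ) ^ s.card) W := fun s => by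
    induction s using Finset.induction_on with
    | empty => simpa using ⟨hf, H⟩
    | insert j s hj ih =>
      obtain ⟨ih1, ih2⟩ := ih
      have hks : k ≤ 2 ^ s.card * k := le_mul_of_one_le_left hk0.le (one_le_pow₀ (by norm_num))
      have e : (fun y : Rd d => exp (I * ((∑ i ∈ insert j s, y i * ξ i : ℝ) : ℂ)) * f y) =
          fun y => exp (I * ((y j * ξ j : ℝ) : ℂ)) *
            (exp (I * ((∑ i ∈ s, y i * ξ i : ℝ) : ℂ)) * f y) := by
        funext y
        rw [Finset.sum_insert hj, ← mul_assoc, ← exp_add]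
        push_cast
        ring_nf
      rw [e]
      refine ⟨(endM j (ξ j) ⟨_, ih1⟩).2, ?_⟩
      have := ih2.modulate_coord hμ (by positivity) (by positivity) hW
        (c := ξ j) (A := Real.exp (A * rootNorm μ ξ)) (fun n => (hA' j n).trans (by gcongr)) ih1 j
      rw [Finset.card_insert_of_notMem hj, pow_succ, pow_succ, ← mul_assoc, mul_comm _ (2 : ℝ),
        mul_assoc (2 : ℝ)]
      exact this
  have h1 := (key Finset.univ).2
  have e1 : (fun y : Rd d => exp (I * ((∑ j, y j * ξ j : ℝ) : ℂ)) * f y) = modulate ξ f := by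
    funext y
    unfold modulate
    congr 4
    simp [PiLp.inner_apply, mul_comm]
  rw [e1, Finset.card_univ, Fintype.card_fin, ← Real.exp_nat_mul, ← mul_assoc] at h1
  convert h1 using 1
  rw [hk]
  field_simp

theorem exists_abs_monomial_le {ν h : ℝ} (hν : 0 < ν) (hh : 0 < h) :
    ∃ A : ℝ, 0 ≤ A ∧ ∀ (x : Rd d) (α : Fin d → ℕ), |monomial α x| ≤
      (∏ j, h ^ α j * ((α j).factorial : ℝ) ^ ν) * Real.exp (A * rootNorm ν x) := by
  obtain ⟨A, hA, HA⟩ := exists_pow_le_mul_exp hν hh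
  refine ⟨d * A, by positivity, fun x α => ?_⟩
  have e : Real.exp (d * A * rootNorm ν x) = ∏ _j : Fin d, Real.exp (A * rootNorm ν x) := by
    rw [Finset.prod_const, Finset.card_univ, Fintype.card_fin, ← Real.exp_nat_mul, mul_assoc]
  rw [e, ← Finset.prod_mul_distrib, monomial, Finset.abs_prod]
  refine Finset.prod_le_prod (fun j _ => abs_nonneg _) fun j _ => ?_
  rw [abs_pow]
  refine (HA _ (abs_nonneg _) _).trans ?_
  gcongr
  exact Real.rpow_le_rpow (abs_nonneg _) (abs_apply_le_norm x j) (by positivity)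

/-- The time-frequency shift `M_η T_y ψ`, for `z = (y, η)`. -/
def tfShift (z : Rd d × Rd d) (ψ : Rd d → ℂ) : Rd d → ℂ := modulate z.2 (translate z.1 ψ)

theorem tfShift_apply (z : Rd d × Rd d) (ψ : Rd d → ℂ) (x : Rd d) :
    tfShift z ψ x = exp (I * ((inner ℝ x z.2 : ℝ) : ℂ)) * ψ (x - z.1) := rfl

theorem norm_tfShift (z : Rd d × Rd d) (ψ : Rd d → ℂ) (x : Rd d) :
    ‖tfShift z ψ x‖ = ‖ψ (x - z.1)‖ := by
  rw [tfShift_apply, norm_mul, mul_comm I, norm_exp_ofReal_mul_I, one_mul]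

theorem tfShift_smooth (z : Rd d × Rd d) {ψ : Rd d → ℂ} (hψ : ContDiff ℝ ∞ ψ) :
    ContDiff ℝ ∞ (tfShift z ψ) :=
  modulate_smooth _ (hψ.comp (contDiff_id.sub contDiff_const))

/-- Norms of time-frequency shifts grow at most exponentially in the gauge. The monomials cost
`exp(a‖x‖^{1/ν})`; decay of the window at rate `a T` around `y`, with `T` the quasi-triangle
constant, reduces this to `exp(aT‖y‖^{1/ν})`. The modulation costs an exponential of `‖η‖^{1/μ}`. -/
theorem exists_boundedBy_tfShift {ν μ h : ℝ} (hν : 0 < ν) (hμ : 0 < μ) (hh : 0 < h) :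
    ∃ h' C A : ℝ, 0 < h' ∧ 0 < C ∧ 0 ≤ A ∧ ∀ (ψ : Rd d → ℂ) (M : ℝ), ContDiff ℝ ∞ ψ →
      BoundedBy ν μ h' ψ M → ∀ z : Rd d × Rd d,
      BoundedBy ν μ h (tfShift z ψ) (C * M * Real.exp (A * anisoNorm ν μ z)) := by
  obtain ⟨a, ha, Ha⟩ := exists_abs_monomial_le (d := d) hν hh
  obtain ⟨k, b, hk, hb, Hb⟩ := exists_derivBound_modulate (d := d) hμ hh
  set T : ℝ := 2 ^ ν⁻¹ with hT
  have hT0 : 0 < T := by positivity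
  obtain ⟨h', C, hh', hC, H⟩ :=
    BoundedBy.exists_norm_multiD_le (d := d) μ (r := a * T) hν (by positivity) hk
  refine ⟨h', C, max (a * T) b, hh', hC, le_max_of_le_right hb, fun ψ M hψ hM z x α β => ?_⟩
  have hM0 := hM.nonneg
  have h1 : DerivBound μ k (translate z.1 ψ) (C * M)
      (fun x => Real.exp (-(a * T * rootNorm ν (x - z.1)))) := fun x β => by
    have e : multiD β (translate z.1 ψ) x = multiD β ψ (x - z.1) := by
      unfold multiD
      rw [listD_translate]
      rfl
    rw [e, prod_eq_pow_len_mul]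
    exact H ψ M hM (x - z.1) β
  have h2 := Hb _ _ _ (hψ.comp (contDiff_id.sub contDiff_const)) (by positivity)
    (fun x => (Real.exp_pos _).le) h1 z.2 x β
  have h3 := Ha x α
  rw [weight_eq]
  set P := ∏ j, h ^ α j * ((α j).factorial : ℝ) ^ ν
  set Q := ∏ j, h ^ β j * ((β j).factorial : ℝ) ^ μ
  have hP : 0 ≤ P := Finset.prod_nonneg fun j _ => by positivity
  have hQ : 0 ≤ Q := Finset.prod_nonneg fun j _ => by positivity
  have h4 : Real.exp (a * rootNorm ν x) * (Real.exp (b * rootNorm μ z.2) *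
      Real.exp (-(a * T * rootNorm ν (x - z.1)))) ≤
      Real.exp (max (a * T) b * anisoNorm ν μ z) := by
    rw [← Real.exp_add, ← Real.exp_add]
    refine Real.exp_le_exp.2 ?_
    have e1 := mul_le_mul_of_nonneg_left (rootNorm_le_sub_add hν x z.1) ha
    have e2 := mul_le_mul_of_nonneg_right (le_max_left (a * T) b) (rootNorm_nonneg ν z.1)
    have e3 := mul_le_mul_of_nonneg_right (le_max_right (a * T) b) (rootNorm_nonneg μ z.2)
    rw [anisoNorm, mul_add]
    rw [← hT] at e1
    linarith
  calc |monomial α x| * ‖multiD β (tfShift z ψ) x‖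
      ≤ (P * Real.exp (a * rootNorm ν x)) * (C * M * Real.exp (b * rootNorm μ z.2) * Q *
        Real.exp (-(a * T * rootNorm ν (x - z.1)))) :=
        mul_le_mul h3 h2 (norm_nonneg _) (by positivity)
    _ = C * M * (Real.exp (a * rootNorm ν x) * (Real.exp (b * rootNorm μ z.2) *
      Real.exp (-(a * T * rootNorm ν (x - z.1))))) * (P * Q) := by ring
    _ ≤ _ := by gcongr

end GS

end

/-! ### The short-time Fourier transform of Schwartz functions and its inversion -/

noncomputable section

namespace GS

variable {d : ℕ}

/-- The linear phase `⟨x, η⟩` as a family of polynomials. -/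
def linPhase (η : Rd d) (j : Fin d) : Polynomial ℝ := Polynomial.C (η j) * Polynomial.X

theorem phaseSymbol_linPhase (η x : Rd d) :
    phaseSymbol (linPhase η) x = exp (I * ((inner ℝ x η : ℝ) : ℂ)) := by
  unfold phaseSymbol linPhase
  congr 3
  simp [PiLp.inner_apply]

/-- The time-frequency shift of a Schwartz function. -/
def schwartzShift (z : Rd d × Rd d) (ψ : 𝓢(Rd d, ℂ)) : 𝓢(Rd d, ℂ) :=
  phaseMul (linPhase z.2) (SchwartzMap.compSubConstCLM ℂ z.1 ψ)

theorem coe_schwartzShift (z : Rd d × Rd d) (ψ : 𝓢(Rd d, ℂ)) :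
    (schwartzShift z ψ : Rd d → ℂ) = tfShift z ψ := by
  funext x
  rw [schwartzShift, phaseMul_apply, phaseSymbol_linPhase, SchwartzMap.compSubConstCLM_apply,
    tfShift_apply]

theorem fourier_apply_eq_integral (f : 𝓢(Rd d, ℂ)) (ξ : Rd d) :
    𝓕 f ξ = ∫ x, exp (I * ((-(2 * Real.pi * inner ℝ x ξ) : ℝ) : ℂ)) * f x := by
  rw [SchwartzMap.fourier_coe, Real.fourier_eq']
  refine integral_congr_ae (Filter.Eventually.of_forall fun x => ?_)
  simp only [smul_eq_mul]
  congr 2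
  push_cast
  ring

theorem fourierInv_apply_eq_integral (f : 𝓢(Rd d, ℂ)) (x : Rd d) :
    𝓕⁻ f x = ∫ ξ, exp (I * ((2 * Real.pi * inner ℝ x ξ : ℝ) : ℂ)) * f ξ := by
  rw [SchwartzMap.fourierInv_coe, Real.fourierInv_eq']
  refine integral_congr_ae (Filter.Eventually.of_forall fun ξ => ?_)
  simp only [smul_eq_mul]
  congr 2
  rw [real_inner_comm]
  push_cast
  ring

/-- The factor `(2π)⁻¹` translates angular frequency into the variable of `𝓕`, whose kernel is
`e^{-2πi⟨x,ξ⟩}`. -/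
theorem fourier_schwartzShift (z : Rd d × Rd d) (ψ : 𝓢(Rd d, ℂ)) (ξ : Rd d) :
    𝓕 (schwartzShift z ψ) ξ =
      exp (I * ((-(2 * Real.pi * inner ℝ z.1 (ξ - (2 * Real.pi)⁻¹ • z.2)) : ℝ) : ℂ)) *
        𝓕 ψ (ξ - (2 * Real.pi)⁻¹ • z.2) := by
  rw [fourier_apply_eq_integral, fourier_apply_eq_integral, ← integral_const_mul,
    ← integral_add_right_eq_self _ z.1]
  refine integral_congr_ae (Filter.Eventually.of_forall fun x => ?_)
  simp only [coe_schwartzShift, tfShift_apply, add_sub_cancel_right]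
  rw [← mul_assoc, ← mul_assoc, ← exp_add, ← exp_add]
  congr 2
  rw [← mul_add, ← mul_add, ← ofReal_add, ← ofReal_add]
  congr 2
  simp only [inner_add_left, inner_sub_right, inner_smul_right]
  field_simp
  ring

theorem norm_fourier_schwartzShift (z : Rd d × Rd d) (ψ : 𝓢(Rd d, ℂ)) (ξ : Rd d) :
    ‖𝓕 (schwartzShift z ψ) ξ‖ = ‖𝓕 ψ (ξ - (2 * Real.pi)⁻¹ • z.2)‖ := by
  rw [fourier_schwartzShift, norm_mul, mul_comm I, norm_exp_ofReal_mul_I, one_mul]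

theorem integral_mul_conj_fourier (f g : 𝓢(Rd d, ℂ)) :
    ∫ ξ, 𝓕 f ξ * conj (𝓕 g ξ) = ∫ x, f x * conj (g x) := by
  simpa [RCLike.inner_apply] using SchwartzMap.integral_inner_fourier_fourier g f

/-- The unnormalized short-time Fourier transform `∫ g conj(M_η T_y ψ)` of a function. -/
def funSTFT (ψ g : Rd d → ℂ) (z : Rd d × Rd d) : ℂ := ∫ x, g x * conj (tfShift z ψ x)

theorem continuous_tfShift {ψ : Rd d → ℂ} (hψ : Continuous ψ) :
    Continuous fun p : (Rd d × Rd d) × Rd d => tfShift p.1 ψ p.2 := by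
  simp only [tfShift_apply]
  have h1 : Continuous fun p : (Rd d × Rd d) × Rd d => (inner ℝ p.2 p.1.2 : ℝ) := by fun_prop
  fun_prop

theorem continuous_tfShift_left {ψ : Rd d → ℂ} (hψ : Continuous ψ) (x : Rd d) :
    Continuous fun z : Rd d × Rd d => tfShift z ψ x := by
  simp only [tfShift_apply]
  have h1 : Continuous fun z : Rd d × Rd d => (inner ℝ x z.2 : ℝ) := by fun_prop
  fun_prop

theorem continuous_tfShift_right {ψ : Rd d → ℂ} (hψ : Continuous ψ) (z : Rd d × Rd d) :
    Continuous (tfShift z ψ) := by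
  unfold tfShift modulate translate
  have h1 : Continuous fun x : Rd d => (inner ℝ x z.2 : ℝ) := by fun_prop
  fun_prop

theorem continuous_funSTFT (ψ g : 𝓢(Rd d, ℂ)) : Continuous (funSTFT ψ g) := by
  set S := SchwartzMap.seminorm ℂ 0 0 ψ with hS
  refine continuous_of_dominated (bound := fun x => ‖g x‖ * S) (fun z => ?_) (fun z => ?_)
    (g.integrable.norm.mul_const _) (Filter.Eventually.of_forall fun x => ?_)
  · exact (g.continuous.mul (continuous_conj.comp
      (continuous_tfShift_right ψ.continuous z))).aestronglyMeasurable
  · refine Filter.Eventually.of_forall fun x => ?_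
    rw [norm_mul, RCLike.norm_conj, norm_tfShift]
    exact mul_le_mul_of_nonneg_left (SchwartzMap.norm_le_seminorm ℂ ψ _) (norm_nonneg _)
  · exact continuous_const.mul (continuous_conj.comp (continuous_tfShift_left ψ.continuous x))

theorem funSTFT_eq_fourier (ψ g : 𝓢(Rd d, ℂ)) (z : Rd d × Rd d) :
    funSTFT ψ g z = ∫ ξ, 𝓕 g ξ * conj (𝓕 (schwartzShift z ψ) ξ) := by
  rw [integral_mul_conj_fourier, funSTFT, coe_schwartzShift]

/-- Complex conjugation of a Schwartz function. -/
def schwartzConj (f : 𝓢(Rd d, ℂ)) : 𝓢(Rd d, ℂ) :=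
  SchwartzMap.postcompCLM (𝕜 := ℝ) (conjCLE : ℂ →L[ℝ] ℂ) f

theorem schwartzConj_apply (f : 𝓢(Rd d, ℂ)) (x : Rd d) : schwartzConj f x = conj (f x) := by
  simp [schwartzConj]

/-- The inner integral in the inversion formula for the short-time Fourier transform. -/
theorem integral_funSTFT_mul_tfShift (ψ g : 𝓢(Rd d, ℂ)) (x y : Rd d) :
    ∫ η, funSTFT ψ g (y, η) * tfShift (y, η) ψ x =
      ((2 * Real.pi) ^ d : ℝ) * (g x * (conj (ψ (x - y)) * ψ (x - y))) := by
  -- For fixed `y` the transform in `η` is the Fourier transform of `g` times the conjugate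
  -- translated window, so the integral is Fourier inversion; rescaling `η` by `2π` produces
  -- `(2π)^d`.
  set G : 𝓢(Rd d, ℂ) := SchwartzMap.pairing (ContinuousLinearMap.mul ℂ ℂ) g
    (schwartzConj (SchwartzMap.compSubConstCLM ℂ y ψ)) with hG
  have hGx : ∀ x, G x = g x * conj (ψ (x - y)) := fun x => by
    rw [hG, SchwartzMap.pairing_apply_apply, schwartzConj_apply,
      SchwartzMap.compSubConstCLM_apply]
    rfl
  let F : Rd d → ℂ := fun ξ => exp (I * ((2 * Real.pi * inner ℝ x ξ : ℝ) : ℂ)) * 𝓕 G ξ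
  have h1 : ∀ η, funSTFT ψ g (y, η) * tfShift (y, η) ψ x = F ((2 * Real.pi)⁻¹ • η) * ψ (x - y) := fun η => by
    have e : funSTFT ψ g (y, η) = 𝓕 G ((2 * Real.pi)⁻¹ • η) := by
      rw [fourier_apply_eq_integral, funSTFT]
      refine integral_congr_ae (Filter.Eventually.of_forall fun w => ?_)
      simp only [hGx, tfShift_apply, map_mul, ← exp_conj, conj_I, conj_ofReal, inner_smul_right]
      rw [mul_inv_cancel_left₀ (by positivity)]
      push_cast
      ring_nf
    simp only [F, e, tfShift_apply, inner_smul_right]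
    rw [mul_inv_cancel_left₀ (by positivity)]
    ring
  have h2 : ∫ ξ, F ξ = 𝓕⁻ (𝓕 G) x := (fourierInv_apply_eq_integral _ _).symm
  simp_rw [h1]
  rw [integral_mul_const, Measure.integral_comp_smul, h2, FourierTransform.fourierInv_fourier_eq, hGx]
  simp only [finrank_euclideanSpace, Fintype.card_fin, inv_pow, inv_inv]
  rw [abs_of_pos (by positivity), real_smul]
  ring

/-- The squared `L²` norm of the window, in the form in which it enters the inversion formula. -/
def windowMass (ψ : Rd d → ℂ) : ℂ := ∫ x, conj (ψ x) * ψ x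

theorem windowMass_ne_zero (ψ : 𝓢(Rd d, ℂ)) (hψ : ψ ≠ 0) : windowMass ψ ≠ 0 := by
  have h1 : windowMass ψ = ((∫ x, ‖ψ x‖ ^ 2 : ℝ) : ℂ) := by
    rw [windowMass, ← integral_complex_ofReal]
    refine integral_congr_ae (Filter.Eventually.of_forall fun x => ?_)
    simp only [conj_mul']
    push_cast
    rfl
  rw [h1, Ne, ofReal_eq_zero]
  have hinteg : Integrable (fun x => ‖ψ x‖ ^ 2) := by
    have := (ψ.memLp 2 volume).integrable_norm_pow (by norm_num)
    simpa using this
  have hc : Continuous fun x => ‖ψ x‖ ^ 2 := by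
    have := ψ.continuous
    fun_prop
  intro h0
  rw [integral_eq_zero_iff_of_nonneg (fun x => by positivity) hinteg] at h0
  have h2 := hc.ae_eq_iff_eq volume continuous_const |>.1 h0
  refine hψ (SchwartzMap.ext fun x => ?_)
  exact norm_eq_zero.1 ((pow_eq_zero_iff two_ne_zero).1 (congrFun h2 x))

/-- The inversion formula for the short-time Fourier transform of Schwartz functions. -/
theorem integral_funSTFT_mul_tfShift_prod (ψ g : 𝓢(Rd d, ℂ)) (hV : Integrable (funSTFT ψ g))
    (x : Rd d) : ∫ z, funSTFT ψ g z * tfShift z ψ x =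
      ((2 * Real.pi) ^ d : ℝ) * windowMass ψ * g x := by
  set S := SchwartzMap.seminorm ℂ 0 0 ψ with hS
  have hinteg : Integrable (fun z => funSTFT ψ g z * tfShift z ψ x) := by
    refine hV.mul_bdd (c := S) ?_ (Filter.Eventually.of_forall fun z => ?_)
    · exact (continuous_tfShift_left ψ.continuous x).aestronglyMeasurable
    · rw [norm_tfShift]
      exact SchwartzMap.norm_le_seminorm ℂ ψ _
  rw [Measure.volume_eq_prod] at hinteg ⊢
  rw [integral_prod _ hinteg]
  simp only [integral_funSTFT_mul_tfShift]
  rw [integral_const_mul, integral_const_mul,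
    integral_sub_left_eq_self (fun y => conj (ψ y) * ψ y) volume x]
  rw [windowMass]
  ring

end GS

end

/-! ### Gelfand–Shilov norms and decay of the short-time Fourier transform -/

noncomputable section

namespace GS

variable {d : ℕ}

theorem BoundedBy.exists_norm_le (μ : ℝ) {ν r : ℝ} (hν : 0 < ν) (hr : 0 ≤ r) :
    ∃ h C : ℝ, 0 < h ∧ 0 < C ∧ ∀ (f : Rd d → ℂ) (M : ℝ), BoundedBy ν μ h f M →
      ∀ x, ‖f x‖ ≤ C * M * Real.exp (-(r * rootNorm ν x)) := by
  obtain ⟨h, C, hh, hC, H⟩ := BoundedBy.exists_norm_multiD_le (d := d) μ hν hr one_pos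
  refine ⟨h, C, hh, hC, fun f M hM x => ?_⟩
  simpa [multiD_zero, len, fact] using H f M hM x 0

theorem BoundedBy.exists_norm_fourier_le (hd : 0 < d) {ν μ r : ℝ} (hν : 1 < ν) (hμ : 0 < μ)
    (hr : 0 ≤ r) : ∃ h C : ℝ, 0 < h ∧ 0 < C ∧ ∀ (f : 𝓢(Rd d, ℂ)) (M : ℝ), BoundedBy ν μ h f M →
      ∀ ξ, ‖𝓕 f ξ‖ ≤ C * M * Real.exp (-(r * rootNorm μ ξ)) := by
  obtain ⟨h, C, hh, hC, H⟩ := exists_norm_D_iterate_fourier_le (d := d) hν hμ hr one_pos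
  refine ⟨h, C, hh, hC, fun f M hM x => ?_⟩
  simpa using H f M hM ⟨0, hd⟩ 0 x

/-- A convolution of two decaying functions decays: the quasi-triangle inequality, with constant
`2^{1/s}`, gives decay in `y`, and the extra rate `1` in the second factor leaves an integrable
function. -/
theorem norm_integral_le_exp_neg_rootNorm {s R M N : ℝ} (hs : 0 < s) (hR : 0 ≤ R) (hM : 0 ≤ M)
    (hN : 0 ≤ N) (F : Rd d → ℂ) (y : Rd d)
    (hF : ∀ x, ‖F x‖ ≤ (M * Real.exp (-(R * 2 ^ s⁻¹ * rootNorm s x))) *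
      (N * Real.exp (-((R * 2 ^ s⁻¹ + 1) * rootNorm s (x - y))))) :
    ‖∫ x, F x‖ ≤ N * (∫ x : Rd d, Real.exp (-rootNorm s x)) * M *
      Real.exp (-(R * rootNorm s y)) := by
  have hinteg := integrable_exp_neg_rootNorm (E := Rd d) volume hs one_pos
  simp only [one_mul] at hinteg
  have h1 : ∀ x, ‖F x‖ ≤ N * M * Real.exp (-(R * rootNorm s y)) *
      Real.exp (-rootNorm s (x - y)) := fun x => by
    refine (hF x).trans ?_
    have e : R * rootNorm s y ≤ R * (2 ^ s⁻¹ * (rootNorm s (x - y) + rootNorm s x)) := by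
      gcongr
      rw [rootNorm_sub_comm]
      exact rootNorm_le_sub_add hs y x
    calc M * Real.exp (-(R * 2 ^ s⁻¹ * rootNorm s x)) *
          (N * Real.exp (-((R * 2 ^ s⁻¹ + 1) * rootNorm s (x - y))))
        = N * M * Real.exp (-(R * 2 ^ s⁻¹ * rootNorm s x) +
          -((R * 2 ^ s⁻¹ + 1) * rootNorm s (x - y))) := by rw [Real.exp_add]; ring
      _ ≤ N * M * Real.exp (-(R * rootNorm s y) + -rootNorm s (x - y)) := by
          refine mul_le_mul_of_nonneg_left (Real.exp_le_exp.2 ?_) (by positivity)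
          linarith
      _ = _ := by rw [Real.exp_add]; ring
  refine (norm_integral_le_of_norm_le ((hinteg.comp_sub_right y).const_mul _)
    (Filter.Eventually.of_forall h1)).trans_eq ?_
  rw [integral_const_mul, integral_sub_right_eq_self (fun x => Real.exp (-rootNorm s x))]
  ring

/-- Decay in `y` comes from the size of `g`, decay in `η` from the size of `𝓕g`. No derivatives of
`g` occur, which suits Fourier multipliers with unimodular symbol, since these preserve `|𝓕g|`. -/
theorem exists_norm_funSTFT_le (hd : 0 < d) {ν μ r : ℝ} (hν : 1 < ν) (hμ : 0 < μ) (hr : 0 ≤ r)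
    (ψ : 𝓢(Rd d, ℂ)) (hψ : Mem ν μ ψ) : ∃ r' C : ℝ, 0 ≤ r' ∧ 0 < C ∧
      ∀ (g : 𝓢(Rd d, ℂ)) (M : ℝ), 0 ≤ M → (∀ x, ‖g x‖ ≤ M * Real.exp (-(r' * rootNorm ν x))) →
      (∀ ξ, ‖𝓕 g ξ‖ ≤ M * Real.exp (-(r' * rootNorm μ ξ))) →
      ∀ z, ‖funSTFT ψ g z‖ ≤ C * M * Real.exp (-(r * anisoNorm ν μ z)) := by
  have hν0 : 0 < ν := by linarith
  set c : ℝ := |(2 * Real.pi)⁻¹| ^ μ⁻¹ with hc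
  have hpi : (0 : ℝ) < |(2 * Real.pi)⁻¹| := abs_pos.2 (by positivity)
  have hc0 : 0 < c := by positivity
  set R1 := 2 * r with hR1
  -- The rates are doubled because the larger of the two gauges is at least half of their sum; `c`
  -- corrects for the frequency scaling by `(2π)⁻¹`.
  set R2 := 2 * r / c with hR2
  have hR10 : 0 ≤ R1 := by positivity
  have hR20 : 0 ≤ R2 := by positivity
  obtain ⟨h1, C1, hh1, hC1, H1⟩ :=
    BoundedBy.exists_norm_le (d := d) μ (r := R1 * 2 ^ ν⁻¹ + 1) hν0 (by positivity)
  obtain ⟨h2, C2, hh2, hC2, H2⟩ :=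
    BoundedBy.exists_norm_fourier_le hd (r := R2 * 2 ^ μ⁻¹ + 1) hν hμ (by positivity)
  obtain ⟨M1, hM1⟩ := hψ.exists_boundedBy hh1
  obtain ⟨M2, hM2⟩ := hψ.exists_boundedBy hh2
  have hM10 := hM1.nonneg
  have hM20 := hM2.nonneg
  set J1 := ∫ x : Rd d, Real.exp (-rootNorm ν x)
  set J2 := ∫ x : Rd d, Real.exp (-rootNorm μ x)
  have hJ1 : 0 ≤ J1 := integral_nonneg fun _ => (Real.exp_pos _).le
  have hJ2 : 0 ≤ J2 := integral_nonneg fun _ => (Real.exp_pos _).le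
  refine ⟨max (R1 * 2 ^ ν⁻¹) (R2 * 2 ^ μ⁻¹), C1 * M1 * J1 + C2 * M2 * J2 + 1,
    le_max_of_le_left (by positivity), by positivity, fun g M hM hg hg' z => ?_⟩
  have b1 : ‖funSTFT ψ g z‖ ≤ C1 * M1 * J1 * M * Real.exp (-(R1 * rootNorm ν z.1)) := by
    refine norm_integral_le_exp_neg_rootNorm hν0 hR10 hM (by positivity) _ z.1 fun x => ?_
    rw [norm_mul, RCLike.norm_conj, norm_tfShift]
    refine mul_le_mul ((hg x).trans ?_) (H1 ψ M1 hM1 _) (norm_nonneg _) (by positivity)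
    gcongr
    · exact rootNorm_nonneg _ _
    · exact le_max_left _ _
  have b2 : ‖funSTFT ψ g z‖ ≤ C2 * M2 * J2 * M * Real.exp (-(2 * r * rootNorm μ z.2)) := by
    have e : R2 * rootNorm μ ((2 * Real.pi)⁻¹ • z.2) = 2 * r * rootNorm μ z.2 := by
      rw [rootNorm_smul, hR2, ← hc]
      field_simp
    rw [← e, funSTFT_eq_fourier]
    refine norm_integral_le_exp_neg_rootNorm hμ hR20 hM (by positivity) _ _ fun x => ?_
    rw [norm_mul, RCLike.norm_conj, norm_fourier_schwartzShift]
    refine mul_le_mul ((hg' x).trans ?_) (H2 ψ M2 hM2 _) (norm_nonneg _) (by positivity)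
    gcongr
    · exact rootNorm_nonneg _ _
    · exact le_max_right _ _
  set X := C1 * M1 * J1 + C2 * M2 * J2 + 1 with hX
  rcases le_total (rootNorm μ z.2) (rootNorm ν z.1) with h | h
  · refine b1.trans ?_
    refine mul_le_mul (mul_le_mul_of_nonneg_right ?_ hM) (Real.exp_le_exp.2 ?_)
      (Real.exp_pos _).le (by positivity)
    · have : 0 ≤ C2 * M2 * J2 := by positivity
      linarith
    · rw [anisoNorm, hR1]
      nlinarith
  · refine b2.trans ?_
    refine mul_le_mul (mul_le_mul_of_nonneg_right ?_ hM) (Real.exp_le_exp.2 ?_)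
      (Real.exp_pos _).le (by positivity)
    · have : 0 ≤ C1 * M1 * J1 := by positivity
      linarith
    · rw [anisoNorm]
      nlinarith

theorem contDiff_tfShift {ψ : Rd d → ℂ} (hψ : ContDiff ℝ ∞ ψ) :
    ContDiff ℝ ∞ fun p : (Rd d × Rd d) × Rd d => tfShift p.1 ψ p.2 := by
  simp only [tfShift_apply]
  have h1 : ContDiff ℝ ∞ fun p : (Rd d × Rd d) × Rd d => (inner ℝ p.2 p.1.2 : ℝ) :=
    contDiff_snd.inner ℝ (contDiff_snd.comp contDiff_fst)
  have h2 : ContDiff ℝ ∞ fun p : (Rd d × Rd d) × Rd d => p.2 - p.1.1 :=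
    contDiff_snd.sub (contDiff_fst.comp contDiff_fst)
  exact (contDiff_const.mul (ofRealCLM.contDiff.comp h1)).cexp.mul (hψ.comp h2)

theorem contDiff_D_uncurry (j : Fin d) {K : Rd d × Rd d → Rd d → ℂ}
    (hK : ContDiff ℝ ∞ fun p : (Rd d × Rd d) × Rd d => K p.1 p.2) :
    ContDiff ℝ ∞ fun p : (Rd d × Rd d) × Rd d => D j (K p.1) p.2 := by
  have h1 : ∀ p : (Rd d × Rd d) × Rd d, D j (K p.1) p.2 =
      -I * fderiv ℝ (fun p : (Rd d × Rd d) × Rd d => K p.1 p.2) p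
        (0, EuclideanSpace.single j 1) := fun p => by
    have h2 := ((hK.differentiable (by simp)) p).hasFDerivAt
    have h3 : HasFDerivAt (fun x : Rd d => (p.1, x)) (ContinuousLinearMap.inr ℝ _ _) p.2 :=
      hasFDerivAt_prodMk_right p.1 p.2
    have h4 := HasFDerivAt.comp (g := fun p : (Rd d × Rd d) × Rd d => K p.1 p.2)
      (f := fun x : Rd d => (p.1, x)) p.2 h2 h3
    have h5 : ((fun p : (Rd d × Rd d) × Rd d => K p.1 p.2) ∘ fun x : Rd d => (p.1, x)) = K p.1 :=
      rfl
    rw [h5] at h4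
    rw [D, h4.fderiv]
    simp
  simp only [h1]
  have : ContDiff ℝ ∞ (fderiv ℝ fun p : (Rd d × Rd d) × Rd d => K p.1 p.2) :=
    hK.fderiv_right (by simp)
  exact contDiff_const.mul (this.clm_apply contDiff_const)

theorem exists_eq_add_single {β : Fin d → ℕ} {n : ℕ} (hβ : len β = n + 1) :
    ∃ (γ : Fin d → ℕ) (j : Fin d), len γ = n ∧ β = γ + Pi.single j 1 := by
  have : ∃ j, β j ≠ 0 := by
    by_contra h
    push Not at h
    simp [len, h] at hβ
  obtain ⟨j, hj⟩ := this
  have e : β = (β - Pi.single j 1) + Pi.single j 1 := by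
    funext i
    by_cases hi : i = j
    · subst hi
      simp
      omega
    · simp [hi]
  refine ⟨β - Pi.single j 1, j, ?_, e⟩
  rw [e, len_add, len_single] at hβ
  omega

/-- Joint smoothness supplies the continuity in `z`, hence the measurability, that differentiation
under the integral needs. -/
theorem contDiff_multiD_tfShift {ψ : Rd d → ℂ} (hψ : ContDiff ℝ ∞ ψ) (β : Fin d → ℕ) :
    ContDiff ℝ ∞ fun p : (Rd d × Rd d) × Rd d => multiD β (tfShift p.1 ψ) p.2 := by
  generalize hn : len β = n
  induction n generalizing β with
  | zero =>
    have : β = 0 := by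
      funext i
      simpa using (Finset.sum_eq_zero_iff.1 hn) i (Finset.mem_univ i)
    subst this
    simpa only [multiD_zero] using contDiff_tfShift hψ
  | succ n ih =>
    obtain ⟨γ, j, hγ, rfl⟩ := exists_eq_add_single hn
    have h1 := contDiff_D_uncurry j (K := fun z => multiD γ (tfShift z ψ)) (ih γ hγ)
    simpa only [D_multiD j γ (tfShift_smooth _ hψ)] using h1

theorem continuous_multiD_tfShift {ψ : Rd d → ℂ} (hψ : ContDiff ℝ ∞ ψ) (β : Fin d → ℕ) (x : Rd d) :
    Continuous fun z : Rd d × Rd d => multiD β (tfShift z ψ) x :=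
  Continuous.comp (g := fun p : (Rd d × Rd d) × Rd d => multiD β (tfShift p.1 ψ) p.2)
    (f := fun z : Rd d × Rd d => (z, x)) (contDiff_multiD_tfShift hψ β).continuous
    (Continuous.prodMk_left x)

theorem hasDerivAt_line (j : Fin d) {f : Rd d → ℂ} (hf : ContDiff ℝ ∞ f) (x : Rd d) (s : ℝ) :
    HasDerivAt (fun s : ℝ => f (x + s • EuclideanSpace.single j 1))
      (I * D j f (x + s • EuclideanSpace.single j 1)) s := by
  have h2 := ((hf.differentiable (by simp)) (x + s • EuclideanSpace.single j 1)).hasFDerivAt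
  have h3 : HasDerivAt (fun s : ℝ => x + s • EuclideanSpace.single j (1 : ℝ))
      (EuclideanSpace.single j (1 : ℝ)) s := by
    simpa using ((hasDerivAt_id s).smul_const (EuclideanSpace.single j (1 : ℝ))).const_add x
  have e : I * D j f (x + s • EuclideanSpace.single j 1) =
      fderiv ℝ f (x + s • EuclideanSpace.single j 1) (EuclideanSpace.single j 1) := by
    rw [D, ← mul_assoc]
    simp
  rw [e]
  exact h2.comp_hasDerivAt s h3

/-- The inversion formula differentiated under the integral sign, one direction at a time. The
exponentially weighted integrability dominates every derivative of the shifted window. -/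
theorem multiD_eq_integral {ν μ h C A : ℝ}
    (ψ g : 𝓢(Rd d, ℂ)) (hb : ∀ z, BoundedBy ν μ h (tfShift z ψ)
      (C * Real.exp (A * anisoNorm ν μ z)))
    (hV : Integrable (funSTFT ψ g))
    (hI : Integrable fun z => ‖funSTFT ψ g z‖ * Real.exp (A * anisoNorm ν μ z))
    (β : Fin d → ℕ) (x : Rd d) :
    ((2 * Real.pi) ^ d : ℝ) * windowMass ψ * multiD β g x =
      ∫ z, funSTFT ψ g z * multiD β (tfShift z ψ) x := by
  have hψs : ContDiff ℝ ∞ ψ := ψ.smooth ⊤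
  have hgs : ContDiff ℝ ∞ g := g.smooth ⊤
  have hnorm : ∀ β z x, ‖multiD β (tfShift z ψ) x‖ ≤
      C * Real.exp (A * anisoNorm ν μ z) * weight ν μ h 0 β := fun β z x => by
    simpa [monomial] using hb z x 0 β
  have hVc := continuous_funSTFT ψ g
  have hmeas : ∀ β x, AEStronglyMeasurable (fun z => funSTFT ψ g z * multiD β (tfShift z ψ) x) :=
    fun β x => (hVc.mul (continuous_multiD_tfShift hψs β x)).aestronglyMeasurable
  have hdom : ∀ β x z, ‖funSTFT ψ g z * multiD β (tfShift z ψ) x‖ ≤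
      ‖funSTFT ψ g z‖ * Real.exp (A * anisoNorm ν μ z) * (C * weight ν μ h 0 β) := fun β x z => by
    rw [norm_mul]
    refine (mul_le_mul_of_nonneg_left (hnorm β z x) (norm_nonneg _)).trans_eq ?_
    ring
  generalize hn : len β = n
  induction n generalizing β x with
  | zero =>
    have : β = 0 := by
      funext i
      simpa using (Finset.sum_eq_zero_iff.1 hn) i (Finset.mem_univ i)
    subst this
    simp only [multiD_zero]
    exact (integral_funSTFT_mul_tfShift_prod ψ g hV x).symm
  | succ n ih =>
    obtain ⟨γ, j, hγ, rfl⟩ := exists_eq_add_single hn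
    have h1 : HasDerivAt (fun s : ℝ => ((2 * Real.pi) ^ d : ℝ) * windowMass ψ *
        multiD γ g (x + s • EuclideanSpace.single j 1))
        (((2 * Real.pi) ^ d : ℝ) * windowMass ψ * (I * D j (multiD γ g)
          (x + (0 : ℝ) • EuclideanSpace.single j 1))) 0 :=
      (hasDerivAt_line j (multiD_smooth γ hgs) x 0).const_mul _
    have h2 := (hasDerivAt_integral_of_dominated_loc_of_deriv_le (μ := volume)
      (F := fun (s : ℝ) z => funSTFT ψ g z *
        multiD γ (tfShift z ψ) (x + s • EuclideanSpace.single j 1))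
      (F' := fun (s : ℝ) z => funSTFT ψ g z *
        (I * D j (multiD γ (tfShift z ψ)) (x + s • EuclideanSpace.single j 1)))
      (bound := fun z => ‖funSTFT ψ g z‖ * Real.exp (A * anisoNorm ν μ z) *
        (C * weight ν μ h 0 (γ + Pi.single j 1)))
      (x₀ := 0) (s := Set.univ) Filter.univ_mem
      (Filter.Eventually.of_forall fun s => hmeas γ _)
      ((hI.mul_const (C * weight ν μ h 0 γ)).mono' (hmeas γ _)
        (Filter.Eventually.of_forall (hdom γ _)))
      (by
        have := (hmeas (γ + Pi.single j 1) (x + (0 : ℝ) • EuclideanSpace.single j 1)).const_mul I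
        refine this.congr (Filter.Eventually.of_forall fun z => ?_)
        simp only [D_multiD j γ (tfShift_smooth _ hψs)]
        ring)
      (Filter.Eventually.of_forall fun z s _ => by
        have := hdom (γ + Pi.single j 1) (x + s • EuclideanSpace.single j 1) z
        rw [D_multiD j γ (tfShift_smooth _ hψs)]
        simpa using this)
      (hI.mul_const _)
      (Filter.Eventually.of_forall fun z s _ =>
        (hasDerivAt_line j (multiD_smooth γ (tfShift_smooth z hψs)) x s).const_mul _)).2
    -- The induction hypothesis holds at every point of the line, so the two sides have the same
    -- derivative there.
    have h3 : (fun s : ℝ => ((2 * Real.pi) ^ d : ℝ) * windowMass ψ *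
        multiD γ g (x + s • EuclideanSpace.single j 1)) = fun s : ℝ => ∫ z, funSTFT ψ g z *
        multiD γ (tfShift z ψ) (x + s • EuclideanSpace.single j 1) :=
      funext fun s => ih γ _ hγ
    rw [h3] at h1
    have h4 := h1.unique h2
    simp only [zero_smul, add_zero, D_multiD j γ hgs, D_multiD j γ (tfShift_smooth _ hψs)] at h4
    have h5 : ∫ z, funSTFT ψ g z * (I * multiD (γ + Pi.single j 1) (tfShift z ψ) x) =
        I * ∫ z, funSTFT ψ g z * multiD (γ + Pi.single j 1) (tfShift z ψ) x := by
      rw [← integral_const_mul]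
      congr 1
      funext z
      ring
    rw [h5] at h4
    refine mul_left_cancel₀ I_ne_zero (Eq.trans ?_ h4)
    ring

/-- The Gelfand–Shilov norms are controlled by weighted integrals of the short-time Fourier
transform. -/
theorem boundedBy_of_funSTFT {ν μ h C A : ℝ}
    (ψ g : 𝓢(Rd d, ℂ)) (hψ : ψ ≠ 0) (hb : ∀ z, BoundedBy ν μ h (tfShift z ψ)
      (C * Real.exp (A * anisoNorm ν μ z)))
    (hV : Integrable (funSTFT ψ g))
    (hI : Integrable fun z => ‖funSTFT ψ g z‖ * Real.exp (A * anisoNorm ν μ z)) :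
    BoundedBy ν μ h g (‖((2 * Real.pi) ^ d : ℝ) * windowMass ψ‖⁻¹ * C *
      ∫ z, ‖funSTFT ψ g z‖ * Real.exp (A * anisoNorm ν μ z)) := by
  intro x α β
  set c : ℂ := ((2 * Real.pi) ^ d : ℝ) * windowMass ψ with hc
  have hc0 : 0 < ‖c‖ := norm_pos_iff.2 (mul_ne_zero (by
    rw [ofReal_ne_zero]; positivity) (windowMass_ne_zero ψ hψ))
  have h1 := multiD_eq_integral ψ g hb hV hI β x
  rw [← hc] at h1
  have h2 : |monomial α x| * ‖c * multiD β g x‖ ≤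
      ∫ z, ‖funSTFT ψ g z‖ * Real.exp (A * anisoNorm ν μ z) * (C * weight ν μ h α β) := by
    rw [h1]
    have e : |monomial α x| * ‖∫ z, funSTFT ψ g z * multiD β (tfShift z ψ) x‖ =
        ‖∫ z, ((|monomial α x| : ℝ) : ℂ) * (funSTFT ψ g z * multiD β (tfShift z ψ) x)‖ := by
      rw [integral_const_mul, norm_mul, norm_real, Real.norm_eq_abs, abs_abs]
    rw [e]
    refine norm_integral_le_of_norm_le (hI.mul_const _) (Filter.Eventually.of_forall fun z => ?_)
    rw [norm_mul, norm_mul, norm_real, Real.norm_eq_abs, abs_abs]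
    calc |monomial α x| * (‖funSTFT ψ g z‖ * ‖multiD β (tfShift z ψ) x‖)
        = ‖funSTFT ψ g z‖ * (|monomial α x| * ‖multiD β (tfShift z ψ) x‖) := by ring
      _ ≤ ‖funSTFT ψ g z‖ * (C * Real.exp (A * anisoNorm ν μ z) * weight ν μ h α β) :=
          mul_le_mul_of_nonneg_left (hb z x α β) (norm_nonneg _)
      _ = _ := by ring
  rw [integral_mul_const, norm_mul] at h2
  rw [mul_assoc, mul_assoc, inv_mul_eq_div, le_div_iff₀ hc0] 
  linarith

end GS

end

/-! ### Weighted integrability, the reproducing formula and Riesz representation -/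

noncomputable section

namespace GS

variable {d : ℕ}

theorem exists_norm_funSTFT_le_of_boundedBy (hd : 0 < d) {ν μ r : ℝ} (hν : 1 < ν) (hμ : 0 < μ)
    (hr : 0 ≤ r) (ψ : 𝓢(Rd d, ℂ)) (hψ : Mem ν μ ψ) : ∃ h C : ℝ, 0 < h ∧ 0 < C ∧
      ∀ (g : 𝓢(Rd d, ℂ)) (M : ℝ), BoundedBy ν μ h g M →
      ∀ z, ‖funSTFT ψ g z‖ ≤ C * M * Real.exp (-(r * anisoNorm ν μ z)) := by
  obtain ⟨r', C, hr', hC, H⟩ := exists_norm_funSTFT_le hd hν hμ hr ψ hψ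
  obtain ⟨h1, C1, hh1, hC1, H1⟩ := BoundedBy.exists_norm_le (d := d) μ (zero_lt_one.trans hν) hr'
  obtain ⟨h2, C2, hh2, hC2, H2⟩ := BoundedBy.exists_norm_fourier_le hd hν hμ hr'
  refine ⟨min h1 h2, C * (C1 + C2), lt_min hh1 hh2, by positivity, fun g M hg z => ?_⟩
  have hM := hg.nonneg
  have := H g ((C1 + C2) * M) (by positivity)
    (fun x => (H1 g M (hg.mono (lt_min hh1 hh2) (min_le_left _ _)) x).trans (by
      refine mul_le_mul_of_nonneg_right (mul_le_mul_of_nonneg_right ?_ hM) (Real.exp_pos _).le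
      linarith))
    (fun x => (H2 g M (hg.mono (lt_min hh1 hh2) (min_le_right _ _)) x).trans (by
      refine mul_le_mul_of_nonneg_right (mul_le_mul_of_nonneg_right ?_ hM) (Real.exp_pos _).le
      linarith)) z
  rwa [← mul_assoc] at this

theorem integrable_of_norm_le_exp_anisoNorm {E : Type*} [NormedAddCommGroup E] {ν μ M : ℝ}
    (hν : 0 < ν) (hμ : 0 < μ) {F : Rd d × Rd d → E} (hF : AEStronglyMeasurable F)
    (h : ∀ z, ‖F z‖ ≤ M * Real.exp (-anisoNorm ν μ z)) : Integrable F := by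
  have := (integrable_exp_neg_anisoNorm (d := d) hν hμ one_pos).const_mul M
  simp only [one_mul] at this
  exact this.mono' hF (Filter.Eventually.of_forall h)

theorem memLp_two_of_norm_le_exp_anisoNorm {ν μ M : ℝ} (hν : 0 < ν) (hμ : 0 < μ)
    {F : Rd d × Rd d → ℂ} (hF : AEStronglyMeasurable F)
    (h : ∀ z, ‖F z‖ ≤ M * Real.exp (-anisoNorm ν μ z)) : MemLp F 2 := by
  rw [memLp_two_iff_integrable_sq_norm hF]
  refine integrable_of_norm_le_exp_anisoNorm (M := M ^ 2) hν hμ (hF.norm.pow 2) fun z => ?_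
  have hz := anisoNorm_nonneg ν μ z
  rw [Real.norm_of_nonneg (by positivity)]
  calc ‖F z‖ ^ 2 ≤ (M * Real.exp (-anisoNorm ν μ z)) ^ 2 :=
        pow_le_pow_left₀ (norm_nonneg _) (h z) 2
    _ = M ^ 2 * (Real.exp (-anisoNorm ν μ z) * Real.exp (-anisoNorm ν μ z)) := by ring
    _ ≤ M ^ 2 * (1 * Real.exp (-anisoNorm ν μ z)) := by
        refine mul_le_mul_of_nonneg_left (mul_le_mul_of_nonneg_right ?_ (Real.exp_pos _).le)
          (by positivity)
        exact Real.exp_le_one_iff.2 (by linarith)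
    _ = _ := by rw [one_mul]

/-- Decay at rate `B + 1` leaves `exp(-anisoNorm)` after multiplication by the weight of rate `B`;
this serves both `L¹` and `L²`. -/
theorem exists_norm_weight_mul_funSTFT_le (hd : 0 < d) {ν μ : ℝ} (hν : 1 < ν) (hμ : 0 < μ) {B : ℝ}
    (hB : 0 ≤ B) {ψ g : 𝓢(Rd d, ℂ)} (hψ : Mem ν μ ψ) (hg : Mem ν μ g) : ∃ M, ∀ z,
      ‖(Real.exp (B * anisoNorm ν μ z) : ℂ) * funSTFT ψ g z‖ ≤ M * Real.exp (-anisoNorm ν μ z) := by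
  obtain ⟨h, C, hh, hC, H⟩ :=
    exists_norm_funSTFT_le_of_boundedBy hd hν hμ (r := B + 1) (by positivity) ψ hψ
  obtain ⟨M, hM⟩ := hg.exists_boundedBy hh
  refine ⟨C * M, fun z => ?_⟩
  rw [norm_mul, norm_real, Real.norm_of_nonneg (Real.exp_pos _).le]
  calc Real.exp (B * anisoNorm ν μ z) * ‖funSTFT ψ g z‖
      ≤ Real.exp (B * anisoNorm ν μ z) * (C * M * Real.exp (-((B + 1) * anisoNorm ν μ z))) :=
        mul_le_mul_of_nonneg_left (H g M hM z) (Real.exp_pos _).le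
    _ = C * M * Real.exp (B * anisoNorm ν μ z + -((B + 1) * anisoNorm ν μ z)) := by
        rw [Real.exp_add]; ring
    _ = _ := by ring_nf

theorem continuous_weight_mul_funSTFT {ν μ : ℝ} (hν : 0 < ν) (hμ : 0 < μ) (B : ℝ)
    (ψ g : 𝓢(Rd d, ℂ)) :
    Continuous fun z => (Real.exp (B * anisoNorm ν μ z) : ℂ) * funSTFT ψ g z := by
  have h1 := continuous_anisoNorm (d := d) hν hμ
  have h2 := continuous_funSTFT ψ g
  fun_prop

theorem integrable_funSTFT (hd : 0 < d) {ν μ : ℝ} (hν : 1 < ν) (hμ : 0 < μ)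
    {ψ g : 𝓢(Rd d, ℂ)} (hψ : Mem ν μ ψ) (hg : Mem ν μ g) : Integrable (funSTFT ψ g) := by
  obtain ⟨M, hM⟩ := exists_norm_weight_mul_funSTFT_le hd hν hμ le_rfl hψ hg
  refine integrable_of_norm_le_exp_anisoNorm (M := M) (zero_lt_one.trans hν) hμ
    (continuous_funSTFT ψ g).aestronglyMeasurable fun z => ?_
  simpa using hM z

theorem integrable_norm_funSTFT_mul_exp (hd : 0 < d) {ν μ : ℝ} (hν : 1 < ν) (hμ : 0 < μ) {B : ℝ}
    (hB : 0 ≤ B) {ψ g : 𝓢(Rd d, ℂ)} (hψ : Mem ν μ ψ) (hg : Mem ν μ g) :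
    Integrable fun z => ‖funSTFT ψ g z‖ * Real.exp (B * anisoNorm ν μ z) := by
  obtain ⟨M, hM⟩ := exists_norm_weight_mul_funSTFT_le hd hν hμ hB hψ hg
  have := (integrable_of_norm_le_exp_anisoNorm (M := M) (zero_lt_one.trans hν) hμ
    (continuous_weight_mul_funSTFT (zero_lt_one.trans hν) hμ B ψ g).aestronglyMeasurable hM).norm
  refine this.congr (Filter.Eventually.of_forall fun z => ?_)
  simp only [norm_mul, norm_real, Real.norm_of_nonneg (Real.exp_pos _).le]
  ring

theorem funSTFT_add (ψ f g : 𝓢(Rd d, ℂ)) (z : Rd d × Rd d) :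
    funSTFT ψ (f + g) z = funSTFT ψ f z + funSTFT ψ g z := by
  have hb : ∀ h : 𝓢(Rd d, ℂ), Integrable fun x => h x * conj (tfShift z ψ x) := fun h => by
    refine h.integrable.mul_bdd (c := SchwartzMap.seminorm ℂ 0 0 ψ)
      (continuous_conj.comp (continuous_tfShift_right ψ.continuous z)).aestronglyMeasurable
      (Filter.Eventually.of_forall fun x => ?_)
    rw [RCLike.norm_conj, norm_tfShift]
    exact ψ.norm_le_seminorm ℂ _
  unfold funSTFT
  rw [← integral_add (hb f) (hb g)]
  simp only [add_mul, Pi.add_apply]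

theorem funSTFT_smul (ψ g : Rd d → ℂ) (c : ℂ) (z : Rd d × Rd d) :
    funSTFT ψ (c • g) z = c * funSTFT ψ g z := by
  unfold funSTFT
  rw [← integral_const_mul]
  simp only [Pi.smul_apply, smul_eq_mul, mul_assoc]

/-- The reproducing formula of the short-time Fourier transform. -/
theorem integral_funSTFT_mul_funSTFT_tfShift (ψ g : 𝓢(Rd d, ℂ)) (hV : Integrable (funSTFT ψ g))
    (w : Rd d × Rd d) : ∫ z, funSTFT ψ g z * funSTFT ψ (tfShift z ψ) w =
      ((2 * Real.pi) ^ d : ℝ) * windowMass ψ * funSTFT ψ g w := by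
  set S := SchwartzMap.seminorm ℂ 0 0 ψ with hS
  have hmeas : AEStronglyMeasurable (fun p : (Rd d × Rd d) × Rd d =>
      funSTFT ψ g p.1 * (tfShift p.1 ψ p.2 * conj (tfShift w ψ p.2))) (volume.prod volume) := by
    have h1 := continuous_tfShift (d := d) ψ.continuous
    have h2 := continuous_tfShift_right (d := d) ψ.continuous w
    have h3 := continuous_funSTFT ψ g
    exact ((h3.comp continuous_fst).mul (h1.mul (continuous_conj.comp
      (h2.comp continuous_snd)))).aestronglyMeasurable
  have hw : Integrable (fun x => ‖tfShift w ψ x‖) := by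
    rw [← coe_schwartzShift]
    exact (schwartzShift w ψ).integrable.norm
  have hinteg : Integrable (fun p : (Rd d × Rd d) × Rd d =>
      funSTFT ψ g p.1 * (tfShift p.1 ψ p.2 * conj (tfShift w ψ p.2))) (volume.prod volume) := by
    refine (hV.norm.mul_prod (hw.const_mul S)).mono' hmeas (Filter.Eventually.of_forall fun p => ?_)
    rw [norm_mul, norm_mul, RCLike.norm_conj]
    refine mul_le_mul_of_nonneg_left (mul_le_mul_of_nonneg_right ?_ (norm_nonneg _)) (norm_nonneg _)
    rw [norm_tfShift]
    exact ψ.norm_le_seminorm ℂ _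
  calc ∫ z, funSTFT ψ g z * funSTFT ψ (tfShift z ψ) w
      = ∫ z, ∫ x, funSTFT ψ g z * (tfShift z ψ x * conj (tfShift w ψ x)) := by
        simp only [integral_const_mul]
        rfl
    -- The shifted window is bounded uniformly in `z`, so integrability of the transform of `g`
    -- justifies Fubini; the inner integral is the inversion formula.
    _ = ∫ x, ∫ z, funSTFT ψ g z * (tfShift z ψ x * conj (tfShift w ψ x)) :=
        integral_integral_swap hinteg
    _ = ∫ x, (((2 * Real.pi) ^ d : ℝ) * windowMass ψ) * (g x * conj (tfShift w ψ x)) := by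
        congr 1
        funext x
        simp only [← mul_assoc]
        rw [integral_mul_const, integral_funSTFT_mul_tfShift_prod ψ g hV x]
    _ = _ := by rw [integral_const_mul, funSTFT]

end GS

/-- A linear functional dominated by a linear map into a Hilbert space is represented by a
vector of that space. -/
theorem LinearMap.exists_inner_eq_of_norm_le {E H : Type*} [AddCommGroup E] [Module ℂ E]
    [NormedAddCommGroup H] [InnerProductSpace ℂ H] [CompleteSpace H] (T : E →ₗ[ℂ] H)
    (φ : E →ₗ[ℂ] ℂ) (C : ℝ) (hφ : ∀ g, ‖φ g‖ ≤ C * ‖T g‖) : ∃ y : H, ∀ g, φ g = inner ℂ y (T g) := by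
  -- The domination makes `φ` vanish on the kernel of `T`, so `φ` descends to the range through any
  -- linear section `S`. Hahn–Banach and the Riesz theorem then produce the vector.
  obtain ⟨S, hS⟩ := LinearMap.exists_rightInverse_of_surjective T.rangeRestrict
    (LinearMap.range_rangeRestrict T)
  have hS' : ∀ y : LinearMap.range T, T (S y) = y := fun y => by
    have := LinearMap.congr_fun hS y
    exact congrArg Subtype.val this
  let f : StrongDual ℂ (LinearMap.range T) := (φ.comp S).mkContinuous C fun y => by
    have := hφ (S y)
    rwa [hS' y] at this
  obtain ⟨G, hG, -⟩ := exists_extension_norm_eq (LinearMap.range T) f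
  refine ⟨(InnerProductSpace.toDual ℂ H).symm G, fun g => ?_⟩
  rw [InnerProductSpace.toDual_symm_apply]
  have h1 : G (T g) = φ (S ⟨T g, LinearMap.mem_range_self T g⟩) :=
    hG ⟨T g, LinearMap.mem_range_self T g⟩
  have h2 := hφ (g - S ⟨T g, LinearMap.mem_range_self T g⟩)
  rw [map_sub T, hS', sub_self, norm_zero, mul_zero, map_sub] at h2
  rw [h1]
  exact sub_eq_zero.1 (norm_le_zero_iff.1 h2)

end

/-! ### Inversion of the short-time Fourier transform for ultradistributions -/

noncomputable section

namespace GelfandShilov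

open GS

variable {d : ℕ} {ν μ : ℝ}

theorem mem (f : GelfandShilov d ν μ) : Mem ν μ (f : Rd d → ℂ) := f.2

/-- The inclusion of the Gelfand–Shilov space in the Schwartz space. -/
def toSchwartz (hν : 0 < ν) (f : GelfandShilov d ν μ) : 𝓢(Rd d, ℂ) := f.mem.toSchwartz hν

theorem coe_toSchwartz (hν : 0 < ν) (f : GelfandShilov d ν μ) :
    (f.toSchwartz hν : Rd d → ℂ) = f := rfl

theorem toSchwartz_ne_zero (hν : 0 < ν) {f : GelfandShilov d ν μ} (hf : f ≠ 0) :
    f.toSchwartz hν ≠ 0 := fun h => hf (Subtype.ext (by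
  have : (f.toSchwartz hν : Rd d → ℂ) = (0 : 𝓢(Rd d, ℂ)) := by rw [h]
  exact this))

theorem seminorm_le {h : {h : ℝ // 0 < h}} {f : GelfandShilov d ν μ} {M : ℝ}
    (hf : BoundedBy ν μ h f M) : seminorm d ν μ h f ≤ M := by
  change (⨆ p, quot ν μ h f p) ≤ M
  refine ciSup_le fun p => ?_
  rw [quot, div_le_iff₀ (weight_pos ν μ h.2 _ _)]
  simpa using hf p.1 p.2.1 p.2.2

theorem boundedBy_seminorm (h : {h : ℝ // 0 < h}) (f : GelfandShilov d ν μ) :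
    BoundedBy ν μ h f (seminorm d ν μ h f) := fun x α β => by
  have h1 : quot ν μ h f (x, α, β) ≤ seminorm d ν μ h f := le_ciSup (f.2.2 h h.2) (x, α, β)
  rw [quot, div_le_iff₀ (weight_pos ν μ h.2 _ _)] at h1
  simpa using h1

theorem Dual.map_smul (u : Dual d ν μ) (c : ℂ) (f : GelfandShilov d ν μ) :
    u (c • f) = conj c * u f :=
  ContinuousLinearMap.map_smulₛₗ (show GelfandShilov d ν μ →SL[starRingEnd ℂ] ℂ from u) c f

theorem Dual.exists_norm_apply_le (u : Dual d ν μ) : ∃ h C : ℝ, 0 < h ∧ 0 ≤ C ∧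
    ∀ (f : GelfandShilov d ν μ) (M : ℝ), BoundedBy ν μ h f M → ‖u f‖ ≤ C * M := by
  let u' : GelfandShilov d ν μ →SL[starRingEnd ℂ] ℂ := u
  obtain ⟨s, C, -, hC⟩ := Seminorm.bound_of_continuous (withSeminorms (d := d) (ν := ν) (μ := μ))
    ((normSeminorm ℂ ℂ).comp u'.toLinearMap) (u'.continuous.norm)
  -- A common lower bound of the finitely many parameters, found as an upper bound in the dual
  -- order; smaller `h` means a stronger norm.
  obtain ⟨h, hh⟩ : ∃ h : {h : ℝ // 0 < h}, ∀ i ∈ s, h ≤ i :=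
    Finset.exists_le (α := {h : ℝ // 0 < h}ᵒᵈ) s
  refine ⟨h, C, h.2, C.2, fun f M hf => (hC f).trans ?_⟩
  rw [smul_apply]
  refine mul_le_mul_of_nonneg_left (Seminorm.finset_sup_apply_le hf.nonneg fun i hi => ?_) C.2
  exact seminorm_le (hf.mono h.2 (hh i hi))

theorem Dual.exists_norm_timeFreqShift_le (hν : 0 < ν) (hμ : 0 < μ) (u : Dual d ν μ)
    (φ : GelfandShilov d ν μ) : ∃ C A : ℝ, 0 ≤ C ∧ 0 ≤ A ∧ ∀ z : Rd d × Rd d,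
      ‖u (timeFreqShift hν hμ z.1 z.2 φ)‖ ≤ C * Real.exp (A * anisoNorm ν μ z) := by
  obtain ⟨h, C, hh, hC, H⟩ := u.exists_norm_apply_le
  obtain ⟨h', C', A, hh', hC', hA, H'⟩ := exists_boundedBy_tfShift (d := d) hν hμ hh
  obtain ⟨M, hM⟩ := φ.mem.exists_boundedBy hh'
  refine ⟨C * (C' * M), A, mul_nonneg hC (mul_nonneg hC'.le hM.nonneg), hA, fun z => ?_⟩
  refine (H (timeFreqShift hν hμ z.1 z.2 φ) _ (H' φ M φ.mem.1 hM z)).trans_eq ?_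
  ring

theorem memLp_weight_mul_funSTFT (hd : 0 < d) (hν : 1 < ν) (hμ : 0 < μ)
    (ψ g : GelfandShilov d ν μ) {B : ℝ} (hB : 0 ≤ B) :
    MemLp (fun z : Rd d × Rd d => (Real.exp (B * anisoNorm ν μ z) : ℂ) * funSTFT ψ g z) 2 := by
  have hν0 : 0 < ν := zero_lt_one.trans hν
  rw [← coe_toSchwartz hν0 ψ, ← coe_toSchwartz hν0 g]
  obtain ⟨M, hM⟩ := exists_norm_weight_mul_funSTFT_le hd hν hμ hB (ψ := ψ.toSchwartz hν0)
    (g := g.toSchwartz hν0) ψ.mem g.mem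
  exact memLp_two_of_norm_le_exp_anisoNorm hν0 hμ
    (continuous_weight_mul_funSTFT hν0 hμ B _ _).aestronglyMeasurable hM

/-- The weighted short-time Fourier transform as a linear map into `L²`. -/
def stftL2 (hd : 0 < d) (hν : 1 < ν) (hμ : 0 < μ) (ψ : GelfandShilov d ν μ) {B : ℝ} (hB : 0 ≤ B) :
    GelfandShilov d ν μ →ₗ[ℂ] Lp ℂ 2 (volume : Measure (Rd d × Rd d)) where
  toFun g := (memLp_weight_mul_funSTFT hd hν hμ ψ g hB).toLp _
  map_add' f g := by
    rw [← MemLp.toLp_add]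
    congr 1
    funext z
    have : funSTFT ψ (f + g : GelfandShilov d ν μ) z = funSTFT ψ f z + funSTFT ψ g z :=
      funSTFT_add (ψ.toSchwartz (zero_lt_one.trans hν)) (f.toSchwartz (zero_lt_one.trans hν))
        (g.toSchwartz (zero_lt_one.trans hν)) z
    simp only [this, Pi.add_apply, mul_add]
  map_smul' c g := by
    rw [RingHom.id_apply, ← MemLp.toLp_const_smul]
    congr 1
    funext z
    have : funSTFT ψ (c • g : GelfandShilov d ν μ) z = c * funSTFT ψ g z :=
      funSTFT_smul ψ g c z
    simp only [this, Pi.smul_apply, smul_eq_mul]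
    ring

theorem coeFn_stftL2 (hd : 0 < d) (hν : 1 < ν) (hμ : 0 < μ) (ψ : GelfandShilov d ν μ) {B : ℝ}
    (hB : 0 ≤ B) (g : GelfandShilov d ν μ) : stftL2 hd hν hμ ψ hB g =ᵐ[volume] fun z =>
      (Real.exp (B * anisoNorm ν μ z) : ℂ) * funSTFT ψ g z :=
  MemLp.coeFn_toLp (memLp_weight_mul_funSTFT hd hν hμ ψ g hB)

/-- Cauchy–Schwarz against the square integrable function `exp(-anisoNorm)`, at the price of one
unit in the rate of the weight. -/
theorem integral_norm_funSTFT_mul_exp_le (hd : 0 < d) (hν : 1 < ν) (hμ : 0 < μ)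
    (ψ : GelfandShilov d ν μ) {B : ℝ} (hB : 0 ≤ B) : ∃ C, 0 ≤ C ∧ ∀ g : GelfandShilov d ν μ,
      ∫ z, ‖funSTFT ψ g z‖ * Real.exp (B * anisoNorm ν μ z) ≤
        C * ‖stftL2 hd hν hμ ψ (B := B + 1) (by positivity) g‖ := by
  have hν0 : 0 < ν := zero_lt_one.trans hν
  have hw : MemLp (fun z : Rd d × Rd d => Real.exp (-anisoNorm ν μ z)) 2 := by
    have := memLp_two_of_norm_le_exp_anisoNorm (d := d) (M := 1) hν0 hμ
      (F := fun z => (Real.exp (-anisoNorm ν μ z) : ℂ)) (by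
        have h1 := continuous_anisoNorm (d := d) hν0 hμ
        exact (by fun_prop : Continuous fun z : Rd d × Rd d =>
          (Real.exp (-anisoNorm ν μ z) : ℂ)).aestronglyMeasurable) (fun z => by
        rw [norm_real, Real.norm_of_nonneg (Real.exp_pos _).le, one_mul])
    exact this.re
  refine ⟨‖hw.toLp _‖, norm_nonneg _, fun g => ?_⟩
  set T := stftL2 hd hν hμ ψ (B := B + 1) (by positivity) g with hT
  have hn : MemLp (fun z => ‖T z‖) 2 volume := (Lp.memLp T).norm
  have h1 : ‖hn.toLp _‖ = ‖T‖ := by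
    rw [Lp.norm_toLp, Lp.norm_def, eLpNorm_norm]
  rw [← h1]
  have h2 := norm_inner_le_norm (𝕜 := ℝ) (hw.toLp _) (hn.toLp _)
  refine le_trans (le_of_eq ?_) ((le_abs_self _).trans h2)
  rw [L2.inner_def]
  refine integral_congr_ae ?_
  filter_upwards [hw.coeFn_toLp, hn.coeFn_toLp, coeFn_stftL2 hd hν hμ ψ (B := B + 1)
    (by positivity) g] with z hz1 hz2 hz3
  rw [hz1, hz2, hz3, norm_mul, norm_real, Real.norm_of_nonneg (Real.exp_pos _).le]
  have : Real.exp ((B + 1) * anisoNorm ν μ z) =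
      Real.exp (B * anisoNorm ν μ z) * Real.exp (anisoNorm ν μ z) := by
    rw [← Real.exp_add]; ring_nf
  simp only [RCLike.inner_apply, conj_trivial, this]
  rw [Real.exp_neg]
  field_simp

/-- Continuity bounds `u` by one Gelfand–Shilov norm, inversion bounds that norm by a weighted `L¹`
norm of the short-time Fourier transform, and this in turn by a weighted `L²` norm. -/
theorem Dual.exists_norm_le_stftL2 (hd : 0 < d) (hν : 1 < ν) (hμ : 0 < μ) (u : Dual d ν μ)
    (ψ : GelfandShilov d ν μ) (hψ : ψ ≠ 0) : ∃ (B : ℝ) (hB : 0 ≤ B) (C : ℝ),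
      ∀ g, ‖u g‖ ≤ C * ‖stftL2 hd hν hμ ψ hB g‖ := by
  have hν0 : 0 < ν := zero_lt_one.trans hν
  obtain ⟨h, C, hh, hC, H⟩ := u.exists_norm_apply_le
  obtain ⟨h', C', A, hh', hC', hA, H'⟩ := exists_boundedBy_tfShift (d := d) hν0 hμ hh
  obtain ⟨M, hM⟩ := ψ.mem.exists_boundedBy hh'
  obtain ⟨Q, hQ, HQ⟩ := integral_norm_funSTFT_mul_exp_le hd hν hμ ψ hA
  have hM0 := hM.nonneg
  set N := ‖(((2 * Real.pi) ^ d : ℝ) : ℂ) * windowMass ψ‖⁻¹ * (C' * M) with hN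
  have hN0 : 0 ≤ N := by positivity
  refine ⟨A + 1, by positivity, C * (N * Q), fun g => ?_⟩
  have h1 := boundedBy_of_funSTFT (ψ.toSchwartz hν0) (g.toSchwartz hν0)
    (toSchwartz_ne_zero hν0 hψ) (H' ψ M ψ.mem.1 hM) (integrable_funSTFT hd hν hμ ψ.mem g.mem)
    (integrable_norm_funSTFT_mul_exp hd hν hμ hA ψ.mem g.mem)
  refine (H g _ h1).trans ?_
  calc C * (N * ∫ z, ‖funSTFT ψ g z‖ * Real.exp (A * anisoNorm ν μ z))
      ≤ C * (N * (Q * ‖stftL2 hd hν hμ ψ (B := A + 1) (by positivity) g‖)) :=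
        mul_le_mul_of_nonneg_left (mul_le_mul_of_nonneg_left (HQ g) hN0) hC
    _ = _ := by ring

/-- Makes `u` an honest integral, so that the inversion formula for `u` reduces to Fubini instead of
moving a functional under a vector-valued integral. -/
theorem Dual.exists_eq_integral_conj_funSTFT (hd : 0 < d) (hν : 1 < ν) (hμ : 0 < μ)
    (u : Dual d ν μ) (ψ : GelfandShilov d ν μ) (hψ : ψ ≠ 0) : ∃ B : ℝ, 0 ≤ B ∧
      ∃ y : Lp ℂ 2 (volume : Measure (Rd d × Rd d)), ∀ g : GelfandShilov d ν μ, u g =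
        ∫ z, (y z * (Real.exp (B * anisoNorm ν μ z) : ℂ)) * conj (funSTFT ψ g z) := by
  obtain ⟨B, hB, C, hC⟩ := u.exists_norm_le_stftL2 hd hν hμ ψ hψ
  -- Conjugation turns the conjugate linear `u` into a linear functional.
  let φ : GelfandShilov d ν μ →ₗ[ℂ] ℂ :=
    { toFun := fun g => conj (u g)
      map_add' := fun f g => by rw [map_add, map_add]
      map_smul' := fun c g => by
        rw [Dual.map_smul, map_mul, conj_conj]
        rfl }
  obtain ⟨y, hy⟩ := LinearMap.exists_inner_eq_of_norm_le (stftL2 hd hν hμ ψ hB) φ C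
    (fun g => by simpa [φ] using hC g)
  refine ⟨B, hB, y, fun g => ?_⟩
  have h1 : conj (u g) = ∫ z, inner ℂ (y z) (stftL2 hd hν hμ ψ hB g z) := hy g
  rw [← conj_conj (u g), h1, ← integral_conj]
  refine integral_congr_ae ?_
  filter_upwards [coeFn_stftL2 hd hν hμ ψ hB g] with z hz
  rw [hz, RCLike.inner_apply]
  simp only [map_mul, conj_conj, conj_ofReal]
  ring

theorem aestronglyMeasurable_funSTFT_tfShift (ψ : 𝓢(Rd d, ℂ)) :
    AEStronglyMeasurable (fun p : (Rd d × Rd d) × (Rd d × Rd d) =>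
      funSTFT ψ (tfShift p.1 ψ) p.2) (volume.prod volume) := by
  have h1 := continuous_tfShift (d := d) ψ.continuous
  have h2 : Continuous fun q : ((Rd d × Rd d) × (Rd d × Rd d)) × Rd d =>
      tfShift q.1.1 ψ q.2 * conj (tfShift q.1.2 ψ q.2) :=
    (h1.comp (g := fun p : (Rd d × Rd d) × Rd d => tfShift p.1 ψ p.2)
      (f := fun q : ((Rd d × Rd d) × (Rd d × Rd d)) × Rd d => (q.1.1, q.2)) (by fun_prop)).mul
    (continuous_conj.comp (h1.comp (g := fun p : (Rd d × Rd d) × Rd d => tfShift p.1 ψ p.2)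
      (f := fun q : ((Rd d × Rd d) × (Rd d × Rd d)) × Rd d => (q.1.2, q.2)) (by fun_prop)))
  exact (h2.stronglyMeasurable.integral_prod_right' (ν := volume)).aestronglyMeasurable

/-- The inversion formula of the short-time Fourier transform, for ultradistributions. -/
theorem Dual.apply_eq_integral (hd : 0 < d) (hν : 1 < ν) (hν0 : 0 < ν) (hμ : 0 < μ) (u : Dual d ν μ)
    (ψ : GelfandShilov d ν μ) (hψ : ψ ≠ 0) (g : GelfandShilov d ν μ) :
    conj ((((2 * Real.pi) ^ d : ℝ) : ℂ) * windowMass ψ) * u g =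
      ∫ z : Rd d × Rd d, conj (funSTFT ψ g z) * u (timeFreqShift hν0 hμ z.1 z.2 ψ) := by
  obtain ⟨B, hB, y, hy⟩ := u.exists_eq_integral_conj_funSTFT hd hν hμ ψ hψ
  obtain ⟨h, C, hh, hC, H⟩ := exists_norm_funSTFT_le_of_boundedBy hd hν hμ (r := B + 1)
    (by positivity) (ψ.toSchwartz hν0) ψ.mem
  obtain ⟨h', C', A, hh', hC', hA, H'⟩ := exists_boundedBy_tfShift (d := d) hν0 hμ hh
  obtain ⟨M, hM⟩ := ψ.mem.exists_boundedBy hh'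
  have hM0 := hM.nonneg
  -- The rate `B + 1` in `w` beats the weight `e^{B·}` attached to `y`; the growth in `z` is
  -- absorbed by the decay of the transform of `g`.
  have hK : ∀ z w, ‖funSTFT ψ (tfShift z ψ) w‖ ≤
      C * (C' * M * Real.exp (A * anisoNorm ν μ z)) * Real.exp (-((B + 1) * anisoNorm ν μ w)) :=
    fun z w => H ((timeFreqShift hν0 hμ z.1 z.2 ψ).toSchwartz hν0) _ (H' ψ M ψ.mem.1 hM z) w
  have hcont := continuous_anisoNorm (d := d) hν0 hμ
  have hVc : Continuous (funSTFT ψ g : Rd d × Rd d → ℂ) :=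
    continuous_funSTFT (ψ.toSchwartz hν0) (g.toSchwartz hν0)
  have hV : Integrable (funSTFT ψ g : Rd d × Rd d → ℂ) :=
    integrable_funSTFT hd hν hμ (ψ := ψ.toSchwartz hν0) (g := g.toSchwartz hν0) ψ.mem g.mem
  have hI1 : Integrable fun z : Rd d × Rd d =>
      ‖funSTFT ψ g z‖ * Real.exp (A * anisoNorm ν μ z) :=
    integrable_norm_funSTFT_mul_exp hd hν hμ hA (ψ := ψ.toSchwartz hν0) (g := g.toSchwartz hν0)
      ψ.mem g.mem
  have hI2 : Integrable fun w : Rd d × Rd d =>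
      C * C' * M * ‖y w * (Real.exp (-anisoNorm ν μ w) : ℂ)‖ := by
    refine (MemLp.integrable_mul (p := 2) (q := 2) (Lp.memLp y) ?_).norm.const_mul _
    refine memLp_two_of_norm_le_exp_anisoNorm (M := 1) hν0 hμ ?_ fun z => ?_
    · exact (by fun_prop : Continuous fun z : Rd d × Rd d =>
        (Real.exp (-anisoNorm ν μ z) : ℂ)).aestronglyMeasurable
    · rw [norm_real, Real.norm_of_nonneg (Real.exp_pos _).le, one_mul]
  have hmeas : AEStronglyMeasurable (fun p : (Rd d × Rd d) × (Rd d × Rd d) =>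
      conj (funSTFT ψ g p.1) * ((y p.2 * (Real.exp (B * anisoNorm ν μ p.2) : ℂ)) *
        conj (funSTFT ψ (tfShift p.1 ψ) p.2))) (volume.prod volume) := by
    have e1 : Continuous fun p : (Rd d × Rd d) × (Rd d × Rd d) => conj (funSTFT ψ g p.1) :=
      continuous_conj.comp (hVc.comp continuous_fst)
    have e2 : Continuous fun p : (Rd d × Rd d) × (Rd d × Rd d) =>
      (Real.exp (B * anisoNorm ν μ p.2) : ℂ) := by fun_prop
    have e3 : AEStronglyMeasurable (fun p : (Rd d × Rd d) × (Rd d × Rd d) => y p.2)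
      (volume.prod volume) := (Lp.aestronglyMeasurable y).comp_snd
    exact e1.aestronglyMeasurable.mul ((e3.mul e2.aestronglyMeasurable).mul
      (continuous_conj.comp_aestronglyMeasurable
        (aestronglyMeasurable_funSTFT_tfShift (ψ.toSchwartz hν0))))
  have hinteg : Integrable (fun p : (Rd d × Rd d) × (Rd d × Rd d) =>
      conj (funSTFT ψ g p.1) * ((y p.2 * (Real.exp (B * anisoNorm ν μ p.2) : ℂ)) *
        conj (funSTFT ψ (tfShift p.1 ψ) p.2))) (volume.prod volume) := by
    refine (hI1.mul_prod hI2).mono' hmeas (Filter.Eventually.of_forall fun p => ?_)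
    simp only [norm_mul, RCLike.norm_conj, norm_real, Real.norm_of_nonneg (Real.exp_pos _).le]
    calc ‖funSTFT ψ g p.1‖ * (‖y p.2‖ * Real.exp (B * anisoNorm ν μ p.2) *
          ‖funSTFT ψ (tfShift p.1 ψ) p.2‖)
        ≤ ‖funSTFT ψ g p.1‖ * (‖y p.2‖ * Real.exp (B * anisoNorm ν μ p.2) *
          (C * (C' * M * Real.exp (A * anisoNorm ν μ p.1)) *
            Real.exp (-((B + 1) * anisoNorm ν μ p.2)))) := by
          refine mul_le_mul_of_nonneg_left (mul_le_mul_of_nonneg_left (hK _ _) ?_) (norm_nonneg _)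
          positivity
      _ = _ := by
          have : Real.exp (-((B + 1) * anisoNorm ν μ p.2)) =
              Real.exp (-anisoNorm ν μ p.2) * (Real.exp (B * anisoNorm ν μ p.2))⁻¹ := by
            rw [← Real.exp_neg, ← Real.exp_add]; ring_nf
          rw [this]
          field_simp
  have hrep : ∀ w, ∫ z, conj (funSTFT ψ g z) * conj (funSTFT ψ (tfShift z ψ) w) =
      conj ((((2 * Real.pi) ^ d : ℝ) : ℂ) * windowMass ψ) * conj (funSTFT ψ g w) := fun w => by
    have := integral_funSTFT_mul_funSTFT_tfShift (ψ.toSchwartz hν0) (g.toSchwartz hν0) hV w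
    rw [coe_toSchwartz, coe_toSchwartz] at this
    rw [← map_mul, ← this, ← integral_conj]
    simp only [map_mul]
  symm
  calc ∫ z : Rd d × Rd d, conj (funSTFT ψ g z) * u (timeFreqShift hν0 hμ z.1 z.2 ψ)
      = ∫ z : Rd d × Rd d, ∫ w, conj (funSTFT ψ g z) *
          ((y w * (Real.exp (B * anisoNorm ν μ w) : ℂ)) *
            conj (funSTFT ψ (tfShift z ψ) w)) := by
        congr 1
        funext z
        rw [hy, integral_const_mul]
        rfl
    _ = ∫ w, ∫ z : Rd d × Rd d, conj (funSTFT ψ g z) *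
          ((y w * (Real.exp (B * anisoNorm ν μ w) : ℂ)) *
            conj (funSTFT ψ (tfShift z ψ) w)) := integral_integral_swap hinteg
    -- The inner integral is the conjugated reproducing formula for `g`.
    _ = ∫ w, conj ((((2 * Real.pi) ^ d : ℝ) : ℂ) * windowMass ψ) *
          ((y w * (Real.exp (B * anisoNorm ν μ w) : ℂ)) * conj (funSTFT ψ g w)) := by
        congr 1
        funext w
        have e : ∀ z, conj (funSTFT ψ g z) * ((y w * (Real.exp (B * anisoNorm ν μ w) : ℂ)) *
            conj (funSTFT ψ (tfShift z ψ) w)) = (y w * (Real.exp (B * anisoNorm ν μ w) : ℂ)) *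
            (conj (funSTFT ψ g z) * conj (funSTFT ψ (tfShift z ψ) w)) := fun z => by ring
        simp only [e]
        rw [integral_const_mul, hrep]
        ring
    _ = _ := by rw [integral_const_mul, ← hy]

end GelfandShilov

end

/-! ### Taylor remainders, and boundedness of phase multipliers -/

noncomputable section

namespace GS

variable {d : ℕ}

theorem exists_norm_aeval_le (P : Polynomial ℝ) {n : ℕ} (hP : P.natDegree ≤ n) :
    ∃ C : ℝ, 0 ≤ C ∧ ∀ z : ℂ, ‖Polynomial.aeval z P‖ ≤ C * (1 + ‖z‖) ^ n := by
  refine ⟨∑ i ∈ Finset.range (n + 1), |P.coeff i|, by positivity, fun z => ?_⟩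
  rw [Polynomial.aeval_eq_sum_range' (Nat.lt_succ_of_le hP), Finset.sum_mul]
  refine (norm_sum_le _ _).trans (Finset.sum_le_sum fun i hi => ?_)
  rw [norm_smul, norm_pow, Real.norm_eq_abs]
  have h1 : ‖z‖ ^ i ≤ (1 + ‖z‖) ^ i := pow_le_pow_left₀ (norm_nonneg _) (by linarith) _
  have h2 : (1 + ‖z‖) ^ i ≤ (1 + ‖z‖) ^ n :=
    pow_le_pow_right₀ (by linarith [norm_nonneg z]) (Nat.lt_succ_iff.1 (Finset.mem_range.1 hi))
  exact mul_le_mul_of_nonneg_left (h1.trans h2) (abs_nonneg _)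

/-- The mean value inequality on a complex disc, where the derivative has degree at most `n`. -/
theorem exists_norm_aeval_add_sub_le (P : Polynomial ℝ) {n : ℕ} (hP : P.natDegree ≤ n + 1) :
    ∃ C : ℝ, 0 ≤ C ∧ ∀ x y : ℂ, ‖Polynomial.aeval (x + y) P - Polynomial.aeval x P‖ ≤
      C * ‖y‖ * (1 + ‖x‖ + ‖y‖) ^ n := by
  obtain ⟨C, hC, H⟩ := exists_norm_aeval_le (Polynomial.derivative P) (n := n)
    ((Polynomial.natDegree_derivative_le P).trans (by omega))
  refine ⟨C, hC, fun x y => ?_⟩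
  have h := (convex_closedBall x ‖y‖).norm_image_sub_le_of_norm_hasDerivWithin_le
    (f := fun z => Polynomial.aeval z P) (f' := fun z => Polynomial.aeval z (Polynomial.derivative P))
    (C := C * (1 + ‖x‖ + ‖y‖) ^ n) (x := x) (y := x + y)
    (fun z _ => (P.hasDerivAt_aeval z).hasDerivWithinAt) (fun z hz => ?_)
    (Metric.mem_closedBall_self (norm_nonneg _)) (by simp)
  · refine h.trans_eq ?_
    rw [add_sub_cancel_left]
    ring
  · refine (H z).trans (mul_le_mul_of_nonneg_left (pow_le_pow_left₀ (by positivity) ?_ _) hC)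
    have : ‖z‖ ≤ ‖x‖ + ‖z - x‖ := by simpa using norm_add_le x (z - x)
    rw [mem_closedBall_iff_norm] at hz
    linarith

theorem aeval_ofReal (P : Polynomial ℝ) (s : ℝ) :
    Polynomial.aeval (s : ℂ) P = ((P.eval s : ℝ) : ℂ) := by
  simpa using Polynomial.aeval_algebraMap_apply ℂ s P

/-- The growth estimate on which the decay of phase multipliers rests, for a fixed phase. -/
theorem exists_norm_phase_increment_le (ρ : Fin d → Polynomial ℝ) {m : ℕ} (hm : 2 ≤ m)
    (hρ : ∀ j, (ρ j).natDegree ≤ m) : ∃ B : ℝ, 0 ≤ B ∧ ∀ (j : Fin d) (s : ℝ) (w : ℂ), ‖w‖ ≤ 1 →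
      ‖Polynomial.aeval ((s : ℂ) + w) (ρ j) - (((ρ j).eval s : ℝ) : ℂ)‖ ≤
        B * ‖w‖ * ((1 + 0 + |s|) ^ (m - 2) * (1 + |s|)) := by
  obtain ⟨n, rfl⟩ := Nat.exists_eq_add_of_le' hm
  choose C hC H using fun j => exists_norm_aeval_add_sub_le (ρ j) (n := n + 1) (hρ j)
  refine ⟨2 ^ (n + 1) * ∑ j, C j, mul_nonneg (by positivity) (Finset.sum_nonneg fun j _ => hC j),
    fun j s w hw => ?_⟩
  have h1 := H j s w
  rw [aeval_ofReal, norm_real, Real.norm_eq_abs] at h1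
  have h2 : (1 + |s| + ‖w‖) ^ (n + 1) ≤ 2 ^ (n + 1) * ((1 + 0 + |s|) ^ n * (1 + |s|)) := by
    rw [add_zero, ← pow_succ, ← mul_pow]
    exact pow_le_pow_left₀ (by positivity) (by linarith [abs_nonneg s]) _
  have h3 : C j ≤ ∑ j, C j := Finset.single_le_sum (fun j _ => hC j) (Finset.mem_univ j)
  have hs := Finset.sum_nonneg fun j (_ : j ∈ Finset.univ) => hC j
  calc _ ≤ C j * ‖w‖ * (1 + |s| + ‖w‖) ^ (n + 1) := h1
    _ ≤ (∑ j, C j) * ‖w‖ * (2 ^ (n + 1) * ((1 + 0 + |s|) ^ n * (1 + |s|))) :=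
        mul_le_mul (mul_le_mul_of_nonneg_right h3 (norm_nonneg _)) h2 (by positivity)
          (mul_nonneg hs (norm_nonneg _))
    _ = _ := by
        simp only [Nat.add_sub_cancel]
        ring

/-- The second order Taylor remainder of `a` at `ξ`, in the variable `s` with increment `2 π s`. -/
def taylorRemainder (a : Polynomial ℝ) (ξ : ℝ) : Polynomial ℝ :=
  a.comp (Polynomial.C (2 * Real.pi) * Polynomial.X + Polynomial.C ξ) -
    Polynomial.C (a.eval ξ) -
    Polynomial.C (a.derivative.eval ξ * (2 * Real.pi)) * Polynomial.X

theorem eval_taylorRemainder (a : Polynomial ℝ) (ξ s : ℝ) : (taylorRemainder a ξ).eval s =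
    a.eval (ξ + 2 * Real.pi * s) - a.eval ξ - a.derivative.eval ξ * (2 * Real.pi * s) := by
  simp [taylorRemainder, Polynomial.eval_comp, add_comm]
  ring

/-- The derivative of the remainder is `2π(a'(ξ + 2πs) - a'(ξ))`. Removing the linear term replaces
one of the `m-1` factors of order `1 + ‖ξ‖ + |s|` by one of order `1 + |s|`; this factor free of `ξ`
is what the interpolation exploits. -/
theorem exists_norm_taylorRemainder_increment_le (a : Fin d → Polynomial ℝ) {m : ℕ} (hm : 2 ≤ m)
    (ha : ∀ j, (a j).natDegree ≤ m) : ∃ B : ℝ, 0 ≤ B ∧ ∀ (ξ : Rd d) (j : Fin d) (s : ℝ) (w : ℂ),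
      ‖w‖ ≤ 1 → ‖Polynomial.aeval ((s : ℂ) + w) (taylorRemainder (a j) (ξ j)) -
        (((taylorRemainder (a j) (ξ j)).eval s : ℝ) : ℂ)‖ ≤
        B * ‖w‖ * ((1 + ‖ξ‖ + |s|) ^ (m - 2) * (1 + |s|)) := by
  obtain ⟨n, rfl⟩ := Nat.exists_eq_add_of_le' hm
  simp only [Nat.add_sub_cancel]
  choose C hC H using fun j => exists_norm_aeval_add_sub_le (Polynomial.derivative (a j)) (n := n)
    ((Polynomial.natDegree_derivative_le (a j)).trans (by have := ha j; omega))
  have hpi : (0 : ℝ) < 2 * Real.pi := by positivity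
  have hpi1 : (1 : ℝ) ≤ 2 * Real.pi := by linarith [Real.pi_gt_three]
  have hs := Finset.sum_nonneg fun j (_ : j ∈ Finset.univ) => hC j
  set T : ℝ := 2 * Real.pi with hT
  refine ⟨(∑ j, C j) * T ^ 2 * (2 * T) ^ n, by positivity, fun ξ j s w hw => ?_⟩
  have h3 : C j ≤ ∑ j, C j := Finset.single_le_sum (fun j _ => hC j) (Finset.mem_univ j)
  have hξ : |ξ j| ≤ ‖ξ‖ := abs_apply_le_norm ξ j
  have h := (convex_closedBall (s : ℂ) ‖w‖).norm_image_sub_le_of_norm_hasDerivWithin_le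
    (f := fun z => Polynomial.aeval z (taylorRemainder (a j) (ξ j)))
    (f' := fun z => Polynomial.aeval z (Polynomial.derivative (taylorRemainder (a j) (ξ j))))
    (C := (∑ j, C j) * T ^ 2 * (2 * T) ^ n * ((1 + ‖ξ‖ + |s|) ^ n * (1 + |s|)))
    (x := (s : ℂ)) (y := s + w)
    (fun z _ => (Polynomial.hasDerivAt_aeval _ z).hasDerivWithinAt) (fun z hz => ?_)
    (Metric.mem_closedBall_self (norm_nonneg _)) (by simp)
  · rw [add_sub_cancel_left, aeval_ofReal] at h
    refine h.trans_eq ?_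
    ring
  · have hz1 : ‖z‖ ≤ 1 + |s| := by
      have : ‖z‖ ≤ ‖(s : ℂ)‖ + ‖z - s‖ := by simpa using norm_add_le (s : ℂ) (z - s)
      rw [mem_closedBall_iff_norm] at hz
      rw [norm_real, Real.norm_eq_abs] at this
      linarith
    have e : Polynomial.aeval z (Polynomial.derivative (taylorRemainder (a j) (ξ j))) =
        T * (Polynomial.aeval ((ξ j : ℂ) + T * z) (Polynomial.derivative (a j)) -
          Polynomial.aeval (ξ j : ℂ) (Polynomial.derivative (a j))) := by
      rw [aeval_ofReal]
      simp [taylorRemainder, Polynomial.derivative_comp, Polynomial.aeval_comp, hT, add_comm]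
      ring
    have hTz : ‖(T : ℂ) * z‖ ≤ T * (1 + |s|) := by
      rw [norm_mul, norm_real, Real.norm_of_nonneg hpi.le]
      exact mul_le_mul_of_nonneg_left hz1 hpi.le
    rw [e, norm_mul, norm_real, Real.norm_of_nonneg hpi.le]
    have h5 : 1 + ‖(ξ j : ℂ)‖ + ‖(T : ℂ) * z‖ ≤ 2 * T * (1 + ‖ξ‖ + |s|) := by
      rw [norm_real, Real.norm_eq_abs]
      nlinarith [norm_nonneg ξ, abs_nonneg s]
    calc T * ‖Polynomial.aeval ((ξ j : ℂ) + T * z) (Polynomial.derivative (a j)) -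
          Polynomial.aeval (ξ j : ℂ) (Polynomial.derivative (a j))‖
        ≤ T * (C j * ‖(T : ℂ) * z‖ * (1 + ‖(ξ j : ℂ)‖ + ‖(T : ℂ) * z‖) ^ n) :=
          mul_le_mul_of_nonneg_left (H j _ _) hpi.le
      _ ≤ T * ((∑ j, C j) * (T * (1 + |s|)) * (2 * T * (1 + ‖ξ‖ + |s|)) ^ n) := by
          refine mul_le_mul_of_nonneg_left (mul_le_mul (mul_le_mul h3 hTz (norm_nonneg _) hs)
            (pow_le_pow_left₀ (by positivity) h5 _) (by positivity) (by positivity)) hpi.le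
      _ = _ := by rw [mul_pow (2 * T)]; ring

/-- Uniform decay of the short-time Fourier transform of `phaseMultiplier ρ f`. -/
theorem exists_norm_funSTFT_phaseMultiplier_le (hd : 0 < d) {μ ν B r : ℝ} (hμ : 0 < μ) (hν : 1 < ν)
    (hB : 0 ≤ B) (hr : 0 ≤ r) {m : ℕ} (hm : 2 ≤ m) (hνμ : μ * ((m : ℝ) - 1) ≤ ν)
    (ψ : 𝓢(Rd d, ℂ)) (hψ : Mem ν μ ψ) :
    ∃ h' C : ℝ, 0 < h' ∧ 0 < C ∧ ∀ (f : 𝓢(Rd d, ℂ)) (M : ℝ), BoundedBy ν μ h' f M →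
      ∀ (ρ : Fin d → Polynomial ℝ) (X : ℝ), 0 ≤ X →
      (∀ (j : Fin d) (s : ℝ) (w : ℂ), ‖w‖ ≤ 1 →
        ‖Polynomial.aeval ((s : ℂ) + w) (ρ j) - (((ρ j).eval s : ℝ) : ℂ)‖ ≤
          B * ‖w‖ * ((1 + X + |s|) ^ (m - 2) * (1 + |s|))) →
      ∀ z, ‖funSTFT ψ (phaseMultiplier ρ f) z‖ ≤
        C * M * Real.exp (X ^ μ⁻¹) * Real.exp (-(r * anisoNorm ν μ z)) := by
  obtain ⟨r', C, hr', hC, H⟩ := exists_norm_funSTFT_le hd hν hμ hr ψ hψ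
  obtain ⟨h1, C1, hh1, hC1, H1⟩ := exists_norm_phaseMultiplier_le hd hμ hν hB hr' hm hνμ
  obtain ⟨h2, C2, hh2, hC2, H2⟩ := BoundedBy.exists_norm_fourier_le hd hν hμ hr'
  refine ⟨min h1 h2, C * (C1 + C2), lt_min hh1 hh2, by positivity, fun f M hf ρ X hX hρ z => ?_⟩
  have hM := hf.nonneg
  have hE : 1 ≤ Real.exp (X ^ μ⁻¹) := Real.one_le_exp (by positivity)
  have := H (phaseMultiplier ρ f) ((C1 + C2) * M * Real.exp (X ^ μ⁻¹)) (by positivity)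
    (fun x => (H1 f M (hf.mono (lt_min hh1 hh2) (min_le_left _ _)) ρ X hX hρ x).trans (by
      refine mul_le_mul_of_nonneg_right (mul_le_mul_of_nonneg_right
        (mul_le_mul_of_nonneg_right ?_ hM) (Real.exp_pos _).le) (Real.exp_pos _).le
      linarith))
    -- On the Fourier side the multiplier does not change the modulus; since `exp(X^{1/μ}) ≥ 1`, the
    -- bound for `𝓕f` fits the same form.
    (fun x => by
      rw [norm_fourier_phaseMultiplier]
      refine (H2 f M (hf.mono (lt_min hh1 hh2) (min_le_right _ _)) x).trans
        (mul_le_mul_of_nonneg_right ?_ (Real.exp_pos _).le)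
      have h3 : C2 * M ≤ (C1 + C2) * M := mul_le_mul_of_nonneg_right (by linarith) hM
      have h4 : 0 ≤ (C1 + C2) * M := by positivity
      nlinarith) z
  refine this.trans_eq ?_
  ring

/-- Spares a direct estimate of all `x^α D^β` of a multiplier image: decay of its short-time Fourier
transform suffices. -/
theorem exists_boundedBy_of_norm_funSTFT_le {ν μ h : ℝ} (hν : 0 < ν) (hμ : 0 < μ) (hh : 0 < h)
    (ψ : 𝓢(Rd d, ℂ)) (hψ : Mem ν μ ψ) (hψ0 : ψ ≠ 0) : ∃ r C : ℝ, 0 ≤ r ∧ 0 ≤ C ∧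
      ∀ (g : 𝓢(Rd d, ℂ)) (M : ℝ), (∀ z, ‖funSTFT ψ g z‖ ≤ M * Real.exp (-(r * anisoNorm ν μ z))) →
        BoundedBy ν μ h g (C * M) := by
  obtain ⟨h', C', A, hh', hC', hA, H'⟩ := exists_boundedBy_tfShift (d := d) hν hμ hh
  obtain ⟨M', hM'⟩ := hψ.exists_boundedBy hh'
  have hM0 := hM'.nonneg
  set N := ‖(((2 * Real.pi) ^ d : ℝ) : ℂ) * windowMass ψ‖⁻¹ * (C' * M') with hN
  have hN0 : 0 ≤ N := by positivity
  set J := ∫ z : Rd d × Rd d, Real.exp (-anisoNorm ν μ z) with hJ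
  have hJ0 : 0 ≤ J := integral_nonneg fun _ => (Real.exp_pos _).le
  have hJi : Integrable fun z : Rd d × Rd d => Real.exp (-anisoNorm ν μ z) := by
    simpa using integrable_exp_neg_anisoNorm (d := d) hν hμ one_pos
  refine ⟨A + 1, N * J, by positivity, by positivity, fun g M hg => ?_⟩
  have hVc := continuous_funSTFT ψ g
  have hMn : 0 ≤ M := by
    have := (norm_nonneg _).trans (hg 0)
    exact nonneg_of_mul_nonneg_left this (Real.exp_pos _)
  have hle : ∀ z, ‖funSTFT ψ g z‖ * Real.exp (A * anisoNorm ν μ z) ≤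
      M * Real.exp (-anisoNorm ν μ z) := fun z => by
    refine (mul_le_mul_of_nonneg_right (hg z) (Real.exp_pos _).le).trans_eq ?_
    rw [mul_assoc, ← Real.exp_add]
    ring_nf
  have hc := continuous_anisoNorm (d := d) hν hμ
  have hI : Integrable fun z => ‖funSTFT ψ g z‖ * Real.exp (A * anisoNorm ν μ z) := by
    refine integrable_of_norm_le_exp_anisoNorm (M := M) hν hμ
      (by fun_prop : Continuous _).aestronglyMeasurable fun z => ?_
    rw [Real.norm_of_nonneg (by positivity)]
    exact hle z
  have hV : Integrable (funSTFT ψ g) := by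
    refine hI.mono' hVc.aestronglyMeasurable (Filter.Eventually.of_forall fun z => ?_)
    have := anisoNorm_nonneg ν μ z
    exact le_mul_of_one_le_right (norm_nonneg _) (Real.one_le_exp (by positivity))
  have hb := boundedBy_of_funSTFT ψ g hψ0 (H' ψ M' hψ.1 hM') hV hI
  intro x α β
  refine (hb x α β).trans (mul_le_mul_of_nonneg_right ?_ (weight_pos ν μ hh α β).le)
  rw [← hN, mul_assoc N J M]
  refine mul_le_mul_of_nonneg_left ?_ hN0
  rw [mul_comm J, hJ, ← integral_const_mul]
  exact integral_mono hI (hJi.const_mul M) hle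

theorem boundedBy_zero {ν μ h M : ℝ} (hh : 0 < h) (hM : 0 ≤ M) :
    BoundedBy ν μ h (0 : Rd d → ℂ) M := fun x α β => by
  have h0 : multiD β (0 : Rd d → ℂ) = 0 := by
    have := listD_smul (List.finRange d) β 0 (f := (0 : Rd d → ℂ)) contDiff_const
    simpa [multiD] using this
  rw [h0]
  simpa using mul_nonneg hM (weight_pos ν μ hh α β).le

/-- Phase multipliers of order `m` are bounded on the Gelfand–Shilov space. -/
theorem exists_boundedBy_phaseMultiplier (hd : 0 < d) {μ ν h : ℝ} (hμ : 0 < μ) (hν : 1 < ν)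
    (hh : 0 < h) {m : ℕ} (hm : 2 ≤ m) (hνμ : μ * ((m : ℝ) - 1) ≤ ν) (ρ : Fin d → Polynomial ℝ)
    (hρ : ∀ j, (ρ j).natDegree ≤ m) : ∃ h' C : ℝ, 0 < h' ∧ 0 ≤ C ∧
      ∀ (f : 𝓢(Rd d, ℂ)) (M : ℝ), Mem ν μ f → BoundedBy ν μ h' f M →
        BoundedBy ν μ h (phaseMultiplier ρ f) (C * M) := by
  -- The argument needs a nonzero window; if there is none, the space is trivial and so is the
  -- claim.
  by_cases hE : ∃ ψ : 𝓢(Rd d, ℂ), Mem ν μ ψ ∧ ψ ≠ 0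
  · obtain ⟨ψ, hψ, hψ0⟩ := hE
    obtain ⟨r, C, hr, hC, H⟩ :=
      exists_boundedBy_of_norm_funSTFT_le (zero_lt_one.trans hν) hμ hh ψ hψ hψ0
    obtain ⟨B, hB, HB⟩ := exists_norm_phase_increment_le ρ hm hρ
    obtain ⟨h', C', hh', hC', H'⟩ :=
      exists_norm_funSTFT_phaseMultiplier_le hd hμ hν hB hr hm hνμ ψ hψ
    refine ⟨h', C * (C' * Real.exp (0 ^ μ⁻¹)), hh', by positivity, fun f M _ hf => ?_⟩
    have := H (phaseMultiplier ρ f) (C' * M * Real.exp (0 ^ μ⁻¹)) (H' f M hf ρ 0 le_rfl HB)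
    convert this using 1
    ring
  · push Not at hE
    refine ⟨1, 0, one_pos, le_rfl, fun f M hf _ => ?_⟩
    rw [hE f hf, map_zero, zero_mul]
    exact boundedBy_zero hh le_rfl

end GS

end

/-! ### The solution operator on Schwartz functions: adjoint, inverse, leading coefficients -/

noncomputable section

namespace GS

variable {d : ℕ}

theorem conj_phaseSymbol_neg (ρ : Fin d → Polynomial ℝ) (η : Rd d) :
    conj (phaseSymbol (-ρ) η) = phaseSymbol ρ η := by
  simp only [phaseSymbol, ← exp_conj, map_mul, conj_I, Pi.neg_apply, Polynomial.eval_neg,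
    Finset.sum_neg_distrib, ofReal_neg, map_neg, conj_ofReal, neg_mul_neg]

theorem phaseSymbol_neg_mul (ρ : Fin d → Polynomial ℝ) (η : Rd d) :
    phaseSymbol (-ρ) η * phaseSymbol ρ η = 1 := by
  simp only [phaseSymbol, ← exp_add, Pi.neg_apply, Polynomial.eval_neg, Finset.sum_neg_distrib,
    ofReal_neg, mul_neg, neg_add_cancel, exp_zero]

theorem linPhase_neg (η : Rd d) : linPhase (-η) = -linPhase η := by
  funext j
  simp [linPhase]

theorem phaseMul_neg_phaseMul (ρ : Fin d → Polynomial ℝ) (f : 𝓢(Rd d, ℂ)) :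
    phaseMul (-ρ) (phaseMul ρ f) = f := by
  ext x
  rw [phaseMul_apply, phaseMul_apply, ← mul_assoc, phaseSymbol_neg_mul, one_mul]

theorem phaseMultiplier_neg_phaseMultiplier (ρ : Fin d → Polynomial ℝ) (f : 𝓢(Rd d, ℂ)) :
    phaseMultiplier (-ρ) (phaseMultiplier ρ f) = f := by
  rw [phaseMultiplier_eq, fourier_phaseMultiplier, phaseMul_neg_phaseMul,
    FourierTransform.fourierInv_fourier_eq]

theorem integral_phaseMul_mul_conj (ρ : Fin d → Polynomial ℝ) (f g : 𝓢(Rd d, ℂ)) :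
    ∫ x, phaseMul ρ f x * conj (g x) = ∫ x, f x * conj (phaseMul (-ρ) g x) := by
  simp only [phaseMul_apply, map_mul, conj_phaseSymbol_neg]
  congr 1
  funext x
  ring

theorem integral_phaseMultiplier_mul_conj (ρ : Fin d → Polynomial ℝ) (f g : 𝓢(Rd d, ℂ)) :
    ∫ x, phaseMultiplier ρ f x * conj (g x) = ∫ x, f x * conj (phaseMultiplier (-ρ) g x) := by
  rw [← integral_mul_conj_fourier, ← integral_mul_conj_fourier f, fourier_phaseMultiplier,
    fourier_phaseMultiplier, integral_phaseMul_mul_conj]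

theorem phaseMul_linPhase_eq_schwartzShift (η : Rd d) (f : 𝓢(Rd d, ℂ)) :
    phaseMul (linPhase η) f = schwartzShift (0, η) f := by
  ext x
  simp [schwartzShift, phaseMul_apply]

theorem schwartz_ext_fourier {f g : 𝓢(Rd d, ℂ)} (h : ∀ ξ, 𝓕 f ξ = 𝓕 g ξ) : f = g := by
  have : 𝓕 f = 𝓕 g := by
    ext ξ
    exact h ξ
  have h1 : 𝓕⁻ (𝓕 f) = 𝓕⁻ (𝓕 g) := by rw [this]
  rwa [FourierTransform.fourierInv_fourier_eq, FourierTransform.fourierInv_fourier_eq] at h1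

/-- Taylor coefficients are values of Hasse derivatives; from the degree of `Q` on these are
constant, so the top coefficients cancel. -/
theorem natDegree_taylor_sub_le (Q : Polynomial ℝ) {m : ℕ} (hQ : Q.natDegree ≤ m + 1) (r : ℝ) :
    (Polynomial.taylor r Q - Q).natDegree ≤ m := by
  rw [Polynomial.natDegree_le_iff_coeff_eq_zero]
  intro N hN
  rw [Polynomial.coeff_sub, Polynomial.taylor_coeff]
  have h1 : (Polynomial.hasseDeriv N Q).natDegree < 1 :=
    (Polynomial.natDegree_hasseDeriv_le Q N).trans_lt (by omega)
  rw [Polynomial.eval_eq_sum_range' h1]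
  simp [Polynomial.hasseDeriv_coeff]

theorem coeff_taylor_sub (Q : Polynomial ℝ) {m : ℕ} (hQ : Q.natDegree ≤ m + 1) (r : ℝ) :
    (Polynomial.taylor r Q - Q).coeff m = r * (Polynomial.derivative Q).coeff m := by
  rw [Polynomial.coeff_sub, Polynomial.taylor_coeff]
  have h1 : (Polynomial.hasseDeriv m Q).natDegree < 2 :=
    (Polynomial.natDegree_hasseDeriv_le Q m).trans_lt (by omega)
  rw [Polynomial.eval_eq_sum_range' h1, Polynomial.coeff_derivative]
  simp [Polynomial.hasseDeriv_coeff, Finset.sum_range_succ, add_comm 1 m]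
  ring

theorem natDegree_le_of_natDegree_derivative_le {Q : Polynomial ℝ} {m : ℕ}
    (hQ : (Polynomial.derivative Q).natDegree ≤ m) : Q.natDegree ≤ m + 1 := by
  rw [Polynomial.natDegree_le_iff_coeff_eq_zero]
  intro N hN
  obtain ⟨k, rfl⟩ : ∃ k, N = k + 1 := ⟨N - 1, by omega⟩
  have h1 := Polynomial.natDegree_le_iff_coeff_eq_zero.1 hQ k (by omega)
  rw [Polynomial.coeff_derivative] at h1
  have h2 : (k : ℝ) + 1 ≠ 0 := by positivity
  exact (mul_eq_zero.1 h1).resolve_right h2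

end GS

namespace Airy

open GS

variable {d : ℕ}

/-- The summands of the phase `φ_t`, as polynomials. -/
def phasePoly (q : Fin d → Polynomial ℝ) (v : Rd d) (t : ℝ) (j : Fin d) : Polynomial ℝ :=
  Polynomial.C (v j)⁻¹ * (Polynomial.taylor (-(t * v j)) (q j) - q j)

theorem phase_eq_sum (q : Fin d → Polynomial ℝ) (v : Rd d) (t : ℝ) (ξ : Rd d) :
    phase q v t ξ = ∑ j, (phasePoly q v t j).eval (ξ j) := by
  simp [phase, phasePoly, Polynomial.taylor_eval, sub_eq_add_neg]

theorem natDegree_phasePoly_le (q : Fin d → Polynomial ℝ) (v : Rd d) (t : ℝ) {m : ℕ} {j : Fin d}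
    (hq : (Polynomial.derivative (q j)).natDegree ≤ m) : (phasePoly q v t j).natDegree ≤ m :=
  (Polynomial.natDegree_C_mul_le _ _).trans
    (natDegree_taylor_sub_le _ (natDegree_le_of_natDegree_derivative_le hq) _)

/-- The factor `v_j⁻¹` cancels the step `-t v_j`. Hence the degree `m` part of `φ_t` is `-t P_m`,
and `v` leaves no trace in it. -/
theorem coeff_phasePoly (q : Fin d → Polynomial ℝ) {v : Rd d} (t : ℝ) {m : ℕ} {j : Fin d}
    (hv : v j ≠ 0) (hq : (Polynomial.derivative (q j)).natDegree ≤ m) :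
    (phasePoly q v t j).coeff m = -t * (Polynomial.derivative (q j)).coeff m := by
  rw [phasePoly, Polynomial.coeff_C_mul,
    coeff_taylor_sub _ (natDegree_le_of_natDegree_derivative_le hq)]
  field_simp

/-- The phase `φ_t(2π ·)`. -/
def scaledPhase (q : Fin d → Polynomial ℝ) (v : Rd d) (t : ℝ) (j : Fin d) : Polynomial ℝ :=
  (phasePoly q v t j).comp (Polynomial.C (2 * Real.pi) * Polynomial.X)

theorem natDegree_scaledPhase_le (q : Fin d → Polynomial ℝ) (v : Rd d) (t : ℝ) {m : ℕ} {j : Fin d}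
    (hq : (Polynomial.derivative (q j)).natDegree ≤ m) : (scaledPhase q v t j).natDegree ≤ m := by
  refine Polynomial.natDegree_comp_le.trans ?_
  calc _ ≤ m * 1 := Nat.mul_le_mul (natDegree_phasePoly_le q v t hq)
        ((Polynomial.natDegree_C_mul_le _ _).trans Polynomial.natDegree_X_le)
    _ = m := mul_one m

theorem phaseSymbol_scaledPhase (q : Fin d → Polynomial ℝ) (v : Rd d) (t : ℝ) (η : Rd d) :
    phaseSymbol (scaledPhase q v t) η = exp (I * (phase q v t ((2 * Real.pi) • η) : ℂ)) := by
  rw [phase_eq_sum]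
  simp [phaseSymbol, scaledPhase, Polynomial.eval_comp]

theorem phase_neg_sub (q : Fin d → Polynomial ℝ) (v : Rd d) (t : ℝ) (ξ : Rd d) :
    phase q v (-t) (ξ - t • v) = -phase q v t ξ := by
  simp only [phase, ← Finset.sum_neg_distrib]
  refine Finset.sum_congr rfl fun j _ => ?_
  simp only [PiLp.sub_apply, PiLp.smul_apply, smul_eq_mul]
  ring_nf

/-- The solution operator on the Schwartz space. -/
def schwartzPropagator (q : Fin d → Polynomial ℝ) (v : Rd d) (t : ℝ) :
    𝓢(Rd d, ℂ) →L[ℂ] 𝓢(Rd d, ℂ) :=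
  (phaseMul (linPhase (-t • v))).comp (phaseMultiplier (scaledPhase q v t))

theorem schwartzPropagator_apply (q : Fin d → Polynomial ℝ) (v : Rd d) (t : ℝ) (f : 𝓢(Rd d, ℂ)) :
    schwartzPropagator q v t f =
      phaseMul (linPhase (-t • v)) (phaseMultiplier (scaledPhase q v t) f) := rfl

theorem fourier_eq (f : 𝓢(Rd d, ℂ)) (ξ : Rd d) : fourier f ξ =
    (((2 * Real.pi) ^ (-(d : ℝ) / 2) : ℝ) : ℂ) * 𝓕 f ((2 * Real.pi)⁻¹ • ξ) := by
  rw [fourier, fourier_apply_eq_integral]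
  congr 2
  funext x
  rw [mul_comm (f x), inner_smul_right]
  congr 2
  push_cast
  have : (2 * Real.pi : ℂ) ≠ 0 := by exact_mod_cast (by positivity : (2 * Real.pi : ℝ) ≠ 0)
  field_simp

theorem coe_schwartzPropagator (q : Fin d → Polynomial ℝ) (v : Rd d) (t : ℝ) (f : 𝓢(Rd d, ℂ)) :
    (schwartzPropagator q v t f : Rd d → ℂ) = propagator q v t f := by
  funext x
  have hpi : (0 : ℝ) < 2 * Real.pi := by positivity
  rw [schwartzPropagator_apply, phaseMul_apply, phaseSymbol_linPhase, propagator, modulate]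
  congr 1
  rw [phaseMultiplier_eq, fourierInv_apply_eq_integral, fourierInv]
  set c : ℝ := (2 * Real.pi) ^ (-(d : ℝ) / 2) with hc
  set F : Rd d → ℂ := fun ξ => exp (I * (phase q v t ξ : ℂ)) * fourier f ξ *
    exp (I * ((inner ℝ x ξ : ℝ) : ℂ)) with hF
  have h1 := Measure.integral_comp_smul_of_nonneg (μ := (volume : Measure (Rd d))) F (2 * Real.pi)
    (hR := hpi.le)
  have h2 : ∀ η, F ((2 * Real.pi) • η) = (c : ℂ) *
      (exp (I * ((2 * Real.pi * inner ℝ x η : ℝ) : ℂ)) *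
        phaseMul (scaledPhase q v t) (𝓕 f) η) := fun η => by
    rw [hF, phaseMul_apply, phaseSymbol_scaledPhase]
    simp only [fourier_eq, smul_smul, inv_mul_cancel₀ hpi.ne', one_smul, inner_smul_right]
    ring
  simp only [h2, integral_const_mul] at h1
  have hc0 : (c : ℂ) ≠ 0 := by
    have : 0 < c := by positivity
    exact_mod_cast this.ne'
  -- The two symmetric normalizations `(2π)^{-d/2}` compensate the Jacobian of the change of
  -- variables by `2π`.
  have hcc : c * c * (2 * Real.pi) ^ d = 1 := by
    rw [hc, ← Real.rpow_natCast, ← Real.rpow_add hpi, ← Real.rpow_add hpi]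
    ring_nf
    simp
  have h3 : ((2 * Real.pi) ^ d)⁻¹ = c * c := by
    have : (2 * Real.pi) ^ d ≠ 0 := by positivity
    field_simp
    linarith
  rw [finrank_euclideanSpace_fin, h3] at h1
  refine mul_left_cancel₀ hc0 (h1.trans ?_)
  rw [Complex.real_smul]
  push_cast
  ring

/-- Modulation by `tv` translates the frequency, and `φ_{-t}(ξ - tv) = -φ_t(ξ)`. Thus `𝒦_{-t}`
equals the multiplier `e^{-iφ_t}` after `M_{tv}`, which is visibly the inverse and the adjoint of
`𝒦_t`. -/
theorem phaseMultiplier_neg_phaseMul_linPhase (q : Fin d → Polynomial ℝ) (v : Rd d) (t : ℝ)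
    (g : 𝓢(Rd d, ℂ)) :
    phaseMultiplier (-scaledPhase q v t) (phaseMul (linPhase (t • v)) g) =
      phaseMul (linPhase (t • v)) (phaseMultiplier (scaledPhase q v (-t)) g) := by
  refine schwartz_ext_fourier fun ξ => ?_
  have hpi : (2 * Real.pi : ℝ) ≠ 0 := by positivity
  rw [fourier_phaseMultiplier, phaseMul_apply, phaseMul_linPhase_eq_schwartzShift,
    phaseMul_linPhase_eq_schwartzShift, fourier_schwartzShift, fourier_schwartzShift,
    fourier_phaseMultiplier, phaseMul_apply, phaseSymbol_scaledPhase]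
  have h1 : phaseSymbol (-scaledPhase q v t) ξ =
      exp (I * (phase q v (-t) ((2 * Real.pi) • (ξ - (2 * Real.pi)⁻¹ • t • v)) : ℂ)) := by
    rw [smul_sub, smul_smul _ _ (t • v), mul_inv_cancel₀ hpi, one_smul, phase_neg_sub,
      ← conj_phaseSymbol_neg, neg_neg, phaseSymbol_scaledPhase, ← exp_conj]
    simp
  rw [h1]
  ring

theorem schwartzPropagator_neg_eq (q : Fin d → Polynomial ℝ) (v : Rd d) (t : ℝ) (f : 𝓢(Rd d, ℂ)) :
    schwartzPropagator q v (-t) f =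
      phaseMultiplier (-scaledPhase q v t) (phaseMul (linPhase (t • v)) f) := by
  rw [schwartzPropagator_apply, phaseMultiplier_neg_phaseMul_linPhase, neg_neg]

theorem schwartzPropagator_neg_schwartzPropagator (q : Fin d → Polynomial ℝ) (v : Rd d) (t : ℝ)
    (f : 𝓢(Rd d, ℂ)) : schwartzPropagator q v (-t) (schwartzPropagator q v t f) = f := by
  have h1 : linPhase (t • v) = -linPhase (-t • v) := by rw [← linPhase_neg, neg_smul, neg_neg]
  rw [schwartzPropagator_neg_eq, schwartzPropagator_apply, h1, phaseMul_neg_phaseMul,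
    phaseMultiplier_neg_phaseMultiplier]

theorem integral_schwartzPropagator_mul_conj (q : Fin d → Polynomial ℝ) (v : Rd d) (t : ℝ)
    (f g : 𝓢(Rd d, ℂ)) : ∫ x, schwartzPropagator q v t f x * conj (g x) =
      ∫ x, f x * conj (schwartzPropagator q v (-t) g x) := by
  have h1 : linPhase (t • v) = -linPhase (-t • v) := by rw [← linPhase_neg, neg_smul, neg_neg]
  rw [schwartzPropagator_neg_eq, schwartzPropagator_apply, integral_phaseMul_mul_conj,
    integral_phaseMultiplier_mul_conj, h1]

theorem exists_boundedBy_schwartzPropagator (hd : 0 < d) {μ ν h : ℝ} (hμ : 0 < μ) (hν : 1 < ν)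
    (hh : 0 < h) {m : ℕ} (hm : 2 ≤ m) (hνμ : μ * ((m : ℝ) - 1) ≤ ν) (q : Fin d → Polynomial ℝ)
    (hq : ∀ j, (Polynomial.derivative (q j)).natDegree ≤ m) (v : Rd d) (t : ℝ) :
    ∃ h' C : ℝ, 0 < h' ∧ 0 ≤ C ∧
      ∀ (f : 𝓢(Rd d, ℂ)) (M : ℝ), Mem ν μ f → BoundedBy ν μ h' f M →
        BoundedBy ν μ h (schwartzPropagator q v t f) (C * M) := by
  obtain ⟨h₁, C₁, A, hh₁, hC₁, hA, H₁⟩ :=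
    exists_boundedBy_tfShift (d := d) (zero_lt_one.trans hν) hμ hh
  obtain ⟨h₂, C₂, hh₂, hC₂, H₂⟩ := exists_boundedBy_phaseMultiplier hd hμ hν hh₁ hm hνμ
    (scaledPhase q v t) (fun j => natDegree_scaledPhase_le q v t (hq j))
  refine ⟨h₂, C₁ * C₂ * Real.exp (A * anisoNorm ν μ ((0 : Rd d), -t • v)), hh₂, by positivity,
    fun f M hf hM => ?_⟩
  have h3 := H₁ _ _ (SchwartzMap.smooth _ ⊤) (H₂ f M hf hM) (0, -t • v)
  rw [← coe_schwartzShift, ← phaseMul_linPhase_eq_schwartzShift, ← schwartzPropagator_apply] at h3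
  convert h3 using 1
  ring

end Airy

end

/-! ### Restriction to the Gelfand–Shilov space and uniqueness on the dual -/

noncomputable section

namespace GelfandShilov

open GS

variable {d : ℕ} {ν μ : ℝ}

theorem mem_of_bounded {T : 𝓢(Rd d, ℂ) →L[ℂ] 𝓢(Rd d, ℂ)}
    (hT : ∀ h : ℝ, 0 < h → ∃ h' C : ℝ, 0 < h' ∧ 0 ≤ C ∧ ∀ (f : 𝓢(Rd d, ℂ)) (M : ℝ), Mem ν μ f →
      BoundedBy ν μ h' f M → BoundedBy ν μ h (T f) (C * M)) {f : 𝓢(Rd d, ℂ)} (hf : Mem ν μ f) :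
    Mem ν μ (T f) := by
  refine mem_of_boundedBy (SchwartzMap.smooth _ ⊤) fun h hh => ?_
  obtain ⟨h', C, hh', -, H⟩ := hT h hh
  obtain ⟨M, hM⟩ := hf.exists_boundedBy hh'
  exact ⟨_, H f M hf hM⟩

/-- An operator on the Schwartz space that preserves the Gelfand–Shilov space, as a linear map on
that space. -/
def restrictLM (hν : 0 < ν) (T : 𝓢(Rd d, ℂ) →L[ℂ] 𝓢(Rd d, ℂ))
    (hT : ∀ f : 𝓢(Rd d, ℂ), Mem ν μ f → Mem ν μ (T f)) :
    GelfandShilov d ν μ →ₗ[ℂ] GelfandShilov d ν μ where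
  toFun f := ⟨T (f.toSchwartz hν), hT _ f.mem⟩
  map_add' f g := by
    refine Subtype.ext ?_
    change (T (f.toSchwartz hν + g.toSchwartz hν) : Rd d → ℂ) = _
    rw [map_add]
    rfl
  map_smul' c f := by
    refine Subtype.ext ?_
    change (T (c • f.toSchwartz hν) : Rd d → ℂ) = _
    rw [map_smul]
    rfl

/-- An operator on the Schwartz space that is bounded for the norms of the Gelfand–Shilov space,
as an operator on that space. -/
def restrictCLM (hν : 0 < ν) (T : 𝓢(Rd d, ℂ) →L[ℂ] 𝓢(Rd d, ℂ))
    (hT : ∀ h : ℝ, 0 < h → ∃ h' C : ℝ, 0 < h' ∧ 0 ≤ C ∧ ∀ (f : 𝓢(Rd d, ℂ)) (M : ℝ), Mem ν μ f →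
      BoundedBy ν μ h' f M → BoundedBy ν μ h (T f) (C * M)) :
    GelfandShilov d ν μ →L[ℂ] GelfandShilov d ν μ where
  toLinearMap := restrictLM hν T fun _ hf => mem_of_bounded hT hf
  cont := by
    refine WithSeminorms.continuous_of_isBounded withSeminorms withSeminorms
      (restrictLM hν T fun _ hf => mem_of_bounded hT hf) (Seminorm.IsBounded.of_real fun h => ?_)
    obtain ⟨h', C, hh', -, H⟩ := hT h h.2
    refine ⟨{⟨h', hh'⟩}, C, fun f => ?_⟩
    rw [Finset.sup_singleton]
    exact seminorm_le (H (f.toSchwartz hν) _ f.mem (boundedBy_seminorm ⟨h', hh'⟩ f))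

theorem eq_zero_of_toDual_apply_self (hν : 0 < ν) {φ : GelfandShilov d ν μ}
    (h : φ.toDual φ = 0) : φ = 0 := by
  by_contra hφ
  refine windowMass_ne_zero (φ.toSchwartz hν) (toSchwartz_ne_zero hν hφ) (Eq.trans ?_ h)
  rw [toDual, ofIntegrable_apply, windowMass]
  refine integral_congr_ae (Filter.Eventually.of_forall fun x => ?_)
  exact mul_comm _ _

/-- A weak* continuous functional on the dual of `Σ_ν^μ` is the evaluation at an element. -/
theorem exists_eval_eq (Λ : Dual d ν μ →L[ℂ] ℂ) : ∃ φ : GelfandShilov d ν μ, ∀ u, Λ u = u φ := by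
  obtain ⟨s, C, -, hC⟩ := Seminorm.bound_of_continuous
    (PointwiseConvergenceCLM.withSeminorms (σ := starRingEnd ℂ) (E := GelfandShilov d ν μ) (F := ℂ))
    ((normSeminorm ℂ ℂ).comp Λ.toLinearMap) Λ.continuous.norm
  let ev : s → Dual d ν μ →ₗ[ℂ] ℂ := fun φ =>
    (PointwiseConvergenceCLM.evalCLM (starRingEnd ℂ) ℂ (φ : GelfandShilov d ν μ)).toLinearMap
  have hev : ∀ φ u, ev φ u = u φ := fun φ u => rfl
  -- Continuity involves only finitely many evaluations. A functional that vanishes on their common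
  -- kernel is a combination of them.
  have hker : ⨅ i, LinearMap.ker (ev i) ≤ LinearMap.ker Λ.toLinearMap := fun u hu => by
    simp only [Submodule.mem_iInf, LinearMap.mem_ker] at hu
    have h1 := hC u
    rw [smul_apply] at h1
    have h2 : (s.sup (PointwiseConvergenceCLM.seminormFamily (starRingEnd ℂ)
        (GelfandShilov d ν μ) ℂ)) u ≤ 0 :=
      Seminorm.finset_sup_apply_le le_rfl fun φ hφ => by
        change ‖u φ‖ ≤ 0
        rw [← hev ⟨φ, hφ⟩ u, hu, norm_zero]
    have h3 : ‖Λ u‖ ≤ 0 := h1.trans (mul_nonpos_of_nonneg_of_nonpos C.2 h2)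
    exact norm_le_zero_iff.1 h3
  have hmem := mem_span_of_iInf_ker_le_ker hker
  obtain ⟨c, hc⟩ := (Submodule.mem_span_range_iff_exists_fun ℂ).1 hmem
  -- The coefficients are conjugated because `u` is conjugate linear.
  refine ⟨∑ i, conj (c i) • (i : GelfandShilov d ν μ), fun u => ?_⟩
  have h4 : Λ u = ∑ i, c i * u i := by
    have := LinearMap.congr_fun hc u
    simp only [LinearMap.sum_apply, LinearMap.smul_apply, hev, smul_eq_mul] at this
    exact this.symm
  rw [h4, map_sum]
  refine Finset.sum_congr rfl fun i _ => ?_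
  rw [Dual.map_smul, conj_conj]

/-- Operators on the dual of `Σ_ν^μ` are determined by their values on `Σ_ν^μ`. -/
theorem eq_of_eq_on_toDual (hν : 0 < ν) {L L' : Dual d ν μ →L[ℂ] Dual d ν μ}
    (h : ∀ f : GelfandShilov d ν μ, L f.toDual = L' f.toDual) : L = L' := by
  refine ContinuousLinearMap.ext fun u => ?_
  refine DFunLike.ext _ _ fun φ => ?_
  -- The functional `u ↦ ((L - L')u, φ)` is evaluation at some `χ`. Applied to `u = χ`, where `L`
  -- and `L'` agree, it gives `∫ |χ|² = 0`.
  obtain ⟨χ, hχ⟩ := exists_eval_eq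
    ((PointwiseConvergenceCLM.evalCLM (starRingEnd ℂ) ℂ φ).comp (L - L'))
  have hval : ∀ w : Dual d ν μ, w χ = L w φ - L' w φ := fun w => (hχ w).symm
  have hχ0 : χ = 0 := by
    refine eq_zero_of_toDual_apply_self hν ?_
    rw [hval, h, sub_self]
  have := hval u
  rw [hχ0, map_zero] at this
  exact (sub_eq_zero.1 this.symm)

end GelfandShilov

end

/-! ### Transport of time-frequency shifts and anisotropic dilations -/

noncomputable section

namespace GS

open Filter Topology

variable {d : ℕ}

/-- The gradient of `∑_j a_j(ξ_j)`. -/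
def phaseGrad (a : Fin d → Polynomial ℝ) (ξ : Rd d) : Rd d :=
  WithLp.toLp 2 fun j => (Polynomial.derivative (a j)).eval (ξ j)

theorem phaseGrad_apply (a : Fin d → Polynomial ℝ) (ξ : Rd d) (j : Fin d) :
    phaseGrad a ξ j = (Polynomial.derivative (a j)).eval (ξ j) := rfl

/-- A phase multiplier transports time-frequency shifts along the gradient of its phase. -/
theorem phaseMultiplier_schwartzShift (a : Fin d → Polynomial ℝ) (z : Rd d × Rd d)
    (φ : 𝓢(Rd d, ℂ)) :
    phaseMultiplier (fun j => (a j).comp (Polynomial.C (2 * Real.pi) * Polynomial.X))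
        (schwartzShift z φ) = phaseSymbol a z.2 • schwartzShift (z.1 - phaseGrad a z.2, z.2)
      (phaseMultiplier (fun j => taylorRemainder (a j) (z.2 j)) φ) := by
  refine schwartz_ext_fourier fun ξ => ?_
  have hpi : (2 * Real.pi : ℝ) ≠ 0 := by positivity
  rw [FourierTransform.fourier_smul]
  rw [fourier_phaseMultiplier, phaseMul_apply, fourier_schwartzShift, smul_apply,
    fourier_schwartzShift, fourier_phaseMultiplier, phaseMul_apply, smul_eq_mul]
  -- The expansion of the phase at `z.2` has increment `2πζ`: its linear term alters the
  -- translation, and the remainder is a multiplier in `ζ`.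
  set ζ := ξ - (2 * Real.pi)⁻¹ • z.2 with hζ
  have h1 : ∀ j, z.2 j + 2 * Real.pi * ζ j = 2 * Real.pi * ξ j := fun j => by
    rw [hζ]
    simp only [PiLp.sub_apply, PiLp.smul_apply, smul_eq_mul]
    field_simp
    ring
  simp only [← mul_assoc]
  congr 1
  simp only [phaseSymbol, ← exp_add, ← mul_add, ← ofReal_add]
  congr 3
  simp only [inner_sub_left, eval_taylorRemainder, h1, Polynomial.eval_comp, Polynomial.eval_mul,
    Polynomial.eval_C, Polynomial.eval_X, Finset.sum_sub_distrib]
  have h2 : (inner ℝ (phaseGrad a z.2) ζ : ℝ) =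
      ∑ j, (Polynomial.derivative (a j)).eval (z.2 j) * ζ j := by
    simp [PiLp.inner_apply, phaseGrad_apply, mul_comm]
  have h3 : ∑ j, (Polynomial.derivative (a j)).eval (z.2 j) * (2 * Real.pi * ζ j) =
      2 * Real.pi * ∑ j, (Polynomial.derivative (a j)).eval (z.2 j) * ζ j := by
    rw [Finset.mul_sum]
    exact Finset.sum_congr rfl fun j _ => by ring
  rw [h2, h3]
  ring

theorem phaseMul_linPhase_schwartzShift (η : Rd d) (z : Rd d × Rd d) (φ : 𝓢(Rd d, ℂ)) :
    phaseMul (linPhase η) (schwartzShift z φ) = schwartzShift (z.1, z.2 + η) φ := by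
  ext x
  rw [phaseMul_apply, phaseSymbol_linPhase, coe_schwartzShift, coe_schwartzShift, tfShift_apply,
    tfShift_apply, ← mul_assoc, ← exp_add, inner_add_right]
  push_cast
  ring_nf

theorem funSTFT_tfShift (ψ g : Rd d → ℂ) (w z : Rd d × Rd d) :
    funSTFT ψ (tfShift w g) z =
      exp (I * ((inner ℝ w.1 (w.2 - z.2) : ℝ) : ℂ)) * funSTFT ψ g (z - w) := by
  unfold funSTFT
  rw [← integral_const_mul, ← integral_add_right_eq_self _ w.1]
  congr 1
  funext x
  simp only [tfShift_apply, map_mul, ← exp_conj, conj_I, conj_ofReal, Prod.fst_sub, Prod.snd_sub,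
    add_sub_cancel_right]
  have e : x + w.1 - z.1 = x - (z.1 - w.1) := by abel
  rw [e]
  have h : exp (I * ((inner ℝ (x + w.1) w.2 : ℝ) : ℂ)) *
      exp (-I * ((inner ℝ (x + w.1) z.2 : ℝ) : ℂ)) =
      exp (I * ((inner ℝ w.1 (w.2 - z.2) : ℝ) : ℂ)) *
        exp (-I * ((inner ℝ x (z.2 - w.2) : ℝ) : ℂ)) := by
    rw [← exp_add, ← exp_add]
    congr 1
    simp only [inner_add_left, inner_sub_right]
    push_cast
    ring
  linear_combination (g x * conj (ψ (x - (z.1 - w.1)))) * h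

theorem norm_funSTFT_tfShift (ψ g : Rd d → ℂ) (w z : Rd d × Rd d) :
    ‖funSTFT ψ (tfShift w g) z‖ = ‖funSTFT ψ g (z - w)‖ := by
  rw [funSTFT_tfShift, norm_mul, mul_comm I, norm_exp_ofReal_mul_I, one_mul]

/-- The anisotropic dilation `(x, ξ) ↦ (s^ν x, s^μ ξ)`. -/
def dilate (ν μ s : ℝ) (z : Rd d × Rd d) : Rd d × Rd d := (s ^ ν • z.1, s ^ μ • z.2)

theorem rootNorm_rpow_smul {ν s : ℝ} (hν : 0 < ν) (hs : 0 < s) (x : Rd d) :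
    rootNorm ν (s ^ ν • x) = s * rootNorm ν x := by
  rw [rootNorm_smul, abs_of_pos (by positivity), Real.rpow_rpow_inv hs.le hν.ne']

theorem anisoNorm_dilate {ν μ s : ℝ} (hν : 0 < ν) (hμ : 0 < μ) (hs : 0 < s) (z : Rd d × Rd d) :
    anisoNorm ν μ (dilate ν μ s z) = s * anisoNorm ν μ z := by
  simp only [anisoNorm, dilate, rootNorm_rpow_smul hν hs, rootNorm_rpow_smul hμ hs]
  ring

theorem dilate_add (ν μ s : ℝ) (z w : Rd d × Rd d) :
    dilate ν μ s (z + w) = dilate ν μ s z + dilate ν μ s w := by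
  simp [dilate, smul_add]

theorem dilate_dilate_inv (ν μ : ℝ) {s : ℝ} (hs : 0 < s) (z : Rd d × Rd d) :
    dilate ν μ s (dilate ν μ s⁻¹ z) = z := by
  have h : ∀ r : ℝ, s ^ r * s⁻¹ ^ r = 1 := fun r => by
    rw [← Real.mul_rpow hs.le (by positivity), mul_inv_cancel₀ hs.ne', Real.one_rpow]
  simp [dilate, smul_smul, h]

theorem norm_lt_of_rootNorm_lt {s ε : ℝ} (hs : 0 < s) (hε : 0 < ε) {x : Rd d}
    (h : rootNorm s x < ε ^ s⁻¹) : ‖x‖ < ε :=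
  (Real.rpow_lt_rpow_iff (norm_nonneg x) hε.le (inv_pos.2 hs)).1 h

theorem exists_anisoNorm_lt_imp_norm_lt {ν μ ε : ℝ} (hν : 0 < ν) (hμ : 0 < μ) (hε : 0 < ε) :
    ∃ δ : ℝ, 0 < δ ∧ ∀ z : Rd d × Rd d, anisoNorm ν μ z < δ → ‖z‖ < ε := by
  refine ⟨min (ε ^ ν⁻¹) (ε ^ μ⁻¹), by positivity, fun z hz => ?_⟩
  have h1 := rootNorm_nonneg ν z.1
  have h2 := rootNorm_nonneg μ z.2
  unfold anisoNorm at hz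
  refine max_lt (norm_lt_of_rootNorm_lt hν hε ?_) (norm_lt_of_rootNorm_lt hμ hε ?_)
  · have := min_le_left (ε ^ ν⁻¹) (ε ^ μ⁻¹)
    linarith
  · have := min_le_right (ε ^ ν⁻¹) (ε ^ μ⁻¹)
    linarith

/-- Decay of `N` along the dilates of an open set survives convolution with kernels that decay
fast enough. -/
theorem exists_mem_nhds_convolution_decay {ν μ C₀ a : ℝ} (hν : 0 < ν) (hμ : 0 < μ) (hC₀ : 0 ≤ C₀)
    (ha : 0 ≤ a) {N : Rd d × Rd d → ℝ} (hN : ∀ z, N z ≤ C₀ * Real.exp (a * anisoNorm ν μ z))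
    {U : Set (Rd d × Rd d)} (hU : IsOpen U) {z₀ : Rd d × Rd d} (hz₀ : z₀ ∈ U)
    (hdec : ∀ r : ℝ, 0 < r → ∃ C : ℝ, ∀ s : ℝ, 0 < s → ∀ w ∈ U,
      N (dilate ν μ s w) ≤ C * Real.exp (-(r * s))) :
    ∃ V ∈ 𝓝 z₀, ∀ r R : ℝ, 0 < r → 0 ≤ R → ∃ k C : ℝ, 0 ≤ k ∧ 0 ≤ C ∧ ∀ s : ℝ, 0 < s → ∀ w ∈ V,
      ∀ z, Real.exp (R * s) * Real.exp (-(k * anisoNorm ν μ (z - dilate ν μ s w))) * N z ≤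
        C * Real.exp (-(r * s)) * Real.exp (-anisoNorm ν μ (z - dilate ν μ s w)) := by
  obtain ⟨ε, hε, hball⟩ := Metric.isOpen_iff.1 hU z₀ hz₀
  obtain ⟨δ, hδ, Hδ⟩ := exists_anisoNorm_lt_imp_norm_lt (d := d) hν hμ (half_pos hε)
  set R₁ := anisoNorm ν μ z₀ + 1 with hR₁
  have hR₁0 : 0 ≤ R₁ := by have := anisoNorm_nonneg ν μ z₀; linarith
  refine ⟨Metric.ball z₀ (ε / 2) ∩ {w | anisoNorm ν μ w < R₁}, inter_mem
    (Metric.ball_mem_nhds _ (half_pos hε)) ((continuous_anisoNorm hν hμ).continuousAt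
      (Iio_mem_nhds (by linarith))), fun r R hr hR => ?_⟩
  obtain ⟨C, hC⟩ := hdec (r + R) (by linarith)
  set κ := quasiConst ν μ with hκ
  have hκ1 : 1 ≤ κ := one_le_quasiConst hν hμ
  -- For `g ≥ δs` the rate `E` turns into decay in `s`, paying for `e^{Rs}`, the growth of `N` at
  -- the centre and the desired `e^{-rs}`; `aκ` covers the growth of `N` away from the centre, and
  -- `1` remains for integrability.
  set E := (R + a * κ * R₁ + r) / δ with hE
  have hE0 : 0 ≤ E := by positivity
  refine ⟨a * κ + 1 + E, max C 0 + C₀, by positivity, by positivity, fun s hs w hw z => ?_⟩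
  set g := anisoNorm ν μ (z - dilate ν μ s w) with hg
  have hg0 : 0 ≤ g := anisoNorm_nonneg _ _ _
  -- Near the centre, `z` is the dilate of a point of `U` and the decay of `N` applies. Far away
  -- only the growth bound of `N` is available and the kernel must win.
  rcases lt_or_ge g (δ * s) with hlt | hge
  · have hz : z = dilate ν μ s (w + dilate ν μ s⁻¹ (z - dilate ν μ s w)) := by
      rw [dilate_add, dilate_dilate_inv ν μ hs, add_sub_cancel]
    have hmem : w + dilate ν μ s⁻¹ (z - dilate ν μ s w) ∈ U := by
      refine hball ?_
      have h1 : ‖dilate ν μ s⁻¹ (z - dilate ν μ s w)‖ < ε / 2 := by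
        refine Hδ _ ?_
        rw [anisoNorm_dilate hν hμ (inv_pos.2 hs), ← hg, inv_mul_eq_div, div_lt_iff₀ hs]
        exact hlt
      have h2 : ‖w - z₀‖ < ε / 2 := by simpa [dist_eq_norm] using hw.1
      rw [Metric.mem_ball, dist_eq_norm, add_sub_right_comm]
      exact (norm_add_le _ _).trans_lt (by linarith)
    have hNz : N z ≤ (max C 0 + C₀) * Real.exp (-((r + R) * s)) := by
      rw [hz]
      refine (hC s hs _ hmem).trans (mul_le_mul_of_nonneg_right ?_ (Real.exp_pos _).le)
      linarith [le_max_left C 0]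
    calc Real.exp (R * s) * Real.exp (-((a * κ + 1 + E) * g)) * N z
        ≤ Real.exp (R * s) * Real.exp (-((a * κ + 1 + E) * g)) *
          ((max C 0 + C₀) * Real.exp (-((r + R) * s))) :=
          mul_le_mul_of_nonneg_left hNz (by positivity)
      _ = (max C 0 + C₀) *
          Real.exp (R * s + -((a * κ + 1 + E) * g) + -((r + R) * s)) := by
          rw [Real.exp_add, Real.exp_add]; ring
      _ ≤ (max C 0 + C₀) * Real.exp (-(r * s) + -g) := by
          refine mul_le_mul_of_nonneg_left (Real.exp_le_exp.2 ?_) (by positivity)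
          have : 0 ≤ (a * κ + E) * g := by positivity
          nlinarith
      _ = _ := by rw [Real.exp_add]; ring
  · have hGz : anisoNorm ν μ z ≤ κ * (g + s * R₁) := by
      refine (anisoNorm_le_sub_add hν hμ z (dilate ν μ s w)).trans
        (mul_le_mul_of_nonneg_left ?_ (by linarith))
      rw [anisoNorm_dilate hν hμ hs]
      have := mul_le_mul_of_nonneg_left (le_of_lt hw.2) hs.le
      linarith
    have hEg : (R + a * κ * R₁ + r) * s ≤ E * g := by
      have h1 : (R + a * κ * R₁ + r) = E * δ := by rw [hE]; field_simp
      rw [h1, mul_assoc]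
      exact mul_le_mul_of_nonneg_left hge hE0
    have hNz : N z ≤ (max C 0 + C₀) * Real.exp (a * (κ * (g + s * R₁))) := by
      refine (hN z).trans (mul_le_mul ?_ (Real.exp_le_exp.2 (mul_le_mul_of_nonneg_left hGz ha))
        (Real.exp_pos _).le (by positivity))
      linarith [le_max_right C 0]
    calc Real.exp (R * s) * Real.exp (-((a * κ + 1 + E) * g)) * N z
        ≤ Real.exp (R * s) * Real.exp (-((a * κ + 1 + E) * g)) *
          ((max C 0 + C₀) * Real.exp (a * (κ * (g + s * R₁)))) :=
          mul_le_mul_of_nonneg_left hNz (by positivity)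
      _ = (max C 0 + C₀) *
          Real.exp (R * s + -((a * κ + 1 + E) * g) + a * (κ * (g + s * R₁))) := by
          rw [Real.exp_add, Real.exp_add]; ring
      _ ≤ (max C 0 + C₀) * Real.exp (-(r * s) + -g) := by
          refine mul_le_mul_of_nonneg_left (Real.exp_le_exp.2 ?_) (by positivity)
          nlinarith
      _ = _ := by rw [Real.exp_add]; ring

/-- For `k < n` one has `μk < ν`, so the lower coefficients are scaled away; the top one survives as
`θ`. Keeping `θ` as a limit treats `ν = μn` and `ν > μn` together. -/
theorem tendsto_rescaled_eval {ν μ : ℝ} (hμ : 0 < μ) {n : ℕ} (hνμ : μ * n ≤ ν) (P : Polynomial ℝ)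
    (hP : P.natDegree ≤ n) {θ : ℝ}
    (hθ : Tendsto (fun s : ℝ => s ^ (μ * n - ν) * P.coeff n) atTop (𝓝 θ)) (y : ℝ) :
    Tendsto (fun p : ℝ × ℝ => p.1 ^ (-ν) * P.eval (p.1 ^ μ * p.2)) (atTop ×ˢ 𝓝 y)
      (𝓝 (θ * y ^ n)) := by
  have h1 : Tendsto (fun p : ℝ × ℝ => ∑ k ∈ Finset.range (n + 1),
      (p.1 ^ (μ * k - ν) * P.coeff k) * p.2 ^ k) (atTop ×ˢ 𝓝 y)
      (𝓝 (∑ k ∈ Finset.range (n + 1), (if k = n then θ else 0) * y ^ k)) := by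
    refine tendsto_finsetSum _ fun k hk => ?_
    have hy : Tendsto (fun p : ℝ × ℝ => p.2 ^ k) (atTop ×ˢ 𝓝 y) (𝓝 (y ^ k)) :=
      tendsto_snd.pow k
    refine Tendsto.mul ?_ hy
    by_cases hkn : k = n
    · subst hkn
      rw [if_pos rfl]
      exact hθ.comp tendsto_fst
    · have hk' : k < n := lt_of_le_of_ne (Nat.lt_succ_iff.1 (Finset.mem_range.1 hk)) hkn
      have hpos : 0 < ν - μ * k := by
        have : (k : ℝ) < n := by exact_mod_cast hk'
        nlinarith
      have h2 := ((tendsto_rpow_neg_atTop hpos).mul_const (P.coeff k)).comp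
        (tendsto_fst (f := (atTop : Filter ℝ)) (g := 𝓝 y))
      rw [if_neg hkn]
      simpa [Function.comp_def] using h2
  have h3 : (∑ k ∈ Finset.range (n + 1), (if k = n then θ else 0) * y ^ k) = θ * y ^ n := by
    simp [ite_mul]
  rw [h3] at h1
  refine h1.congr' ?_
  filter_upwards [(eventually_gt_atTop 0).prod_inl (𝓝 y)] with p hp
  rw [Polynomial.eval_eq_sum_range' (Nat.lt_succ_of_le hP), Finset.mul_sum]
  refine Finset.sum_congr rfl fun k _ => ?_
  rw [sub_eq_add_neg, Real.rpow_add hp, Real.rpow_mul hp.le, Real.rpow_natCast]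
  ring

/-- The flow `(x, ξ) ↦ (x + (θ_j ξ_j^n)_j, ξ)`. -/
def monomialFlow (θ : Fin d → ℝ) (n : ℕ) (z : Rd d × Rd d) : Rd d × Rd d :=
  (z.1 + WithLp.toLp 2 fun j => θ j * z.2 j ^ n, z.2)

/-- The rescaled centre of the kernel tends to the inverse flow of the target point, and the
frequency shift by `η` vanishes at scale `s^μ`. The limit is joint in `s` and the point, which gives
uniformity on a neighbourhood. -/
theorem tendsto_rescaled_flow {ν μ : ℝ} (hμ : 0 < μ) {n : ℕ} (hνμ : μ * n ≤ ν)
    (a : Fin d → Polynomial ℝ) (ha : ∀ j, (a j).natDegree ≤ n + 1) {θ : Fin d → ℝ}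
    (hθ : ∀ j, Tendsto (fun s : ℝ => s ^ (μ * n - ν) * (Polynomial.derivative (a j)).coeff n) atTop
      (𝓝 (θ j))) (η : Rd d) (z₀ : Rd d × Rd d) :
    Tendsto (fun p : ℝ × (Rd d × Rd d) =>
      (p.2.1 - p.1 ^ (-ν) • phaseGrad a (p.1 ^ μ • p.2.2), p.2.2 + p.1 ^ (-μ) • η))
      (atTop ×ˢ 𝓝 (monomialFlow θ n z₀)) (𝓝 z₀) := by
  set z := monomialFlow θ n z₀ with hz
  have hsnd : Tendsto (fun p : ℝ × (Rd d × Rd d) => p.2) (atTop ×ˢ 𝓝 z) (𝓝 z) := tendsto_snd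
  have hx : Tendsto (fun p : ℝ × (Rd d × Rd d) => p.2.1) (atTop ×ˢ 𝓝 z) (𝓝 z.1) :=
    (continuous_fst.tendsto z).comp hsnd
  have hξ : Tendsto (fun p : ℝ × (Rd d × Rd d) => p.2.2) (atTop ×ˢ 𝓝 z) (𝓝 z.2) :=
    (continuous_snd.tendsto z).comp hsnd
  have hgrad : Tendsto (fun p : ℝ × (Rd d × Rd d) => p.1 ^ (-ν) • phaseGrad a (p.1 ^ μ • p.2.2))
      (atTop ×ˢ 𝓝 z) (𝓝 (WithLp.toLp 2 fun j => θ j * z.2 j ^ n)) := by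
    have h1 : Tendsto (fun (p : ℝ × (Rd d × Rd d)) (j : Fin d) =>
        p.1 ^ (-ν) * (Polynomial.derivative (a j)).eval (p.1 ^ μ * p.2.2 j)) (atTop ×ˢ 𝓝 z)
        (𝓝 fun j => θ j * z.2 j ^ n) := by
      refine tendsto_pi_nhds.2 fun j => ?_
      have h2 := tendsto_rescaled_eval hμ hνμ (Polynomial.derivative (a j))
        ((Polynomial.natDegree_derivative_le _).trans (by have := ha j; omega)) (hθ j) (z.2 j)
      have h3 : Tendsto (fun p : ℝ × (Rd d × Rd d) => (p.1, p.2.2 j)) (atTop ×ˢ 𝓝 z)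
          (atTop ×ˢ 𝓝 (z.2 j)) :=
        tendsto_fst.prodMk (((EuclideanSpace.proj (𝕜 := ℝ) j).continuous.tendsto z.2).comp hξ)
      exact h2.comp h3
    exact ((PiLp.continuous_toLp 2 _).tendsto _).comp h1
  have hη : Tendsto (fun p : ℝ × (Rd d × Rd d) => p.1 ^ (-μ) • η) (atTop ×ˢ 𝓝 z) (𝓝 0) := by
    have := ((tendsto_rpow_neg_atTop hμ).smul_const η).comp
      (tendsto_fst (f := (atTop : Filter ℝ)) (g := 𝓝 z))
    simpa [Function.comp_def] using this
  have h := (hx.sub hgrad).prodMk_nhds (hξ.add hη)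
  have e : (z.1 - WithLp.toLp 2 fun j => θ j * z.2 j ^ n, z.2 + 0) = z₀ := by
    rw [hz]
    simp [monomialFlow]
  rwa [e] at h

end GS

end

/-! ### Propagation of microlocal regularity -/

noncomputable section

namespace GelfandShilov

open GS Airy Filter Topology

variable {d : ℕ} {ν μ : ℝ}

/-- The short-time Fourier transform of `u` decays rapidly along the dilates of a neighbourhood
of `z`. -/
def RegularAt (hν : 0 < ν) (hμ : 0 < μ) (φ : GelfandShilov d ν μ) (u : Dual d ν μ)
    (z : Rd d × Rd d) : Prop :=
  ∃ U : Set (Rd d × Rd d), IsOpen U ∧ z ∈ U ∧ 0 ∉ U ∧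
    ∀ r : ℝ, 0 < r → ∃ C : ℝ, ∀ s : ℝ, 0 < s → ∀ w ∈ U,
      ‖u (timeFreqShift hν hμ (s ^ ν • w.1) (s ^ μ • w.2) φ)‖ ≤ C * Real.exp (-(r * s))

theorem mem_waveFrontSet_iff (hν : 0 < ν) (hμ : 0 < μ) (φ : GelfandShilov d ν μ) (u : Dual d ν μ)
    (z : Rd d × Rd d) : z ∈ waveFrontSet hν hμ φ u ↔ z ≠ 0 ∧ ¬RegularAt hν hμ φ u z := by
  refine and_congr_right fun _ => not_congr (exists_congr fun U => and_congr_right fun _ =>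
    and_congr_right fun _ => and_congr_right fun _ => forall_congr' fun r => forall_congr' fun _ => ?_)
  set c : ℝ := (2 * Real.pi) ^ (-(d : ℝ) / 2) with hc
  have hc0 : 0 < c := by positivity
  have key : ∀ (s : ℝ) (w : Rd d × Rd d),
      Real.exp (r * s) * ‖stft hν hμ φ u (s ^ ν • w.1) (s ^ μ • w.2)‖ =
        c * (Real.exp (r * s) * ‖u (timeFreqShift hν hμ (s ^ ν • w.1) (s ^ μ • w.2) φ)‖) :=
    fun s w => by
      rw [stft, norm_mul, norm_real, Real.norm_of_nonneg hc0.le]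
      ring
  simp only [key]
  constructor
  · rintro ⟨C, hC⟩
    refine ⟨C / c, fun s hs w hw => ?_⟩
    have := hC s hs w hw
    rw [Real.exp_neg, ← div_eq_mul_inv, le_div_iff₀ (Real.exp_pos _), le_div_iff₀ hc0]
    linarith
  · rintro ⟨C, hC⟩
    refine ⟨c * C, fun s hs w hw => mul_le_mul_of_nonneg_left ?_ hc0.le⟩
    have := hC s hs w hw
    rw [Real.exp_neg, ← div_eq_mul_inv, le_div_iff₀ (Real.exp_pos _)] at this
    linarith

theorem coe_propagator_timeFreqShift (hν : 0 < ν) (hμ : 0 < μ) (q : Fin d → Polynomial ℝ)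
    (v : Rd d) (t : ℝ) (φ : GelfandShilov d ν μ) (x ξ : Rd d) :
    schwartzPropagator q v (-t) ((timeFreqShift hν hμ x ξ φ).toSchwartz hν) =
      phaseSymbol (phasePoly q v (-t)) ξ •
        schwartzShift (x - phaseGrad (phasePoly q v (-t)) ξ, ξ + t • v)
          (phaseMultiplier (fun j => taylorRemainder (phasePoly q v (-t) j) (ξ j))
            (φ.toSchwartz hν)) := by
  have h1 : (timeFreqShift hν hμ x ξ φ).toSchwartz hν =
      schwartzShift (x, ξ) (φ.toSchwartz hν) := by
    refine DFunLike.coe_injective ?_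
    rw [coe_schwartzShift]
    rfl
  have h2 := phaseMultiplier_schwartzShift (phasePoly q v (-t)) (x, ξ) (φ.toSchwartz hν)
  rw [h1, schwartzPropagator_apply, neg_neg]
  change phaseMul (linPhase (t • v)) (phaseMultiplier (fun j => (phasePoly q v (-t) j).comp
    (Polynomial.C (2 * Real.pi) * Polynomial.X)) (schwartzShift (x, ξ) (φ.toSchwartz hν))) = _
  rw [h2, map_smul, phaseMul_linPhase_schwartzShift]

theorem dilate_rescaled {ν μ s : ℝ} (hs : 0 < s) (x ξ y η : Rd d) :
    dilate ν μ s (x - s ^ (-ν) • y, ξ + s ^ (-μ) • η) = (s ^ ν • x - y, s ^ μ • ξ + η) := by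
  have h : ∀ r : ℝ, s ^ r * s ^ (-r) = 1 := fun r => by
    rw [← Real.rpow_add hs, add_neg_cancel, Real.rpow_zero]
  simp [dilate, smul_sub, smul_add, smul_smul, h]

/-- Microlocal regularity is transported along the limit of the rescaled phase flow. -/
theorem RegularAt.propagate (hd : 0 < d) (hν : 1 < ν) (hν0 : 0 < ν) (hμ : 0 < μ) {m : ℕ}
    (hm : 2 ≤ m) (hνμ : μ * ((m : ℝ) - 1) ≤ ν) (q : Fin d → Polynomial ℝ)
    (hq : ∀ j, (Polynomial.derivative (q j)).natDegree ≤ m) (v : Rd d) (t : ℝ)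
    {u u' : Dual d ν μ} {φ ψ : GelfandShilov d ν μ} (hψ : ψ ≠ 0)
    (K : GelfandShilov d ν μ → GelfandShilov d ν μ)
    (hK : ∀ f, (K f : Rd d → ℂ) = schwartzPropagator q v (-t) (f.toSchwartz hν0))
    (hu' : ∀ f, u' f = u (K f)) {z z₀ : Rd d × Rd d} (hz : z ≠ 0)
    (hlim : Tendsto (fun p : ℝ × (Rd d × Rd d) =>
      (p.2.1 - p.1 ^ (-ν) • phaseGrad (phasePoly q v (-t)) (p.1 ^ μ • p.2.2),
        p.2.2 + p.1 ^ (-μ) • t • v)) (atTop ×ˢ 𝓝 z) (𝓝 z₀))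
    (h : RegularAt hν0 hμ ψ u z₀) : RegularAt hν0 hμ φ u' z := by
  obtain ⟨U, hU, hz₀, -, hdec⟩ := h
  obtain ⟨C₀, A, hC₀, hA, hgrow⟩ := u.exists_norm_timeFreqShift_le hν0 hμ ψ
  obtain ⟨V, hV, HV⟩ := exists_mem_nhds_convolution_decay hν0 hμ hC₀ hA
    (N := fun z => ‖u (timeFreqShift hν0 hμ z.1 z.2 ψ)‖) hgrow hU hz₀ hdec
  obtain ⟨C', A', hC', hA', hgrow'⟩ := u'.exists_norm_timeFreqShift_le hν0 hμ φ
  -- The joint limit gives one threshold `s₀` and one neighbourhood of `z` for which the rescaled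
  -- centre lies in `V`.
  obtain ⟨pa, hpa, pb, hpb, hpab⟩ := eventually_prod_iff.1 (hlim hV)
  obtain ⟨s₀, hs₀⟩ := eventually_atTop.1 hpa
  set s₁ := max s₀ 1 with hs₁
  have hs₁0 : 0 < s₁ := lt_max_of_lt_right one_pos
  set R := anisoNorm ν μ z + 1 with hR
  have hR0 : 0 ≤ R := by have := anisoNorm_nonneg ν μ z; linarith
  have hnhds : {w | pb w} ∩ ({w | anisoNorm ν μ w < R} ∩ {0}ᶜ) ∈ 𝓝 z :=
    inter_mem hpb (inter_mem ((continuous_anisoNorm hν0 hμ).continuousAt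
      (Iio_mem_nhds (by linarith))) (isOpen_compl_singleton.mem_nhds hz))
  obtain ⟨U', hU'sub, hU', hzU'⟩ := mem_nhds_iff.1 hnhds
  refine ⟨U', hU', hzU', fun h0 => (hU'sub h0).2.2 rfl, fun r hr => ?_⟩
  -- The rate `k` depends on `R`, the exponent of the loss. This is not circular: the loss
  -- `exp(‖ξ‖^{1/μ})` below is independent of the decay rate requested.
  obtain ⟨k, C, hk, hC, Hk⟩ := HV r R hr hR0
  obtain ⟨B, hB, HB⟩ := exists_norm_taylorRemainder_increment_le (phasePoly q v (-t)) hm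
    (fun j => natDegree_phasePoly_le q v (-t) (hq j))
  obtain ⟨h₁, C₁, hh₁, hC₁, H₁⟩ := exists_norm_funSTFT_phaseMultiplier_le hd hμ hν hB hk hm hνμ
    (ψ.toSchwartz hν0) ψ.mem
  obtain ⟨M, hM⟩ := φ.mem.exists_boundedBy hh₁
  have hM0 := hM.nonneg
  set c : ℂ := conj ((((2 * Real.pi) ^ d : ℝ) : ℂ) * windowMass ψ) with hc
  have hc0 : 0 < ‖c‖ := by
    rw [hc, RCLike.norm_conj]
    exact norm_pos_iff.2 (mul_ne_zero (by rw [ofReal_ne_zero]; positivity)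
      (windowMass_ne_zero (ψ.toSchwartz hν0) (toSchwartz_ne_zero hν0 hψ)))
  set J := ∫ z : Rd d × Rd d, Real.exp (-anisoNorm ν μ z) with hJ
  have hJ0 : 0 ≤ J := integral_nonneg fun _ => (Real.exp_pos _).le
  have hJi : Integrable fun z : Rd d × Rd d => Real.exp (-anisoNorm ν μ z) := by
    simpa using integrable_exp_neg_anisoNorm (d := d) hν0 hμ one_pos
  set D₁ := C₁ * M * C * J / ‖c‖ with hD₁
  have hD₁0 : 0 ≤ D₁ := by positivity
  set D₂ := C' * Real.exp (A' * (s₁ * R)) * Real.exp (r * s₁) with hD₂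
  have hD₂0 : 0 ≤ D₂ := by positivity
  refine ⟨D₁ + D₂, fun s hs w hw => ?_⟩
  obtain ⟨hw1, hw2, -⟩ := hU'sub hw
  -- For bounded `s` the growth bound for `u'` on a set of bounded gauge is enough; `D₂` contains
  -- `e^{r s₁}` to offset the demanded decay.
  rcases lt_or_ge s s₁ with hlt | hge
  · have h1 := hgrow' (dilate ν μ s w)
    rw [anisoNorm_dilate hν0 hμ hs] at h1
    refine h1.trans ?_
    have h2 : s * anisoNorm ν μ w ≤ s₁ * R :=
      mul_le_mul hlt.le (le_of_lt hw2) (anisoNorm_nonneg _ _ _) hs₁0.le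
    calc C' * Real.exp (A' * (s * anisoNorm ν μ w)) ≤ C' * Real.exp (A' * (s₁ * R)) :=
          mul_le_mul_of_nonneg_left (Real.exp_le_exp.2 (mul_le_mul_of_nonneg_left h2 hA')) hC'
      _ = D₂ * Real.exp (-(r * s₁)) := by
          rw [hD₂, mul_assoc _ (Real.exp (r * s₁)), ← Real.exp_add, add_neg_cancel, Real.exp_zero,
            mul_one]
      _ ≤ (D₁ + D₂) * Real.exp (-(r * s)) := by
          refine mul_le_mul (by linarith) (Real.exp_le_exp.2 ?_) (Real.exp_pos _).le (by positivity)
          have := mul_le_mul_of_nonneg_left hlt.le hr.le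
          linarith
  · set x := s ^ ν • w.1 with hx
    set ξ := s ^ μ • w.2 with hξ
    set a := phasePoly q v (-t) with ha
    set y : Rd d × Rd d := (x - phaseGrad a ξ, ξ + t • v) with hy
    set w' : Rd d × Rd d := (w.1 - s ^ (-ν) • phaseGrad a (s ^ μ • w.2), w.2 + s ^ (-μ) • t • v)
      with hw'
    have hw'V : w' ∈ V := hpab (hs₀ s ((le_max_left _ _).trans hge)) hw1
    have hyw : dilate ν μ s w' = y := dilate_rescaled hs _ _ _ _
    set g := K (timeFreqShift hν0 hμ x ξ φ) with hg
    set Φ := phaseMultiplier (fun j => taylorRemainder (a j) (ξ j)) (φ.toSchwartz hν0) with hΦ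
    have hgeq : (g : Rd d → ℂ) = phaseSymbol a ξ • tfShift y Φ := by
      rw [hg, hK, coe_propagator_timeFreqShift, ← coe_schwartzShift]
      rfl
    -- On the dilate the loss `exp(‖ξ‖^{1/μ})` equals `exp(s‖w.2‖^{1/μ})`, which is at most `e^{Rs}`
    -- on the chosen neighbourhood.
    have hVg : ∀ z, ‖funSTFT ψ g z‖ ≤
        C₁ * M * (Real.exp (R * s) * Real.exp (-(k * anisoNorm ν μ (z - dilate ν μ s w')))) :=
      fun z => by
        rw [hgeq, funSTFT_smul, norm_mul, norm_phaseSymbol, one_mul, norm_funSTFT_tfShift, hyw]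
        refine (H₁ (φ.toSchwartz hν0) M hM _ ‖ξ‖ (norm_nonneg _) (HB ξ) (z - y)).trans ?_
        rw [mul_assoc]
        refine mul_le_mul_of_nonneg_left (mul_le_mul_of_nonneg_right (Real.exp_le_exp.2 ?_)
          (Real.exp_pos _).le) (by positivity)
        have h1 : rootNorm μ ξ = s * rootNorm μ w.2 := rootNorm_rpow_smul hμ hs w.2
        change rootNorm μ ξ ≤ R * s
        rw [h1, mul_comm]
        refine mul_le_mul_of_nonneg_right ?_ hs.le
        have h2 := rootNorm_nonneg ν w.1
        have h3 : rootNorm ν w.1 + rootNorm μ w.2 < R := hw2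
        linarith
    have hinteg : ∀ z : Rd d × Rd d,
        ‖conj (funSTFT ψ g z) * u (timeFreqShift hν0 hμ z.1 z.2 ψ)‖ ≤
        C₁ * M * C * Real.exp (-(r * s)) * Real.exp (-anisoNorm ν μ (z - dilate ν μ s w')) :=
      fun z => by
        rw [norm_mul, RCLike.norm_conj]
        refine (mul_le_mul_of_nonneg_right (hVg z) (norm_nonneg _)).trans ?_
        have := mul_le_mul_of_nonneg_left (Hk s hs w' hw'V z) (mul_nonneg hC₁.le hM0)
        linarith
    have hinv := u.apply_eq_integral hd hν hν0 hμ ψ hψ g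
    have : (volume : Measure (Rd d × Rd d)).IsAddRightInvariant := by
      rw [Measure.volume_eq_prod]
      infer_instance
    have hle := norm_integral_le_of_norm_le ((hJi.comp_sub_right (dilate ν μ s w')).const_mul _)
      (Eventually.of_forall hinteg)
    rw [← hinv, ← hc, norm_mul, integral_const_mul,
      integral_sub_right_eq_self (fun z : Rd d × Rd d => Real.exp (-anisoNorm ν μ z)), ← hJ] at hle
    rw [hu', ← hg]
    have h5 : ‖u g‖ ≤ D₁ * Real.exp (-(r * s)) := by
      rw [hD₁, div_mul_eq_mul_div, le_div_iff₀ hc0]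
      linarith
    refine h5.trans (mul_le_mul_of_nonneg_right (by linarith) (Real.exp_pos _).le)

end GelfandShilov

end

/-! ### The Hamilton flow, the operators on the spaces, and the conclusion -/

noncomputable section

namespace Airy

open GS Filter Topology

variable {d : ℕ}

theorem principalPart_eq_sum {p : Fin d → Polynomial ℝ} {m : ℕ} (hp : ∀ j, (p j).natDegree ≤ m)
    (ξ : Rd d) : principalPart p m ξ = ∑ j, (p j).coeff m * ξ j ^ m := by
  rw [principalPart, Finset.sum_filter]
  refine Finset.sum_congr rfl fun j _ => ?_
  split_ifs with h
  · rfl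
  · rw [Polynomial.coeff_eq_zero_of_natDegree_lt (lt_of_le_of_ne (hp j) h), zero_mul]

theorem gradient_principalPart {p : Fin d → Polynomial ℝ} {m : ℕ} (hp : ∀ j, (p j).natDegree ≤ m)
    (ξ : Rd d) : gradient (principalPart p m) ξ =
      WithLp.toLp 2 fun j => (p j).coeff m * (m * ξ j ^ (m - 1)) := by
  refine HasGradientAt.gradient ?_
  rw [hasGradientAt_iff_hasFDerivAt]
  have h0 : principalPart p m = fun ξ => ∑ j, (p j).coeff m * ξ j ^ m :=
    funext (principalPart_eq_sum hp)
  have h1 : HasFDerivAt (fun ξ : Rd d => ∑ j, (p j).coeff m * ξ j ^ m)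
      (∑ j, (p j).coeff m • (m * ξ j ^ (m - 1)) • (EuclideanSpace.proj (𝕜 := ℝ) j : Rd d →L[ℝ] ℝ))
      ξ := by
    refine HasFDerivAt.fun_sum fun j _ => ?_
    have h2 : HasFDerivAt (fun ξ : Rd d => ξ j) (EuclideanSpace.proj (𝕜 := ℝ) j : Rd d →L[ℝ] ℝ) ξ :=
      (EuclideanSpace.proj (𝕜 := ℝ) j : Rd d →L[ℝ] ℝ).hasFDerivAt
    exact ((hasDerivAt_pow m (ξ j)).comp_hasFDerivAt ξ h2).const_mul _
  have h3 : InnerProductSpace.toDual ℝ (Rd d)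
      (WithLp.toLp 2 fun j => (p j).coeff m * (m * ξ j ^ (m - 1))) =
      ∑ j, (p j).coeff m • (m * ξ j ^ (m - 1)) •
        (EuclideanSpace.proj (𝕜 := ℝ) j : Rd d →L[ℝ] ℝ) := by
    refine ContinuousLinearMap.ext fun y => ?_
    rw [InnerProductSpace.toDual_apply_apply, PiLp.inner_apply, sum_apply]
    refine Finset.sum_congr rfl fun j _ => ?_
    simp only [smul_apply, PiLp.proj_apply, smul_eq_mul, RCLike.inner_apply, conj_trivial]
    ring
  rw [h0, h3]
  exact h1

/-- Brings the flow into the form in which the rescaled phase gradient converges, with coefficients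
`t m c_{j,m}`. -/
theorem hamiltonFlow_eq {p : Fin d → Polynomial ℝ} {m : ℕ} (hp : ∀ j, (p j).natDegree ≤ m) (t : ℝ) :
    hamiltonFlow p m t = monomialFlow (fun j => t * ((p j).coeff m * m)) (m - 1) := by
  funext z
  rw [hamiltonFlow, monomialFlow, gradient_principalPart hp]
  congr 2
  ext j
  simp only [PiLp.smul_apply, smul_eq_mul]
  ring

end Airy

namespace GS

variable {d : ℕ}

theorem monomialFlow_neg_monomialFlow (θ : Fin d → ℝ) (n : ℕ) (z : Rd d × Rd d) :
    monomialFlow (-θ) n (monomialFlow θ n z) = z := by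
  refine Prod.ext ?_ rfl
  ext j
  simp [monomialFlow]

theorem monomialFlow_zero (n : ℕ) (z : Rd d × Rd d) : monomialFlow (0 : Fin d → ℝ) n z = z := by
  refine Prod.ext ?_ rfl
  ext j
  simp [monomialFlow]

/-- The inverse flow fixes the origin because `0^n = 0`, which needs `n ≠ 0`. -/
theorem monomialFlow_ne_zero {θ : Fin d → ℝ} {n : ℕ} (hn : n ≠ 0) {z : Rd d × Rd d} (hz : z ≠ 0) :
    monomialFlow θ n z ≠ 0 := fun h => hz (by
  have h0 : monomialFlow (-θ) n (0 : Rd d × Rd d) = 0 := by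
    refine Prod.ext ?_ rfl
    ext j
    simp [monomialFlow, hn]
  rw [← monomialFlow_neg_monomialFlow θ n z, h, h0])

end GS

namespace GelfandShilov

open GS Airy Filter Topology

variable {d : ℕ} {ν μ : ℝ}

/-- The solution operator on the Gelfand–Shilov space. -/
def gsPropagator (hd : 0 < d) (hν : 1 < ν) (hν0 : 0 < ν) (hμ : 0 < μ) {m : ℕ} (hm : 2 ≤ m)
    (hνμ : μ * ((m : ℝ) - 1) ≤ ν) (q : Fin d → Polynomial ℝ)
    (hq : ∀ j, (Polynomial.derivative (q j)).natDegree ≤ m) (v : Rd d) (t : ℝ) :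
    GelfandShilov d ν μ →L[ℂ] GelfandShilov d ν μ :=
  restrictCLM hν0 (schwartzPropagator q v t)
    fun _ hh => exists_boundedBy_schwartzPropagator hd hμ hν hh hm hνμ q hq v t

section

variable (hd : 0 < d) (hν : 1 < ν) (hν0 : 0 < ν) (hμ : 0 < μ) {m : ℕ} (hm : 2 ≤ m)
    (hνμ : μ * ((m : ℝ) - 1) ≤ ν) (q : Fin d → Polynomial ℝ)
    (hq : ∀ j, (Polynomial.derivative (q j)).natDegree ≤ m) (v : Rd d) (t : ℝ)

theorem coe_gsPropagator (f : GelfandShilov d ν μ) :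
    (gsPropagator hd hν hν0 hμ hm hνμ q hq v t f : Rd d → ℂ) =
      schwartzPropagator q v t (f.toSchwartz hν0) := rfl

theorem gsPropagator_neg_gsPropagator (f : GelfandShilov d ν μ) :
    gsPropagator hd hν hν0 hμ hm hνμ q hq v (-t) (gsPropagator hd hν hν0 hμ hm hνμ q hq v t f) =
      f := by
  refine Subtype.ext ?_
  change (schwartzPropagator q v (-t) (schwartzPropagator q v t (f.toSchwartz hν0)) : Rd d → ℂ) = _
  rw [schwartzPropagator_neg_schwartzPropagator]
  rfl

/-- The solution operator on the ultradistributions, the transpose of `gsPropagator` at `-t`. -/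
def dualPropagator : Dual d ν μ →L[ℂ] Dual d ν μ :=
  PointwiseConvergenceCLM.precomp ℂ (gsPropagator hd hν hν0 hμ hm hνμ q hq v (-t))

theorem dualPropagator_apply (u : Dual d ν μ) (f : GelfandShilov d ν μ) :
    dualPropagator hd hν hν0 hμ hm hνμ q hq v t u f =
      u (gsPropagator hd hν hν0 hμ hm hνμ q hq v (-t) f) := rfl

theorem dualPropagator_neg_dualPropagator (u : Dual d ν μ) :
    dualPropagator hd hν hν0 hμ hm hνμ q hq v (-t)
      (dualPropagator hd hν hν0 hμ hm hνμ q hq v t u) = u := by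
  refine DFunLike.ext _ _ fun f => ?_
  rw [dualPropagator_apply, dualPropagator_apply, neg_neg, gsPropagator_neg_gsPropagator]

theorem dualPropagator_ofIntegrable (f : 𝓢(Rd d, ℂ)) :
    dualPropagator hd hν hν0 hμ hm hνμ q hq v t (ofIntegrable f f.integrable) =
      ofIntegrable (schwartzPropagator q v t f) (schwartzPropagator q v t f).integrable := by
  refine DFunLike.ext _ _ fun φ => ?_
  -- The `L²` adjoint of `𝒦_t` is `𝒦_{-t}`, so the transpose of `𝒦_{-t}` extends `𝒦_t`.
  rw [dualPropagator_apply, ofIntegrable_apply, ofIntegrable_apply]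
  exact (integral_schwartzPropagator_mul_conj q v t f (φ.toSchwartz hν0)).symm

theorem RegularAt.dualPropagator {n : ℕ} (hmn : m = n + 1) {θ : Fin d → ℝ}
    (hθ : ∀ j, Tendsto (fun s : ℝ => s ^ (μ * n - ν) *
      (Polynomial.derivative (phasePoly q v (-t) j)).coeff n) atTop (𝓝 (θ j)))
    {u : Dual d ν μ} {φ ψ : GelfandShilov d ν μ} (hψ : ψ ≠ 0) {z : Rd d × Rd d} (hz : z ≠ 0)
    (h : RegularAt hν0 hμ ψ u z) :
    RegularAt hν0 hμ φ (dualPropagator hd hν hν0 hμ hm hνμ q hq v t u) (monomialFlow θ n z) := by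
  subst hmn
  refine RegularAt.propagate hd hν hν0 hμ hm hνμ q hq v t hψ
    (gsPropagator hd hν hν0 hμ hm hνμ q hq v (-t))
    (fun f => coe_gsPropagator hd hν hν0 hμ hm hνμ q hq v (-t) f) (fun f => rfl)
    (monomialFlow_ne_zero (by omega) hz) ?_ h
  refine tendsto_rescaled_flow hμ ?_ _ (fun j => natDegree_phasePoly_le q v (-t) (hq j)) hθ _ z
  simpa using hνμ

/-- Propagation of regularity from `u` gives one inclusion. The other is the same statement for `-t`
applied to the evolved ultradistribution, with the windows interchanged and the flow inverted, so
both windows must be nonzero. -/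
theorem waveFrontSet_dualPropagator {n : ℕ} (hmn : m = n + 1) {θ : Fin d → ℝ}
    (hθ : ∀ j, Tendsto (fun s : ℝ => s ^ (μ * n - ν) *
      (Polynomial.derivative (phasePoly q v (-t) j)).coeff n) atTop (𝓝 (θ j)))
    (hθ' : ∀ j, Tendsto (fun s : ℝ => s ^ (μ * n - ν) *
      (Polynomial.derivative (phasePoly q v (- -t) j)).coeff n) atTop (𝓝 ((-θ) j)))
    (u : Dual d ν μ) {φ ψ : GelfandShilov d ν μ} (hφ : φ ≠ 0) (hψ : ψ ≠ 0) :
    waveFrontSet hν0 hμ φ (dualPropagator hd hν hν0 hμ hm hνμ q hq v t u) =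
      monomialFlow θ n '' waveFrontSet hν0 hμ ψ u := by
  have hn : n ≠ 0 := by omega
  ext z
  constructor
  · intro hz
    rw [mem_waveFrontSet_iff] at hz
    have e : monomialFlow θ n (monomialFlow (-θ) n z) = z := by
      simpa using monomialFlow_neg_monomialFlow (-θ) n z
    have h0 : monomialFlow (-θ) n z ≠ 0 := monomialFlow_ne_zero hn hz.1
    refine ⟨monomialFlow (-θ) n z, (mem_waveFrontSet_iff _ _ _ _ _).2 ⟨h0, fun hreg => hz.2 ?_⟩, e⟩
    have := hreg.dualPropagator hd hν hν0 hμ hm hνμ q hq v t hmn hθ (φ := φ) hψ h0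
    rwa [e] at this
  · rintro ⟨w, hw, rfl⟩
    rw [mem_waveFrontSet_iff] at hw ⊢
    refine ⟨monomialFlow_ne_zero hn hw.1, fun hreg => hw.2 ?_⟩
    have := hreg.dualPropagator hd hν hν0 hμ hm hνμ q hq v (-t) hmn hθ' (φ := ψ) hφ
      (monomialFlow_ne_zero hn hw.1)
    rwa [monomialFlow_neg_monomialFlow, dualPropagator_neg_dualPropagator] at this

end

theorem coeff_derivative_phasePoly (q : Fin d → Polynomial ℝ) {v : Rd d} {n : ℕ} {j : Fin d}
    (hv : v j ≠ 0) (hq : (Polynomial.derivative (q j)).natDegree ≤ n + 1) (t : ℝ) :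
    (Polynomial.derivative (phasePoly q v (-t) j)).coeff n =
      t * ((Polynomial.derivative (q j)).coeff (n + 1) * ((n + 1 : ℕ) : ℝ)) := by
  rw [Polynomial.coeff_derivative, coeff_phasePoly q (-t) hv hq]
  push_cast
  ring

end GelfandShilov

end

theorem theorem5p3 {d m : ℕ} (p q : Fin d → Polynomial ℝ)
    (hm : m = Finset.univ.sup fun j => (p j).natDegree) (hm2 : 2 ≤ m)
    (hq : ∀ j, Polynomial.derivative (q j) = p j)
    (v : Rd d) (hv : ∀ j, v j ≠ 0)
    {ν μ : ℝ} (hν : 0 < ν) (hμ : 0 < μ)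
    (h1 : 1 < μ * ((m : ℝ) - 1)) (h2 : μ * ((m : ℝ) - 1) ≤ ν) (t : ℝ) :
    ∃ K : GelfandShilov d ν μ →L[ℂ] GelfandShilov d ν μ,
      (∀ f : GelfandShilov d ν μ, (K f : Rd d → ℂ) = Airy.propagator q v t f) ∧
    ∃ L : GelfandShilov.Dual d ν μ →L[ℂ] GelfandShilov.Dual d ν μ,
      (∀ f : GelfandShilov d ν μ, L f.toDual = (K f).toDual) ∧
      (∀ L' : GelfandShilov.Dual d ν μ →L[ℂ] GelfandShilov.Dual d ν μ,
        (∀ f : GelfandShilov d ν μ, L' f.toDual = (K f).toDual) → L' = L) ∧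
      (∀ f : 𝓢(Rd d, ℂ), ∃ g : 𝓢(Rd d, ℂ), (g : Rd d → ℂ) = Airy.propagator q v t f ∧
        L (GelfandShilov.ofIntegrable f f.integrable) =
          GelfandShilov.ofIntegrable g g.integrable) ∧
      (ν = μ * ((m : ℝ) - 1) →
        ∀ (u : GelfandShilov.Dual d ν μ) (φ ψ : GelfandShilov d ν μ), φ ≠ 0 → ψ ≠ 0 →
          GelfandShilov.waveFrontSet hν hμ φ (L u) =
            Airy.hamiltonFlow p m t '' GelfandShilov.waveFrontSet hν hμ ψ u) ∧
      (μ * ((m : ℝ) - 1) < ν →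
        ∀ (u : GelfandShilov.Dual d ν μ) (φ ψ : GelfandShilov d ν μ), φ ≠ 0 → ψ ≠ 0 →
          GelfandShilov.waveFrontSet hν hμ φ (L u) = GelfandShilov.waveFrontSet hν hμ ψ u) := by
  -- For `d = 0` the supremum of the degrees over the empty set is `0`, against `m ≥ 2`.
  have hd : 0 < d := by
    rcases Nat.eq_zero_or_pos d with rfl | hd
    · simp at hm
      omega
    · exact hd
  have hν1 : 1 < ν := h1.trans_le h2
  have hp : ∀ j, (p j).natDegree ≤ m := fun j => by
    rw [hm]
    exact Finset.le_sup (f := fun j => (p j).natDegree) (Finset.mem_univ j)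
  have hq' : ∀ j, (Polynomial.derivative (q j)).natDegree ≤ m := fun j => by
    rw [hq]
    exact hp j
  obtain ⟨n, hmn⟩ : ∃ n, m = n + 1 := ⟨m - 1, by omega⟩
  have hcast : (m : ℝ) - 1 = n := by rw [hmn]; push_cast; ring
  have hcoeff : ∀ (τ : ℝ) (j : Fin d),
      (Polynomial.derivative (Airy.phasePoly q v (-τ) j)).coeff n = τ * ((p j).coeff m * m) :=
    fun τ j => by
      rw [GelfandShilov.coeff_derivative_phasePoly q (hv j) (hmn ▸ hq' j), hq, ← hmn]
  have hL : ∀ f : GelfandShilov d ν μ,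
      GelfandShilov.dualPropagator hd hν1 hν hμ hm2 h2 q hq' v t f.toDual =
        (GelfandShilov.gsPropagator hd hν1 hν hμ hm2 h2 q hq' v t f).toDual := fun f =>
    GelfandShilov.dualPropagator_ofIntegrable hd hν1 hν hμ hm2 h2 q hq' v t (f.toSchwartz hν)
  refine ⟨GelfandShilov.gsPropagator hd hν1 hν hμ hm2 h2 q hq' v t, fun f => ?_,
    GelfandShilov.dualPropagator hd hν1 hν hμ hm2 h2 q hq' v t, hL, fun L' hL' => ?_, fun f => ?_, ?_, ?_⟩
  · rw [GelfandShilov.coe_gsPropagator, Airy.coe_schwartzPropagator]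
    rfl
  · exact GelfandShilov.eq_of_eq_on_toDual hν fun f => (hL' f).trans (hL f).symm
  · exact ⟨Airy.schwartzPropagator q v t f, Airy.coe_schwartzPropagator q v t f,
      GelfandShilov.dualPropagator_ofIntegrable hd hν1 hν hμ hm2 h2 q hq' v t f⟩
  · intro heq u φ ψ hφ hψ
    rw [Airy.hamiltonFlow_eq hp, show m - 1 = n by omega]
    -- With exponent `0` the rescaled leading coefficient is constant, so the limit flow is the
    -- Hamilton flow.
    have hexp : μ * n - ν = 0 := by rw [← hcast, heq, sub_self]
    refine GelfandShilov.waveFrontSet_dualPropagator hd hν1 hν hμ hm2 h2 q hq' v t hmn (fun j => ?_)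
      (fun j => ?_) u hφ hψ
    · simp only [hexp, Real.rpow_zero, one_mul, hcoeff]
      exact tendsto_const_nhds
    · simp only [hexp, Real.rpow_zero, one_mul, hcoeff, Pi.neg_apply, neg_mul]
      exact tendsto_const_nhds
  · intro hlt u φ ψ hφ hψ
    -- With a negative power of `s` the leading coefficient is scaled away too, so `θ = 0` and the
    -- limit flow is the identity.
    have hexp : 0 < ν - μ * n := by rw [← hcast]; linarith
    have hlim : ∀ c : ℝ, Filter.Tendsto (fun s : ℝ => s ^ (μ * n - ν) * c) Filter.atTop
        (nhds 0) := fun c => by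
      have := (tendsto_rpow_neg_atTop hexp).mul_const c
      simpa using this
    rw [GelfandShilov.waveFrontSet_dualPropagator hd hν1 hν hμ hm2 h2 q hq' v t hmn (θ := 0)
      (fun j => hlim _) (fun j => by simpa using hlim _) u hφ hψ,
      show GS.monomialFlow (0 : Fin d → ℝ) n = id from funext (GS.monomialFlow_zero n), Set.image_id]
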